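/- **Theorem.** The finite synthesis problem for the interval temporal logic $AB\bar B{\sim}$ is decidable: there is an algorithm which, given an $AB\bar B{\sim}$ formula $\varphi$ and a set $\Sigma^T_{\Box}\subseteq\Sigma^T$ (both finite objects), decides whether $(\varphi,\Sigma^T_{\Box})$ admits a finite synthesis. The notions are as follows. *Logic.* Formulas are built from proposition letters, one of which is the special letter $\sim$, by $\neg,\vee$ and the modalities $\langle A\rangle,\langle B\rangle,\langle\bar B\rangle$; $[R]\psi$ abbreviates $\neg\langle R\rangle\neg\psi$. They are interpreted on the closed intervals $[x,y]$, $x\le y$, of a linear order $D$ with a valuation $\mathcal V$ that maps each interval to a set of letters: $[x,y]\models p$ iff $p\in\mathcal V([x,y])$, Boolean connectives as usual, and $I\models\langle R\rangle\psi$ iff $J\models\psi$ for some $J$ with $I\,R\,J$, where $[x,y]\,A\,[x',y']$ iff $y=x'$; $[x,y]\,B\,[x',y']$ iff $x=x'$ and $y'<y$; $[x,y]\,\bar B\,[x',y']$ iff $x=x'$ and $y<y'$. The letter $\sim$ must be interpreted as an equivalence relation: there is an equivalence relation $E$ on $D$ with $\sim\,\in\mathcal V([x,y])$ iff $x\,E\,y$,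 for all $x\le y$. *Alphabet.* Let $\Sigma$ be the set of letters occurring in $\varphi$, let $Cl(\varphi)$ be the set of subformulas of $\varphi$ and their negations ($\neg\neg\psi$ being identified with $\psi$ everywhere), and let $\Sigma^T=\Sigma\cup TF^+(\varphi)$ with $TF^+(\varphi)=\{\langle R\rangle\psi: R\in\{A,B,\bar B\},\ \psi\in Cl(\varphi)\}$. Spoiler controls $\Sigma^T_\Box$, duplicator controls $\Sigma^T\setminus\Sigma^T_\Box$. *Runs.* An admissible run is a finite or infinite sequence $\rho=([x_0,y_0],\sigma_0)([x_1,y_1],\sigma_1)\ldots$ of intervals over $\mathbb N$ with subsets of $\Sigma^T$ such that: (1) if $\rho$ is infinite, every interval over $\mathbb N$ occurs in it; if it is finite, there is $m>0$ such that its length is $m(m+1)$ and every interval over $\{0,\ldots,m-1\}$ occurs in it; (2) $[x_0,y_0]=[0,0]$, and for every even $i$: $[x_i,y_i]=[x_{i+1},y_{i+1}]$, $\sigma_i\subseteq\Sigma^T_\Box$, $\sigma_{i+1}\subseteq\Sigma^T\setminus\Sigma^T_\Box$, and $[x_j,y_j]\ne[x_i,y_i]$ for all $j\notin\{i,i+1\}$;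 (3) if $y_{i+1}\neq y_i$, then $y_{i+1}=y_i+1$ and every interval $[x,y]$ with $y<y_{i+1}$ equals some $[x_j,y_j]$ with $j<i+1$. A finite admissible run of length $m(m+1)$ induces a structure over $\{0<\cdots<m-1\}$: if $[x,y]=[x_i,y_i]$ with $i$ even, the label of $[x,y]$ is $\sigma_i\cup\sigma_{i+1}$, and $\mathcal V([x,y])$ is the set of letters in it. The run is successful if, in the induced structure, $\sim$ is interpreted as an equivalence relation (a condition imposed only when $\sim\,\in\Sigma$), $[0,0]\models\varphi$, and for every interval $I$ and every $\psi\in TF^+(\varphi)$, $I\models\psi$ iff $\psi$ belongs to the label of $I$. *Finite synthesis.* A response strategy is a function $S$ from the odd-length finite prefixes of admissible runs to the subsets of $\Sigma^T\setminus\Sigma^T_\Box$. A spoiler sequence is a sequence $(\rho[2i])_{i\in\mathbb N}$ for some infinite admissible run $\rho$. The response of $S$ to a spoiler sequence $\rho_\Box$ is the infinite run $\rho$ with $\rho[2i]=\rho_\Box[i]$ and $\rho[2i+1]=(I_i,S(\rho[0]\ldots\rho[2i]))$ for all $i$, where $I_i$ is the interval of $\rho[2i]$. The pair $(\varphi,\Sigma^T_\Box)$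 admits a finite synthesis if there is a response strategy $S$ such that, for every spoiler sequence, the response of $S$ has a finite prefix which is a successful admissible run. -/

import Mathlib

namespace ABBSim

/-! ### Syntax -/

/-- Proposition letters are natural numbers; the letter `sim` is the special letter `∼`. -/
abbrev Letter := ℕ

/-- The special proposition letter `∼`. -/
def sim : Letter := 0

/-- The three modalities `⟨A⟩` (meets), `⟨B⟩` (begun by) and `⟨B̄⟩` (begins). -/
inductive Modality
  | A
  | B
  | Bbar
  deriving DecidableEq

/-- Formulas of the logic with modalities `A`, `B`, `B̄` and the letter `∼`. -/
inductive Formula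
  | atom (p : Letter)
  | neg (f : Formula)
  | or (f g : Formula)
  | dia (R : Modality) (f : Formula)
  deriving DecidableEq

namespace Formula

/-! ### Formulas as finite objects: a numbering -/

/-- The number of a formula. -/
def toNat : Formula → ℕ
  | atom p => 6 * p
  | neg f => 6 * f.toNat + 1
  | or f g => 6 * Nat.pair f.toNat g.toNat + 2
  | dia Modality.A f => 6 * f.toNat + 3
  | dia Modality.B f => 6 * f.toNat + 4
  | dia Modality.Bbar f => 6 * f.toNat + 5

/-- The formula with a given number. -/
def ofNat (n : ℕ) : Formula :=
  if h0 : n % 6 = 0 then atom (n / 6)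
  else
    have h1 : n / 6 < n := by omega
    have _h2 : (n / 6).unpair.1 < n := lt_of_le_of_lt (Nat.unpair_left_le _) h1
    have _h3 : (n / 6).unpair.2 < n := lt_of_le_of_lt (Nat.unpair_right_le _) h1
    if n % 6 = 1 then neg (ofNat (n / 6))
    else if n % 6 = 2 then or (ofNat (n / 6).unpair.1) (ofNat (n / 6).unpair.2)
    else if n % 6 = 3 then dia Modality.A (ofNat (n / 6))
    else if n % 6 = 4 then dia Modality.B (ofNat (n / 6))
    else dia Modality.Bbar (ofNat (n / 6))
  termination_by n

theorem ofNat_toNat (f : Formula) : ofNat f.toNat = f := by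
  induction f with
  | atom p =>
    rw [ofNat, dif_pos (by simp only [toNat]; omega)]
    simp only [toNat]
    rw [Nat.mul_div_cancel_left p (by norm_num : 0 < 6)]
  | neg f ih =>
    have h1 : (6 * f.toNat + 1) % 6 = 1 := by omega
    have h2 : (6 * f.toNat + 1) / 6 = f.toNat := by omega
    rw [toNat, ofNat]
    simp [h1, h2, ih]
  | or f g ihf ihg =>
    have h1 : (6 * Nat.pair f.toNat g.toNat + 2) % 6 = 2 := by omega
    have h2 : (6 * Nat.pair f.toNat g.toNat + 2) / 6 = Nat.pair f.toNat g.toNat := by omega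
    rw [toNat, ofNat]
    simp [h1, h2, ihf, ihg]
  | dia R f ih =>
    cases R
    · have h1 : (6 * f.toNat + 3) % 6 = 3 := by omega
      have h2 : (6 * f.toNat + 3) / 6 = f.toNat := by omega
      rw [toNat, ofNat]
      simp [h1, h2, ih]
    · have h1 : (6 * f.toNat + 4) % 6 = 4 := by omega
      have h2 : (6 * f.toNat + 4) / 6 = f.toNat := by omega
      rw [toNat, ofNat]
      simp [h1, h2, ih]
    · have h1 : (6 * f.toNat + 5) % 6 = 5 := by omega
      have h2 : (6 * f.toNat + 5) / 6 = f.toNat := by omega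
      rw [toNat, ofNat]
      simp [h1, h2, ih]

theorem toNat_ofNat (n : ℕ) : (ofNat n).toNat = n := by
  induction n using Nat.strong_induction_on with
  | _ n ih =>
    rw [ofNat]
    by_cases h0 : n % 6 = 0
    · rw [dif_pos h0, toNat]
      omega
    · rw [dif_neg h0]
      have h1 : n / 6 < n := by omega
      have h2 : (n / 6).unpair.1 < n := lt_of_le_of_lt (Nat.unpair_left_le _) h1
      have h3 : (n / 6).unpair.2 < n := lt_of_le_of_lt (Nat.unpair_right_le _) h1
      split_ifs
      · rw [toNat, ih _ h1]; omega
      · rw [toNat, ih _ h2, ih _ h3, Nat.pair_unpair]; omega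
      · rw [toNat, ih _ h1]; omega
      · rw [toNat, ih _ h1]; omega
      · rw [toNat, ih _ h1]; omega

/-- The numbering is a bijection, so formulas are legitimate inputs of algorithms. -/
instance instDenumerable : Denumerable Formula :=
  Denumerable.mk' ⟨toNat, ofNat, ofNat_toNat, toNat_ofNat⟩

/-! ### Subformulas and closures -/

/-- The set of all subformulas of a formula. -/
def subformulas : Formula → Finset Formula
  | atom p => {atom p}
  | neg f => insert (neg f) f.subformulas
  | or f g => insert (or f g) (f.subformulas ∪ g.subformulas)
  | dia R f => insert (dia R f) f.subformulas

/-- Negation, where `¬¬f` is identified with `f`. -/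
def negate : Formula → Formula
  | neg f => f
  | f => neg f

/-- The representative of a formula under the identification of `¬¬f` with `f`
(performed everywhere inside the formula). As `[R]f` stands for `¬⟨R⟩¬f`, this also identifies
`¬⟨R⟩f` with `[R]¬f`. -/
def reduce : Formula → Formula
  | atom p => atom p
  | neg f => negate f.reduce
  | or f g => or f.reduce g.reduce
  | dia R f => dia R f.reduce

/-- The box modality `[R]f = ¬⟨R⟩¬f`. -/
def box (R : Modality) (f : Formula) : Formula := neg (dia R (neg f))

/-- The closure: all subformulas and their negations, up to the identification above. -/
def closure (φ : Formula) : Finset Formula :=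
  (φ.subformulas ∪ φ.subformulas.image neg).image reduce

/-- All formulas `⟨R⟩ψ` and `[R]ψ` for `ψ ∈ closure φ`, up to the identification above. -/
def requests (R : Modality) (φ : Formula) : Finset Formula :=
  (φ.closure.image (dia R) ∪ φ.closure.image (box R)).image reduce

/-- The extended closure. -/
def extendedClosure (φ : Formula) : Finset Formula :=
  φ.closure ∪ (requests Modality.A φ ∪ requests Modality.B φ ∪ requests Modality.Bbar φ)

/-- `f` has the form `⟨R⟩ψ`. -/
def isDia : Formula → Bool
  | dia _ _ => true
  | _ => false

/-- `f` is a proposition letter. -/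
def isAtom : Formula → Bool
  | atom _ => true
  | _ => false

/-- The temporal formulas `⟨R⟩ψ` of the extended closure. -/
def temporal (φ : Formula) : Finset Formula := φ.extendedClosure.filter (fun f => f.isDia)

/-- The proposition letters occurring in `φ` (as formulas). -/
def letters (φ : Formula) : Finset Formula := φ.subformulas.filter (fun f => f.isAtom)

/-- The set `Σ^T` of the proposition letters of `φ` and its temporal requests, that is, of
everything whose truth value is chosen by one of the two players. -/
def alphabet (φ : Formula) : Finset Formula := φ.letters ∪ φ.temporal

end Formula

/-! ### Semantics -/

/-- Allen's relations between the closed intervals `[x,y]`, `x ≤ y`, of a linear order. -/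
def Modality.Rel {D : Type*} [LinearOrder D] :
    Modality → NonemptyInterval D → NonemptyInterval D → Prop
  | Modality.A, I, J => I.snd = J.fst
  | Modality.B, I, J => I.fst = J.fst ∧ J.snd < I.snd
  | Modality.Bbar, I, J => I.fst = J.fst ∧ I.snd < J.snd

/-- Truth of a formula on an interval of the interval structure with temporal domain `D` and
valuation `V`. -/
def Sat {D : Type*} [LinearOrder D] (V : NonemptyInterval D → Set Letter) :
    NonemptyInterval D → Formula → Prop
  | I, Formula.atom p => p ∈ V I
  | I, Formula.neg f => ¬ Sat V I f
  | I, Formula.or f g => Sat V I f ∨ Sat V I g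
  | I, Formula.dia R f => ∃ J, R.Rel I J ∧ Sat V J f

/-- The letter `∼` is interpreted by `V` as an equivalence relation over `D`. -/
def InterpretsSim {D : Type*} [LinearOrder D] (V : NonemptyInterval D → Set Letter) : Prop :=
  ∃ E : Setoid D, ∀ I : NonemptyInterval D, sim ∈ V I ↔ E I.fst I.snd

/-! ### Runs -/

/-- A move: an interval over `ℕ` and the set of letters and requests put on it. -/
abbrev Move := NonemptyInterval ℕ × Finset Formula

/-- The sequence `ρ 0, ρ 1, …` cut at length `N` (`N = ⊤` for an infinite sequence) is an
admissible run on `(φ, Spo)`, where `Spo` is the part of the alphabet controlled by spoiler.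
A finite admissible run visits exactly the `m(m+1)/2` intervals over `{0, …, m-1}`, each in two
consecutive moves (one of spoiler, one of duplicator), so its length is `m(m+1)`. -/
structure IsAdmissibleRun (φ : Formula) (Spo : Finset Formula) (N : ℕ∞) (ρ : ℕ → Move) :
    Prop where
  finite_or_infinite :
    (∃ m : ℕ, 0 < m ∧ N = ((m * (m + 1) : ℕ) : ℕ∞) ∧
      ∀ I : NonemptyInterval ℕ, I.snd < m → ∃ i : ℕ, (i : ℕ∞) < N ∧ (ρ i).1 = I) ∨
    (N = ⊤ ∧ ∀ I : NonemptyInterval ℕ, ∃ i : ℕ, (ρ i).1 = I)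
  start : (ρ 0).1 = NonemptyInterval.pure 0
  round : ∀ i : ℕ, Even i → (i : ℕ∞) < N →
    (ρ (i + 1)).1 = (ρ i).1 ∧ (ρ i).2 ⊆ Spo ∧ (ρ (i + 1)).2 ⊆ φ.alphabet \ Spo ∧
      ∀ j : ℕ, (j : ℕ∞) < N → j ≠ i → j ≠ i + 1 → (ρ j).1 ≠ (ρ i).1
  order : ∀ i : ℕ, ((i + 1 : ℕ) : ℕ∞) < N → (ρ (i + 1)).1.snd ≠ (ρ i).1.snd →
    (ρ (i + 1)).1.snd = (ρ i).1.snd + 1 ∧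
      ∀ I : NonemptyInterval ℕ, I.snd < (ρ (i + 1)).1.snd → ∃ j < i + 1, (ρ j).1 = I

/-- The odd-length finite prefixes of admissible runs (the last move is one of spoiler). -/
def oddPrefixes (φ : Formula) (Spo : Finset Formula) : Set (List Move) :=
  {h | ∃ (N : ℕ∞) (ρ : ℕ → Move), IsAdmissibleRun φ Spo N ρ ∧
    ∃ k : ℕ, Odd k ∧ (k : ℕ∞) ≤ N ∧ h = List.ofFn (fun j : Fin k => ρ j)}

/-- The infinite sequences of spoiler's moves in infinite admissible runs. -/
def spoilerRuns (φ : Formula) (Spo : Finset Formula) : Set (ℕ → Move) :=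
  {ρs | ∃ ρ : ℕ → Move, IsAdmissibleRun φ Spo ⊤ ρ ∧ ∀ i, ρs i = ρ (2 * i)}

/-- `S` is a response strategy: it maps every odd-length prefix to a set of letters and requests
controlled by duplicator (its values on other lists play no role). -/
def IsResponseStrategy (φ : Formula) (Spo : Finset Formula) (S : List Move → Finset Formula) :
    Prop :=
  ∀ h ∈ oddPrefixes φ Spo, S h ⊆ φ.alphabet \ Spo

/-- The response `ρ` of `S` to `ρs`: `ρ (2i) = ρs i`, and `ρ (2i+1)` is the same interval with the
label that `S` gives to `ρ 0, …, ρ (2i)`. -/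
def response (S : List Move → Finset Formula) (ρs : ℕ → Move) (n : ℕ) : Move :=
  if n % 2 = 0 then ρs (n / 2)
  else ((ρs (n / 2)).1, S (List.ofFn (fun j : Fin n => response S ρs j)))
  termination_by n
  decreasing_by exact j.2

/-! ### Successful runs and finite synthesis -/

/-- An interval over `{0, …, m-1}` as an interval over `ℕ`. -/
def liftInterval {m : ℕ} (I : NonemptyInterval (Fin m)) : NonemptyInterval ℕ :=
  ⟨(I.fst.val, I.snd.val), I.fst_le_snd⟩

/-- The set of all letters and requests put on the interval `I`, by either player, in the first
`N` moves of `ρ`. -/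
def labelOn (N : ℕ) (ρ : ℕ → Move) (I : NonemptyInterval ℕ) : Set Formula :=
  {ψ | ∃ i : ℕ, Even i ∧ i < N ∧ (ρ i).1 = I ∧ (ψ ∈ (ρ i).2 ∨ ψ ∈ (ρ (i + 1)).2)}

/-- The valuation of the structure over `{0, …, m-1}` induced by the run `ρ` cut at length
`m(m+1)`. -/
def inducedValuation (m : ℕ) (ρ : ℕ → Move) (I : NonemptyInterval (Fin m)) : Set Letter :=
  {p | Formula.atom p ∈ labelOn (m * (m + 1)) ρ (liftInterval I)}

/-- The admissible run `ρ` cut at length `m(m+1)`, with `m > 0`, is successful: the induced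
structure interprets `∼` as an equivalence relation (if `∼` is one of the letters at all), it
satisfies `φ` on `[0,0]`, and every temporal request of `φ` is true on an interval if and only if
it is in the label of that interval. -/
def IsSuccessful (φ : Formula) (m : ℕ) (hm : 0 < m) (ρ : ℕ → Move) : Prop :=
  (Formula.atom sim ∈ φ.letters → InterpretsSim (inducedValuation m ρ)) ∧
  Sat (inducedValuation m ρ) (NonemptyInterval.pure ⟨0, hm⟩) φ ∧
  ∀ I : NonemptyInterval (Fin m), ∀ ψ ∈ φ.temporal,
    Sat (inducedValuation m ρ) I ψ ↔ ψ ∈ labelOn (m * (m + 1)) ρ (liftInterval I)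

/-- The pair `(φ, Spo)` admits a finite synthesis: duplicator has a response strategy such that
the response to every infinite sequence of spoiler's moves has a finite prefix which is a
successful admissible run. -/
def AdmitsFiniteSynthesis (φ : Formula) (Spo : Finset Formula) : Prop :=
  ∃ S : List Move → Finset Formula, IsResponseStrategy φ Spo S ∧
    ∀ ρs ∈ spoilerRuns φ Spo, ∃ (m : ℕ) (hm : 0 < m),
      IsAdmissibleRun φ Spo ((m * (m + 1) : ℕ) : ℕ∞) (response S ρs) ∧
      IsSuccessful φ m hm (response S ρs)

/-- The positive instances of the finite synthesis problem. An input is a formula `φ` with a finite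
list of formulas, which lists the elements of the set `Spo ⊆ Σ^T` controlled by spoiler. -/
def FiniteSynthesisProblem (x : Formula × List Formula) : Prop :=
  x.2.toFinset ⊆ x.1.alphabet ∧ AdmitsFiniteSynthesis x.1 x.2.toFinset

end ABBSim

/-!
# Decidability of the finite synthesis problem

A run labels the intervals `[x, y]` over `ℕ` column by column, where the column of `[x, y]` is `y`
and its row is `x`. That the temporal requests in the labels are true is a local condition: it
relates consecutive labels in a row, and each label to that of the point interval in its column
(`coherent_iff_local`). When a column is complete, the future of the game therefore depends only
on the *configuration*: the points seen so far, with the equivalence relation that `∼` declares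
on them, each point coloured by the last label in its row.

If one configuration embeds in another, and the duplicator wins from the larger one within `k`
columns, then she wins from the smaller one within `k` columns as well (`Arena.Win.of_embed`): in
the larger game the spoiler may label the additional rows first, and she copies her answers in the
others. Finite equivalence relations coloured by a finite set are well-quasi-ordered by embedding,
by Higman's lemma applied twice (`exists_embedding_of_finite_colours`).

Hence both players have finite certificates. A win of the duplicator is derived by the rules
`Arena.WinRule` in finitely many steps, since she needs only finitely many columns and the spoiler
has finitely many moves. For the spoiler it is enough to force an invalid labelling or a
configuration in which an earlier one embeds (`Arena.LoseRule`): were such a configuration won,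
an earlier one would be won equally fast, although a duplicator who plays as fast as possible
comes closer to her goal with each column (`Arena.not_force_of_derivable`). If neither player had
a certificate, an infinite play without such pairs of configurations would contradict the
well-quasi-order (`Arena.derivable_loseRule_of_not`).

Admissible runs and response strategies translate into plays of this game
(`admitsFiniteSynthesis_iff`), and whether a finite list of positions is a certificate is a
primitive recursive condition. So the problem and its complement are both recursively enumerable,
and the problem is decidable.
-/

namespace ABBSim

/-! ### The column game -/

/-- The data of a labelling game on the intervals `[x, y]`, `x ≤ y`, over `ℕ`. The interval
`[x, y]` is the pair `(x, y)`; it lies in *row* `x` and *column* `y`. Column after column, the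
spoiler chooses an unlabelled row and a move `s`, and the duplicator completes `s` to a label. The
requirements on the labels are local: they concern single labels, consecutive labels of a row, and
labels of a column. -/
structure Arena (σ Λ : Type) where
  /-- The moves of the spoiler. -/
  opts : List σ
  /-- The labels to which the duplicator can complete a move of the spoiler. -/
  menu : σ → List Λ
  /-- The requirement on the label of `[0, 0]`. -/
  start : Λ → Prop
  /-- The requirement on the first label of a row, that of `[x, x]`. -/
  init : Λ → Prop
  /-- The requirement on the labels of the last column. -/
  final : Λ → Prop
  /-- The label declares the endpoints of its interval to be equivalent. -/
  sm : Λ → Prop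
  /-- The requirement on consecutive labels of a row. -/
  step : Λ → Λ → Prop
  /-- The requirement on a label and the label of the point interval in the same column. -/
  col : Λ → Λ → Prop

namespace Arena

variable {σ Λ : Type} (G : Arena σ Λ)

/-- The relation on points that the labelling `L` declares, made symmetric because only pairs `(x,
y)` with `x ≤ y` are intervals. -/
def Rel (L : ℕ × ℕ → Λ) (x y : ℕ) : Prop := G.sm (L (min x y, max x y))

/-- The labels in the first `n` columns meet all requirements except those on the last column, and
declare an equivalence relation on the first `n` points. -/
structure Valid (n : ℕ) (L : ℕ × ℕ → Λ) : Prop where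
  start : 0 < n → G.start (L (0, 0))
  init : ∀ x < n, G.init (L (x, x))
  step : ∀ x y, x ≤ y → y + 1 < n → G.step (L (x, y)) (L (x, y + 1))
  col : ∀ x y, x ≤ y → y < n → G.col (L (x, y)) (L (y, y))
  refl : ∀ x < n, G.Rel L x x
  trans : ∀ x < n, ∀ y < n, ∀ z < n, G.Rel L x y → G.Rel L y z → G.Rel L x z

/-- The first `n` columns form a finished game that the duplicator has won. -/
def Success (n : ℕ) (L : ℕ × ℕ → Λ) : Prop :=
  0 < n ∧ G.Valid n L ∧ ∀ x < n, G.final (L (x, n - 1))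

/-- The map `f` embeds the configuration of `L` after `n` columns into that of `L'` after `n'`
columns. A configuration is the set of points with the declared relation, each point coloured by
the last label of its row. Injectivity is part of the condition. -/
def Embed (n : ℕ) (L : ℕ × ℕ → Λ) (n' : ℕ) (L' : ℕ × ℕ → Λ) (f : ℕ → ℕ) : Prop :=
  ∀ x < n, f x < n' ∧ L (x, n - 1) = L' (f x, n' - 1) ∧
    ∀ y < n, (f x = f y → x = y) ∧ (G.Rel L x y ↔ G.Rel L' (f x) (f y))

/-- The duplicator can answer the next `c` moves of the spoiler in column `n`, whose unlabelled
rows are those in `U`, so that the resulting labelling satisfies `T`. -/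
def Force (n : ℕ) (T : (ℕ × ℕ → Λ) → Prop) : ℕ → Finset ℕ → (ℕ × ℕ → Λ) → Prop
  | 0, _, L => T L
  | c + 1, U, L => ∀ x ∈ U, ∀ s ∈ G.opts, ∃ l ∈ G.menu s,
      Force n T c (U.erase x) (Function.update L (x, n) l)

/-- With the first `n` columns labelled by `L`, the duplicator can force success within `k` further
columns. -/
def Win : ℕ → ℕ → (ℕ × ℕ → Λ) → Prop
  | 0, n, L => G.Success n L
  | k + 1, n, L => G.Success n L ∨
      G.Force n (fun L' => Win k (n + 1) L') (n + 1) (Finset.range (n + 1)) L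

/-- The labellings agree outside column `n`. -/
def AgreeOff (n : ℕ) (L L' : ℕ × ℕ → Λ) : Prop := ∀ p : ℕ × ℕ, p.2 ≠ n → L p = L' p

theorem AgreeOff.refl (n : ℕ) (L : ℕ × ℕ → Λ) : AgreeOff n L L := fun _ _ => rfl

theorem AgreeOff.update {n : ℕ} {L L' : ℕ × ℕ → Λ} (h : AgreeOff n L L') (x : ℕ) (l : Λ) :
    AgreeOff n L (Function.update L' (x, n) l) := by
  intro p hp
  rw [Function.update_of_ne, h p hp]
  rintro rfl
  exact hp rfl

variable {G}

theorem Valid.congr {n : ℕ} {L L' : ℕ × ℕ → Λ} (hL : ∀ p : ℕ × ℕ, p.2 < n → L p = L' p)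
    (h : G.Valid n L) : G.Valid n L' where
  start hn := by rw [← hL _ hn]; exact h.start hn
  init x hx := by rw [← hL _ hx]; exact h.init x hx
  step x y hxy hy := by
    rw [← hL (x, y) (by simp; omega), ← hL (x, y + 1) hy]; exact h.step x y hxy hy
  col x y hxy hy := by rw [← hL (x, y) hy, ← hL (y, y) hy]; exact h.col x y hxy hy
  refl x hx := by
    have := h.refl x hx
    unfold Rel at *
    rwa [← hL _ (by simpa using hx)]
  trans x hx y hy z hz := by
    have := h.trans x hx y hy z hz
    unfold Rel at *
    rwa [← hL _ (by simp [hx, hy]), ← hL _ (by simp [hy, hz]), ← hL _ (by simp [hx, hz])]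

theorem Valid.mono {n n' : ℕ} {L : ℕ × ℕ → Λ} (hn : n ≤ n') (h : G.Valid n' L) :
    G.Valid n L where
  start h0 := h.start (by omega)
  init x hx := h.init x (by omega)
  step x y hxy hy := h.step x y hxy (by omega)
  col x y hxy hy := h.col x y hxy (by omega)
  refl x hx := h.refl x (by omega)
  trans x hx y hy z hz := h.trans x (by omega) y (by omega) z (by omega)

theorem Force.mono {n : ℕ} {T T' : (ℕ × ℕ → Λ) → Prop} (hT : ∀ L, T L → T' L) {c : ℕ}
    {U : Finset ℕ} {L : ℕ × ℕ → Λ} (h : G.Force n T c U L) : G.Force n T' c U L := by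
  induction c generalizing U L with
  | zero => exact hT L h
  | succ c ih =>
    intro x hx s hs
    obtain ⟨l, hl, h'⟩ := h x hx s hs
    exact ⟨l, hl, ih h'⟩

theorem Win.succ {k n : ℕ} {L : ℕ × ℕ → Λ} (h : G.Win k n L) : G.Win (k + 1) n L := by
  induction k generalizing n L with
  | zero => exact Or.inl h
  | succ k ih => exact h.imp_right fun h => h.mono fun L hL => ih hL

theorem Win.mono {k k' n : ℕ} {L : ℕ × ℕ → Λ} (hk : k ≤ k') (h : G.Win k n L) :
    G.Win k' n L := by
  induction hk with
  | refl => exact h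
  | step _ ih => exact ih.succ

/-- The rows in `V` may be filled before all others, whatever the duplicator's answers are. -/
theorem Force.fill (hs : ∃ s, s ∈ G.opts) {n : ℕ} {T : (ℕ × ℕ → Λ) → Prop} {c : ℕ}
    (V : Finset ℕ) {U : Finset ℕ} {L : ℕ × ℕ → Λ} (hV : V ⊆ U)
    (h : G.Force n T (c + V.card) U L) :
    ∃ L', G.Force n T c (U \ V) L' ∧ AgreeOff n L L' := by
  induction V using Finset.induction_on generalizing U L with
  | empty => exact ⟨L, by simpa using h, .refl n L⟩
  | insert v V hv ih =>
    rw [Finset.card_insert_of_notMem hv, ← add_assoc] at h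
    obtain ⟨s, hs⟩ := hs
    obtain ⟨l, -, h'⟩ := h v (hV (Finset.mem_insert_self v V)) s hs
    obtain ⟨L', h1, h2⟩ := ih (fun x hx => Finset.mem_erase.2
      ⟨fun e => hv (by rwa [← e]), hV (Finset.mem_insert_of_mem hx)⟩) h'
    refine ⟨L', ?_, fun p hp => ?_⟩
    · convert h1 using 1
      ext x
      simp only [Finset.mem_sdiff, Finset.mem_insert, Finset.mem_erase]
      tauto
    · rw [← h2 p hp]
      exact (AgreeOff.refl n L).update v l p hp

/-- A target that can be forced can be reached. -/
theorem Force.exists_target (hs : ∃ s, s ∈ G.opts) {n : ℕ} {T : (ℕ × ℕ → Λ) → Prop}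
    {U : Finset ℕ} {L : ℕ × ℕ → Λ} (h : G.Force n T U.card U L) :
    ∃ L', T L' ∧ AgreeOff n L L' := by
  obtain ⟨L', h1, h2⟩ := Force.fill (c := 0) hs U (Finset.Subset.refl U) (by simpa using h)
  exact ⟨L', h1, h2⟩

theorem Win.valid (hs : ∃ s, s ∈ G.opts) {k n : ℕ} {L : ℕ × ℕ → Λ} (h : G.Win k n L) :
    G.Valid n L := by
  induction k generalizing n L with
  | zero => exact h.2.1
  | succ k ih =>
    rcases h with h | h
    · exact h.2.1
    · obtain ⟨L', h1, h2⟩ := Force.exists_target hs (by rwa [Finset.card_range])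
      exact ((ih h1).mono (Nat.le_succ n)).congr fun p hp => (h2 p hp.ne).symm

/-- If the unlabelled rows of column `n` are mapped injectively to rows of column `n'`, then the
duplicator can copy her answers from there, and what she forces in column `n'` she forces in column
`n`. -/
theorem Force.simulate {n n' : ℕ} {L L' : ℕ × ℕ → Λ} {T T' : (ℕ × ℕ → Λ) → Prop} {g : ℕ → ℕ}
    (hg : ∀ x ≤ n, ∀ y ≤ n, g x = g y → x = y)
    (hT : ∀ M M', AgreeOff n L M → AgreeOff n' L' M' → (∀ x ≤ n, M (x, n) = M' (g x, n')) →
      T' M' → T M)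
    {c : ℕ} {U : Finset ℕ} {M M' : ℕ × ℕ → Λ} (hc : c = U.card) (hU : ∀ x ∈ U, x ≤ n)
    (hM : AgreeOff n L M) (hM' : AgreeOff n' L' M')
    (heq : ∀ x ≤ n, x ∉ U → M (x, n) = M' (g x, n'))
    (h : G.Force n' T' c (U.image g) M') : G.Force n T c U M := by
  induction c generalizing U M M' with
  | zero =>
    have : U = ∅ := Finset.card_eq_zero.1 hc.symm
    subst this
    exact hT M M' hM hM' (fun x hx => heq x hx (by simp)) h
  | succ c ih =>
    intro x hx s hs
    obtain ⟨l, hl, h'⟩ := h (g x) (Finset.mem_image_of_mem g hx) s hs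
    refine ⟨l, hl, ih (M' := Function.update M' (g x, n') l) ?_ ?_ (hM.update x l)
      (hM'.update (g x) l) ?_ ?_⟩
    · rw [Finset.card_erase_of_mem hx]; omega
    · intro y hy; exact hU y (Finset.mem_of_mem_erase hy)
    · intro y hy hyU
      by_cases hyx : y = x
      · subst hyx; simp
      · rw [Function.update_of_ne (by simpa using hyx), Function.update_of_ne]
        · exact heq y hy fun hyU' => hyU (Finset.mem_erase.2 ⟨hyx, hyU'⟩)
        · intro e
          exact hyx (hg y hy x (hU x hx) (Prod.ext_iff.1 e).1)
    · convert h' using 1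
      ext z
      simp only [Finset.mem_image, Finset.mem_erase]
      constructor
      · rintro ⟨y, ⟨hyx, hyU⟩, rfl⟩
        exact ⟨fun e => hyx (hg y (hU y hyU) x (hU x hx) e), y, hyU, rfl⟩
      · rintro ⟨hz, y, hyU, rfl⟩
        exact ⟨y, ⟨fun e => hz (e ▸ rfl), hyU⟩, rfl⟩

theorem Rel.symm {L : ℕ × ℕ → Λ} {x y : ℕ} (h : G.Rel L x y) : G.Rel L y x := by
  unfold Rel at *; rwa [min_comm, max_comm]

/-- An embedding of configurations extends to the next column, with the new point mapped to the new
point, if corresponding rows receive the same label. -/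
theorem Embed.extend {n n' : ℕ} {L L' M M' : ℕ × ℕ → Λ} {f : ℕ → ℕ}
    (hf : G.Embed n L n' L' f) (hM : AgreeOff n L M) (hM' : AgreeOff n' L' M')
    (heq : ∀ x ≤ n, M (x, n) = M' (Function.update f n n' x, n')) :
    G.Embed (n + 1) M (n' + 1) M' (Function.update f n n') := by
  have hlt : ∀ x < n, Function.update f n n' x = f x := fun x hx =>
    Function.update_of_ne hx.ne _ _
  have hnew : ∀ x ≤ n, G.Rel M x n ↔ G.Rel M' (Function.update f n n' x) n' := by
    intro x hx
    have : Function.update f n n' x ≤ n' := by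
      rcases hx.lt_or_eq with h | rfl
      · rw [hlt x h]; exact (hf x h).1.le
      · simp
    unfold Rel
    rw [min_eq_left hx, max_eq_right hx, min_eq_left this, max_eq_right this, heq x hx]
  intro x hx
  have hx : x ≤ n := Nat.lt_succ_iff.1 hx
  refine ⟨?_, by simpa using heq x hx, fun y hy => ?_⟩
  · rcases hx.lt_or_eq with h | rfl
    · rw [hlt x h]; have := (hf x h).1; omega
    · simp
  have hy : y ≤ n := Nat.lt_succ_iff.1 hy
  rcases hx.lt_or_eq with hx' | rfl <;> rcases hy.lt_or_eq with hy' | rfl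
  · rw [hlt x hx', hlt y hy']
    refine ⟨((hf x hx').2.2 y hy').1, ?_⟩
    have h1 := ((hf x hx').2.2 y hy').2
    have h2 := (hf x hx').1
    have h3 := (hf y hy').1
    unfold Rel at *
    rw [← hM _ (by simp; omega), ← hM' _ (by simp; omega)]
    exact h1
  · refine ⟨fun e => ?_, ?_⟩
    · rw [hlt x hx', Function.update_self] at e
      have := (hf x hx').1; omega
    · have := hnew x hx
      simpa using this
  · refine ⟨fun e => ?_, ?_⟩
    · rw [hlt y hy', Function.update_self] at e
      have := (hf y hy').1; omega
    · have := hnew y hy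
      simp only [Function.update_self]
      exact ⟨fun h => (this.1 h.symm).symm, fun h => (this.2 h.symm).symm⟩
  · refine ⟨fun _ => rfl, ?_⟩
    have := hnew _ le_rfl
    simpa using this

/-- Under the conditions of `Embed.extend`, validity of the larger labelling passes to the smaller
one, because each requirement on the new column compares a label with the last one in its row or
within the new column. -/
theorem Embed.extend_valid {n n' : ℕ} {L L' M M' : ℕ × ℕ → Λ} {f : ℕ → ℕ} (hn : 0 < n)
    (hL : G.Valid n L) (hf : G.Embed n L n' L' f) (hM : AgreeOff n L M) (hM' : AgreeOff n' L' M')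
    (heq : ∀ x ≤ n, M (x, n) = M' (Function.update f n n' x, n')) (hV : G.Valid (n' + 1) M') :
    G.Valid (n + 1) M := by
  have hE := hf.extend hM hM' heq
  have hlt : ∀ x < n, Function.update f n n' x = f x := fun x hx =>
    Function.update_of_ne hx.ne _ _
  refine ⟨fun _ => ?_, fun x hx => ?_, fun x y hxy hy => ?_, fun x y hxy hy => ?_,
    fun x hx => ?_, fun x hx y hy z hz h1 h2 => ?_⟩
  · rw [← hM _ hn.ne]; exact hL.start hn
  · rcases (Nat.lt_succ_iff.1 hx).lt_or_eq with hx' | rfl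
    · rw [← hM _ hx'.ne]; exact hL.init x hx'
    · rw [heq _ le_rfl, Function.update_self]; exact hV.init n' (by omega)
  · rcases (Nat.lt_succ_iff.1 hy).lt_or_eq with hy' | rfl
    · rw [← hM (x, y) (by simp; omega), ← hM (x, y + 1) hy'.ne]
      exact hL.step x y hxy hy'
    · have hx : x < y + 1 := by omega
      have h1 := hf x hx
      rw [← hM (x, y) (by simp), heq x (by omega), hlt x hx]
      have h2 : L (x, y) = L' (f x, n' - 1) := h1.2.1
      rw [h2, hM' _ (by simp; omega)]
      have := hV.step (f x) (n' - 1) (by omega) (by omega)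
      rwa [Nat.sub_add_cancel (by omega)] at this
  · rcases (Nat.lt_succ_iff.1 hy).lt_or_eq with hy' | rfl
    · rw [← hM (x, y) hy'.ne, ← hM (y, y) hy'.ne]
      exact hL.col x y hxy hy'
    · rw [heq x hxy, heq y le_rfl, Function.update_self]
      refine hV.col _ _ ?_ (by omega)
      have := (hE x (by omega)).1
      omega
  · have h := hE x hx
    exact (h.2.2 x hx).2.2 (hV.refl _ h.1)
  · exact ((hE x hx).2.2 z hz).2.2 (hV.trans _ (hE x hx).1 _ (hE y hy).1 _ (hE z hz).1
      (((hE x hx).2.2 y hy).2.1 h1) (((hE y hy).2.2 z hz).2.1 h2))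

/-- Winning is inherited along embeddings. In the larger game the spoiler may fill the rows outside
the range of the embedding first; the duplicator's answers in the remaining rows are then copied to
the smaller game, and the new configurations are again related by an embedding. -/
theorem Win.of_embed (hs : ∃ s, s ∈ G.opts) {k n n' : ℕ} {L L' : ℕ × ℕ → Λ} {f : ℕ → ℕ}
    (hn : 0 < n) (hL : G.Valid n L) (hf : G.Embed n L n' L' f) (h : G.Win k n' L') :
    G.Win k n L := by
  have hsucc : G.Success n' L' → G.Success n L := fun h =>
    ⟨hn, hL, fun x hx => by rw [(hf x hx).2.1]; exact h.2.2 _ (hf x hx).1⟩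
  induction k generalizing n n' L L' f with
  | zero => exact hsucc h
  | succ k ih =>
    rcases h with h | h
    · exact Or.inl (hsucc h)
    right
    set g := Function.update f n n' with hg
    have hgn : g n = n' := by simp [hg]
    have hgx : ∀ x < n, g x = f x := fun x hx => by simp [hg, hx.ne]
    have hgle : ∀ x ≤ n, g x ≤ n' := by
      intro x hx
      rcases hx.lt_or_eq with h | rfl
      · rw [hgx x h]; exact (hf x h).1.le
      · exact hgn.le
    have hginj : ∀ x ≤ n, ∀ y ≤ n, g x = g y → x = y := by
      intro x hx y hy e
      rcases hx.lt_or_eq with hx' | rfl <;> rcases hy.lt_or_eq with hy' | rfl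
      · rw [hgx x hx', hgx y hy'] at e
        exact ((hf x hx').2.2 y hy').1 e
      · rw [hgx x hx', hgn] at e; have := (hf x hx').1; omega
      · rw [hgx y hy', hgn] at e; have := (hf y hy').1; omega
      · rfl
    have hsub : (Finset.range (n + 1)).image g ⊆ Finset.range (n' + 1) := by
      intro z hz
      obtain ⟨x, hx, rfl⟩ := Finset.mem_image.1 hz
      have := hgle x (by simp at hx; omega)
      simp; omega
    have hcard : ((Finset.range (n + 1)).image g).card = n + 1 := by
      rw [Finset.card_image_of_injOn, Finset.card_range]
      intro x hx y hy e
      simp only [Finset.coe_range, Set.mem_Iio] at hx hy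
      exact hginj x (by omega) y (by omega) e
    have hcard' : n + 1 + (Finset.range (n' + 1) \ (Finset.range (n + 1)).image g).card
        = n' + 1 := by
      rw [Finset.card_sdiff_of_subset hsub, hcard, Finset.card_range]
      have := Finset.card_le_card hsub
      rw [hcard, Finset.card_range] at this
      omega
    -- let the spoiler fill the rows outside the range of `g` in the larger game
    obtain ⟨M', h1, h2⟩ := Force.fill (c := n + 1) hs
      (Finset.range (n' + 1) \ (Finset.range (n + 1)).image g) Finset.sdiff_subset
      (by rw [hcard']; exact h)
    rw [Finset.sdiff_sdiff_eq_self hsub] at h1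
    refine Force.simulate (L := L) (L' := L') hginj ?_ (by simp)
      (fun x hx => by simp at hx; omega) (.refl n L) h2
      (fun x hx hxU => absurd (Finset.mem_range.2 (Nat.lt_succ_of_le hx)) hxU) h1
    intro M M' hM hM' heq hw
    have hE := hf.extend hM hM' heq
    have hV := hf.extend_valid hn hL hM hM' heq (hw.valid hs)
    exact ih (Nat.succ_pos n) hV hE hw fun h =>
      ⟨Nat.succ_pos n, hV, fun x hx => by rw [(hE x hx).2.1]; exact h.2.2 _ (hE x hx).1⟩

/-- Winning depends only on the columns labelled so far. -/
theorem Win.congr (hs : ∃ s, s ∈ G.opts) {k n : ℕ} {L L' : ℕ × ℕ → Λ} (hn : 0 < n)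
    (hL : ∀ p : ℕ × ℕ, p.2 < n → L p = L' p) (h : G.Win k n L) : G.Win k n L' := by
  refine Win.of_embed (f := id) hs hn ((h.valid hs).congr hL) (fun x hx => ⟨hx, ?_, ?_⟩) h
  · exact (hL _ (by simp; omega)).symm
  · intro y hy
    refine ⟨fun e => e, ?_⟩
    unfold Rel
    rw [id, id, hL _ (by simp [hx, hy])]

theorem exists_forall_list_of_monotone {ι : Type*} {P : ι → ℕ → Prop}
    (hP : ∀ i k k', k ≤ k' → P i k → P i k') (l : List ι) (h : ∀ i ∈ l, ∃ k, P i k) :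
    ∃ k, ∀ i ∈ l, P i k := by
  induction l with
  | nil => exact ⟨0, by simp⟩
  | cons i l ih =>
    obtain ⟨k, hk⟩ := ih fun j hj => h j (by simp [hj])
    obtain ⟨k', hk'⟩ := h i (by simp)
    refine ⟨max k k', fun j hj => ?_⟩
    rcases List.mem_cons.1 hj with rfl | hj
    · exact hP _ _ _ (le_max_right _ _) hk'
    · exact hP _ _ _ (le_max_left _ _) (hk j hj)

/-- As the spoiler has finitely many moves, the number of further columns can be bounded before a
column is played. -/
theorem Force.exists_rank {n c : ℕ} {U : Finset ℕ} {L : ℕ × ℕ → Λ}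
    (h : G.Force n (fun L' => ∃ k, G.Win k (n + 1) L') c U L) :
    ∃ k, G.Force n (G.Win k (n + 1)) c U L := by
  induction c generalizing U L with
  | zero => exact h
  | succ c ih =>
    have := exists_forall_list_of_monotone
      (P := fun (q : ℕ × σ) k => ∃ l ∈ G.menu q.2, G.Force n (G.Win k (n + 1)) c
        (U.erase q.1) (Function.update L (q.1, n) l))
      (fun q k k' hk ⟨l, hl, h⟩ => ⟨l, hl, h.mono fun L' hL' => hL'.mono hk⟩)
      (U.toList.product G.opts) (by
        rintro ⟨x, s⟩ hq
        rw [List.pair_mem_product, Finset.mem_toList] at hq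
        obtain ⟨l, hl, h'⟩ := h x hq.1 s hq.2
        obtain ⟨k, hk⟩ := ih h'
        exact ⟨k, l, hl, hk⟩)
    obtain ⟨k, hk⟩ := this
    exact ⟨k, fun x hx s hs' => hk (x, s) (by
      rw [List.pair_mem_product, Finset.mem_toList]; exact ⟨hx, hs'⟩)⟩

end Arena

/-! ### A well-quasi-order on coloured equivalence relations -/

/-- Pairing the members of a well-quasi-ordered set with tags that are ignored in comparisons
preserves the well-quasi-order. -/
theorem partiallyWellOrderedOn_snd {α β : Type*} {r : β → β → Prop} {s : Set β}
    (h : s.PartiallyWellOrderedOn r) :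
    {p : α × β | p.2 ∈ s}.PartiallyWellOrderedOn fun p q => r p.2 q.2 := by
  rw [Set.partiallyWellOrderedOn_iff_exists_lt] at h ⊢
  exact fun f hf => h (fun n => (f n).2) hf

/-- A relation on lists in the sense of Higman's lemma yields an injective map between their
members, if neither list has repetitions. -/
theorem exists_injOn_of_sublistForall₂ {α β : Type*} [Inhabited β] {R : α → β → Prop}
    {l : List α} {l' : List β} (hl : l.Nodup) (hl' : l'.Nodup) (h : List.SublistForall₂ R l l') :
    ∃ g : α → β, (∀ a ∈ l, g a ∈ l' ∧ R a (g a)) ∧ ∀ a ∈ l, ∀ b ∈ l, g a = g b → a = b := by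
  classical
  induction h with
  | nil => exact ⟨fun _ => default, by simp, by simp⟩
  | @cons a b l l' hab _ ih =>
    rw [List.nodup_cons] at hl hl'
    obtain ⟨g, h1, h2⟩ := ih hl.2 hl'.2
    have hne : ∀ c ∈ l, c ≠ a := fun c hc e => hl.1 (by rwa [← e])
    have hne' : ∀ c ∈ l, g c ≠ b := fun c hc e => hl'.1 (by rw [← e]; exact (h1 c hc).1)
    refine ⟨Function.update g a b, fun c hc => ?_, fun c hc d hd e => ?_⟩
    · rcases List.mem_cons.1 hc with rfl | hc
      · simp [hab]
      · rw [Function.update_of_ne (hne c hc)]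
        exact ⟨List.mem_cons_of_mem _ (h1 c hc).1, (h1 c hc).2⟩
    · rcases List.mem_cons.1 hc with hc' | hc' <;> rcases List.mem_cons.1 hd with hd' | hd'
      · rw [hc', hd']
      · rw [hc', Function.update_self, Function.update_of_ne (hne d hd')] at e
        exact absurd e.symm (hne' d hd')
      · rw [hd', Function.update_self, Function.update_of_ne (hne c hc')] at e
        exact absurd e (hne' c hc')
      · rw [Function.update_of_ne (hne c hc'), Function.update_of_ne (hne d hd')] at e
        exact h2 c hc' d hd' e
  | cons_right _ ih =>
    obtain ⟨g, h1, h2⟩ := ih hl (List.nodup_cons.1 hl').2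
    exact ⟨g, fun a ha => ⟨List.mem_cons_of_mem _ (h1 a ha).1, (h1 a ha).2⟩, h2⟩

open Classical in
/-- The least member of the class of `x` in the relation `E` on `{0, …, n-1}`. -/
noncomputable def leastRep (n : ℕ) (E : ℕ → ℕ → Prop) (x : ℕ) : ℕ := sInf {z | z < n ∧ E z x}

open Classical in
/-- The members of the class of `r`, each with its colour. -/
noncomputable def classList {Λ : Type*} (n : ℕ) (E : ℕ → ℕ → Prop) (c : ℕ → Λ) (r : ℕ) :
    List (ℕ × Λ) :=
  ((List.range n).filter (E r ·)).map fun x => (x, c x)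

open Classical in
/-- The classes of `E`, each with its least member. The numbers serve as tags only: they make the
lists free of repetitions and are ignored when lists are compared. -/
noncomputable def classesList {Λ : Type*} (n : ℕ) (E : ℕ → ℕ → Prop) (c : ℕ → Λ) :
    List (ℕ × List (ℕ × Λ)) :=
  ((List.range n).filter (fun r => leastRep n E r = r)).map fun r => (r, classList n E c r)

section classes

variable {Λ : Type*} {n : ℕ} {E : ℕ → ℕ → Prop} {c : ℕ → Λ}

theorem leastRep_spec (hr : ∀ x < n, E x x) {x : ℕ} (hx : x < n) :
    leastRep n E x < n ∧ E (leastRep n E x) x :=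
  Nat.sInf_mem (s := {z | z < n ∧ E z x}) ⟨x, hx, hr x hx⟩

theorem leastRep_congr (hs : ∀ x < n, ∀ y < n, E x y → E y x)
    (ht : ∀ x < n, ∀ y < n, ∀ z < n, E x y → E y z → E x z) {x y : ℕ} (hx : x < n) (hy : y < n)
    (h : E x y) : leastRep n E x = leastRep n E y := by
  unfold leastRep
  congr 1
  ext z
  exact ⟨fun hz => ⟨hz.1, ht z hz.1 x hx y hy hz.2 h⟩,
    fun hz => ⟨hz.1, ht z hz.1 y hy x hx hz.2 (hs x hx y hy h)⟩⟩

theorem mem_classList {r : ℕ} {p : ℕ × Λ} :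
    p ∈ classList n E c r ↔ p.1 < n ∧ E r p.1 ∧ p.2 = c p.1 := by
  rcases p with ⟨x, l⟩
  simp only [classList, List.mem_map, List.mem_filter, List.mem_range, decide_eq_true_eq,
    Prod.mk.injEq]
  constructor
  · rintro ⟨y, ⟨h1, h2⟩, rfl, rfl⟩; exact ⟨h1, h2, rfl⟩
  · rintro ⟨h1, h2, h3⟩; exact ⟨x, ⟨h1, h2⟩, rfl, h3.symm⟩

theorem mem_classesList {p : ℕ × List (ℕ × Λ)} :
    p ∈ classesList n E c ↔ p.1 < n ∧ leastRep n E p.1 = p.1 ∧ p.2 = classList n E c p.1 := by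
  rcases p with ⟨x, l⟩
  simp only [classesList, List.mem_map, List.mem_filter, List.mem_range, decide_eq_true_eq,
    Prod.mk.injEq]
  constructor
  · rintro ⟨y, ⟨h1, h2⟩, rfl, rfl⟩; exact ⟨h1, h2, rfl⟩
  · rintro ⟨h1, h2, h3⟩; exact ⟨x, ⟨h1, h2⟩, rfl, h3.symm⟩

theorem nodup_classList {r : ℕ} : (classList n E c r).Nodup :=
  (List.nodup_range.filter _).map fun _ _ h => (Prod.ext_iff.1 h).1

theorem nodup_classesList : (classesList n E c).Nodup :=
  (List.nodup_range.filter _).map fun _ _ h => (Prod.ext_iff.1 h).1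

end classes

/-- Among infinitely many finite sets with an equivalence relation and a colouring by finitely
many colours, one embeds in a later one. This is Higman's lemma applied twice: an equivalence
relation is a list of classes, and a class is a list of colours. -/
theorem exists_embedding_of_finite_colours {Λ : Type*} [Inhabited Λ] {S : Set Λ} (hS : S.Finite)
    (N : ℕ → ℕ) (E : ℕ → ℕ → ℕ → Prop) (c : ℕ → ℕ → Λ)
    (hr : ∀ i, ∀ x < N i, E i x x) (hs : ∀ i, ∀ x < N i, ∀ y < N i, E i x y → E i y x)
    (ht : ∀ i, ∀ x < N i, ∀ y < N i, ∀ z < N i, E i x y → E i y z → E i x z)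
    (hc : ∀ i, ∀ x < N i, c i x ∈ S) :
    ∃ i j, i < j ∧ ∃ f : ℕ → ℕ, ∀ x < N i, f x < N j ∧ c i x = c j (f x) ∧
      ∀ y < N i, (f x = f y → x = y) ∧ (E i x y ↔ E j (f x) (f y)) := by
  let r : ℕ × Λ → ℕ × Λ → Prop := fun p q => p.2 = q.2
  let R : ℕ × List (ℕ × Λ) → ℕ × List (ℕ × Λ) → Prop := fun p q => List.SublistForall₂ r p.2 q.2
  have : Std.Refl r := ⟨fun _ => rfl⟩
  have : IsTrans _ r := ⟨fun _ _ _ h1 h2 => Eq.trans h1 h2⟩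
  have : IsPreorder _ r := {}
  have : Std.Refl R := ⟨fun p => refl_of (List.SublistForall₂ r) p.2⟩
  have : IsTrans _ R := ⟨fun _ _ _ h1 h2 => trans_of (List.SublistForall₂ r) h1 h2⟩
  have : IsPreorder _ R := {}
  have h1 := partiallyWellOrderedOn_snd (α := ℕ) (hS.partiallyWellOrderedOn (r := (· = ·)))
  have h2 := Set.PartiallyWellOrderedOn.partiallyWellOrderedOn_sublistForall₂ r h1
  have h3 := partiallyWellOrderedOn_snd (α := ℕ) h2
  have h4 := Set.PartiallyWellOrderedOn.partiallyWellOrderedOn_sublistForall₂ R h3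
  obtain ⟨i, j, hij, h⟩ := h4.exists_lt (f := fun i => classesList (N i) (E i) (c i)) (by
    intro i p hp q hq
    rw [mem_classesList] at hp
    rw [hp.2.2, mem_classList] at hq
    show q.2 ∈ S
    rw [hq.2.2]
    exact hc i _ hq.1)
  refine ⟨i, j, hij, ?_⟩
  obtain ⟨g, hg1, hg2⟩ := exists_injOn_of_sublistForall₂ nodup_classesList nodup_classesList h
  let cl : ℕ → ℕ × List (ℕ × Λ) := fun x =>
    (leastRep (N i) (E i) x, classList (N i) (E i) (c i) (leastRep (N i) (E i) x))
  have hrep : ∀ x < N i, leastRep (N i) (E i) x < N i ∧ E i (leastRep (N i) (E i) x) x :=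
    fun x hx => leastRep_spec (hr i) hx
  have hcl : ∀ x < N i, cl x ∈ classesList (N i) (E i) (c i) := fun x hx =>
    mem_classesList.2 ⟨(hrep x hx).1,
      leastRep_congr (hs i) (ht i) (hrep x hx).1 hx (hrep x hx).2, rfl⟩
  have hin : ∀ x, ∃ h : ℕ × Λ → ℕ × Λ, x < N i →
      (∀ a ∈ (cl x).2, h a ∈ (g (cl x)).2 ∧ r a (h a)) ∧
      ∀ a ∈ (cl x).2, ∀ b ∈ (cl x).2, h a = h b → a = b := by
    intro x
    by_cases hx : x < N i
    · have hgx := hg1 _ (hcl x hx)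
      obtain ⟨h, hh⟩ := exists_injOn_of_sublistForall₂ (nodup_classList)
        (by rw [(mem_classesList.1 hgx.1).2.2]; exact nodup_classList) hgx.2
      exact ⟨h, fun _ => hh⟩
    · exact ⟨id, fun h => absurd h hx⟩
  choose h' hh' using hin
  -- the matching of members must depend on the class only
  let h : ℕ → ℕ × Λ → ℕ × Λ := fun x => h' (leastRep (N i) (E i) x)
  have hclrep : ∀ x < N i, cl (leastRep (N i) (E i) x) = cl x := by
    intro x hx
    have := leastRep_congr (hs i) (ht i) (hrep x hx).1 hx (hrep x hx).2
    simp only [cl, this]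
  have hh : ∀ x < N i, (∀ a ∈ (cl x).2, h x a ∈ (g (cl x)).2 ∧ r a (h x a)) ∧
      ∀ a ∈ (cl x).2, ∀ b ∈ (cl x).2, h x a = h x b → a = b := by
    intro x hx
    have := hh' _ (hrep x hx).1
    rwa [hclrep x hx] at this
  have hmem : ∀ x < N i, (x, c i x) ∈ (cl x).2 := fun x hx =>
    mem_classList.2 ⟨hx, (hrep x hx).2, rfl⟩
  let f : ℕ → ℕ := fun x => (h x (x, c i x)).1
  have hgc : ∀ x < N i, (g (cl x)).1 < N j ∧ leastRep (N j) (E j) (g (cl x)).1 = (g (cl x)).1 ∧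
      (g (cl x)).2 = classList (N j) (E j) (c j) (g (cl x)).1 := fun x hx =>
    mem_classesList.1 (hg1 _ (hcl x hx)).1
  have hf : ∀ x < N i, f x < N j ∧ E j (g (cl x)).1 (f x) ∧ (h x (x, c i x)).2 = c j (f x) := by
    intro x hx
    have := ((hh x hx).1 _ (hmem x hx)).1
    rw [(hgc x hx).2.2, mem_classList] at this
    exact this
  have hfrep : ∀ x < N i, leastRep (N j) (E j) (f x) = (g (cl x)).1 := fun x hx => by
    rw [← leastRep_congr (hs j) (ht j) (hgc x hx).1 (hf x hx).1 (hf x hx).2.1, (hgc x hx).2.1]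
  have hE : ∀ x < N i, ∀ y < N i, E j (f x) (f y) →
      leastRep (N i) (E i) x = leastRep (N i) (E i) y := by
    intro x hx y hy e
    have h1 := leastRep_congr (hs j) (ht j) (hf x hx).1 (hf y hy).1 e
    rw [hfrep x hx, hfrep y hy] at h1
    have h2 : g (cl x) = g (cl y) := by
      refine Prod.ext h1 ?_
      rw [(hgc x hx).2.2, (hgc y hy).2.2, h1]
    exact (Prod.ext_iff.1 (hg2 _ (hcl x hx) _ (hcl y hy) h2)).1
  refine ⟨f, fun x hx => ⟨(hf x hx).1, ?_, fun y hy => ⟨fun e => ?_, fun e => ?_, fun e => ?_⟩⟩⟩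
  · exact ((hh x hx).1 _ (hmem x hx)).2.trans (hf x hx).2.2
  · have h1 : leastRep (N i) (E i) x = leastRep (N i) (E i) y :=
      hE x hx y hy (by rw [e]; exact hr j _ (hf y hy).1)
    have h2 : cl x = cl y := by simp only [cl, h1]
    have h3 : h x = h y := by simp only [h, h1]
    have h4 : h x (x, c i x) = h x (y, c i y) := by
      refine Prod.ext ?_ ?_
      · have e' : (h x (x, c i x)).1 = (h y (y, c i y)).1 := e
        rwa [← h3] at e'
      · rw [(hf x hx).2.2, h3, (hf y hy).2.2, e]
    have := (hh x hx).2 _ (hmem x hx) _ (by rw [h2]; exact hmem y hy) h4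
    exact (Prod.ext_iff.1 this).1
  · have h1 := leastRep_congr (hs i) (ht i) hx hy e
    have h2 : cl x = cl y := by simp only [cl, h1]
    refine ht j _ (hf x hx).1 _ (hgc x hx).1 _ (hf y hy).1 (hs j _ (hgc x hx).1 _ (hf x hx).1
      (hf x hx).2.1) ?_
    rw [h2]
    exact (hf y hy).2.1
  · have h1 := hE x hx y hy e
    refine ht i _ hx _ (hrep x hx).1 _ hy (hs i _ (hrep x hx).1 _ hx (hrep x hx).2) ?_
    rw [h1]
    exact (hrep y hy).2

namespace Arena

variable {σ Λ : Type} {G : Arena σ Λ}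

/-- Among valid labellings with `0, 1, 2, …` columns, one has a configuration that embeds in that
of a later one. -/
theorem exists_embed [Inhabited Λ] {S : Set Λ} (hS : S.Finite) (L : ℕ → ℕ × ℕ → Λ)
    (hV : ∀ n, G.Valid n (L n)) (hL : ∀ n, ∀ x < n, L n (x, n - 1) ∈ S) :
    ∃ m n, 0 < m ∧ m < n ∧ ∃ f, G.Embed m (L m) n (L n) f := by
  obtain ⟨i, j, hij, f, hf⟩ := exists_embedding_of_finite_colours hS (fun i => i + 1)
    (fun i => G.Rel (L (i + 1))) (fun i x => L (i + 1) (x, i)) (fun i => (hV _).refl)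
    (fun i x _ y _ h => h.symm) (fun i => (hV _).trans) (fun i => hL (i + 1))
  exact ⟨i + 1, j + 1, i.succ_pos, by omega, f, hf⟩

end Arena

/-! ### Finite certificates for least fixed points -/

/-- Membership in the least fixed point of the rules `R`, where `R p X` says that `p` follows from
premises in `X`. -/
def Derivable {P : Type*} (R : P → (P → Prop) → Prop) (p : P) : Prop :=
  ∀ X : P → Prop, (∀ q, R q X → X q) → X p

section Derivable

variable {P : Type*} {R : P → (P → Prop) → Prop}

theorem Derivable.intro (hmono : ∀ p (X Y : P → Prop), (∀ q, X q → Y q) → R p X → R p Y) {p : P}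
    (h : R p (Derivable R)) : Derivable R p := fun X hX =>
  hX p (hmono p _ X (fun _ hq => hq X hX) h)

/-- If every rule has finitely many premises, and premises have greater measure than conclusions,
then `p` is derivable if and only if it lies in a finite list all of whose members are conclusions
of rules with premises in the list. -/
theorem derivable_iff_exists_list (μ : P → ℕ)
    (hmono : ∀ p (X Y : P → Prop), (∀ q, X q → Y q) → R p X → R p Y)
    (hfin : ∀ p X, R p X → ∃ Y : List P, (∀ q ∈ Y, X q) ∧ R p (· ∈ Y))
    (hμ : ∀ p X, R p X → R p fun q => X q ∧ μ p < μ q) (p : P) :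
    Derivable R p ↔ ∃ W : List P, p ∈ W ∧ ∀ q ∈ W, R q (· ∈ W) := by
  constructor
  · intro h
    refine h (fun p => ∃ W : List P, p ∈ W ∧ ∀ q ∈ W, R q (· ∈ W)) fun q hq => ?_
    obtain ⟨Y, hY, hqY⟩ := hfin q _ hq
    have : ∃ W : List P, (∀ q ∈ Y, q ∈ W) ∧ ∀ q ∈ W, R q (· ∈ W) := by
      clear hqY
      induction Y with
      | nil => exact ⟨[], by simp, by simp⟩
      | cons r Y ih =>
        obtain ⟨W, h1, h2⟩ := ih fun s hs => hY s (List.mem_cons_of_mem _ hs)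
        obtain ⟨W', h1', h2'⟩ := hY r List.mem_cons_self
        refine ⟨W ++ W', fun s hs => ?_, fun s hs => ?_⟩
        · rcases List.mem_cons.1 hs with rfl | hs
          · exact List.mem_append_right _ h1'
          · exact List.mem_append_left _ (h1 s hs)
        · rcases List.mem_append.1 hs with hs | hs
          · exact hmono s _ _ (fun t ht => List.mem_append_left _ ht) (h2 s hs)
          · exact hmono s _ _ (fun t ht => List.mem_append_right _ ht) (h2' s hs)
    obtain ⟨W, h1, h2⟩ := this
    refine ⟨q :: W, List.mem_cons_self, fun s hs => ?_⟩
    rcases List.mem_cons.1 hs with rfl | hs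
    · exact hmono s _ _ (fun t ht => List.mem_cons_of_mem _ (h1 t ht)) hqY
    · exact hmono s _ _ (fun t ht => List.mem_cons_of_mem _ ht) (h2 s hs)
  · rintro ⟨W, hp, hW⟩
    obtain ⟨B, hB⟩ : ∃ B, ∀ q ∈ W, μ q ≤ B :=
      ⟨(W.map μ).sum, fun q hq => List.single_le_sum (by simp) _ (List.mem_map_of_mem hq)⟩
    have : ∀ d, ∀ q ∈ W, B - μ q < d → Derivable R q := by
      intro d
      induction d with
      | zero => intro q _ h; omega
      | succ d ih =>
        intro q hq hd
        refine Derivable.intro hmono (hmono q _ _ (fun r hr => ?_) (hμ q _ (hW q hq)))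
        have := hB r hr.1
        exact ih r hr.1 (by omega)
    exact this _ p hp (Nat.lt_succ_self _)

end Derivable

/-! ### Positions of the game -/

/-- The labelled intervals of a game, the latest first. -/
abbrev History (Λ : Type) := List ((ℕ × ℕ) × Λ)

/-- A position of the game: the current column and the history. -/
abbrev Position (Λ : Type) := ℕ × History Λ

section Position

variable {Λ : Type}

/-- The labelling given by a history; unlabelled intervals receive the default label. -/
def label [Inhabited Λ] (H : History Λ) (p : ℕ × ℕ) : Λ := (H.lookup p).getD default

/-- The interval `p` has been labelled. -/
def Visited (H : History Λ) (p : ℕ × ℕ) : Prop := p ∈ H.map Prod.fst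

theorem label_cons [Inhabited Λ] (q : ℕ × ℕ) (l : Λ) (H : History Λ) :
    label ((q, l) :: H) = Function.update (label H) q l := by
  ext p
  unfold label
  by_cases h : p = q
  · subst h; simp
  · have : (p == q) = false := by simpa using h
    rw [List.lookup_cons, this, Function.update_of_ne h]

@[simp] theorem visited_cons {q p : ℕ × ℕ} {l : Λ} {H : History Λ} :
    Visited ((q, l) :: H) p ↔ p = q ∨ Visited H p := by
  simp [Visited]

@[simp] theorem not_visited_nil (p : ℕ × ℕ) : ¬ Visited ([] : History Λ) p := by
  simp [Visited]

/-- All rows of column `n` are labelled. -/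
def Complete (n : ℕ) (H : History Λ) : Prop := ∀ x < n + 1, Visited H (x, n)

open Classical in
/-- The unlabelled rows of column `n`. -/
noncomputable def unvisited (n : ℕ) (H : History Λ) : Finset ℕ :=
  (Finset.range (n + 1)).filter fun x => ¬ Visited H (x, n)

theorem mem_unvisited {n x : ℕ} {H : History Λ} :
    x ∈ unvisited n H ↔ x < n + 1 ∧ ¬ Visited H (x, n) := by
  simp [unvisited]

theorem unvisited_subset (n : ℕ) (H : History Λ) : unvisited n H ⊆ Finset.range (n + 1) :=
  fun _ hx => Finset.mem_range.2 (mem_unvisited.1 hx).1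

theorem complete_iff_unvisited_eq_empty {n : ℕ} {H : History Λ} :
    Complete n H ↔ unvisited n H = ∅ := by
  rw [Finset.eq_empty_iff_forall_notMem]
  simp only [mem_unvisited, Complete]
  exact forall_congr' fun x => by tauto

theorem unvisited_cons {n x : ℕ} {l : Λ} {H : History Λ} :
    unvisited n (((x, n), l) :: H) = (unvisited n H).erase x := by
  ext y
  simp only [mem_unvisited, visited_cons, Finset.mem_erase, Prod.mk.injEq, and_true]
  tauto

/-- Only intervals in the columns up to `n` are labelled. -/
def OldColumns (n : ℕ) (H : History Λ) : Prop := ∀ p, Visited H p → p.2 ≤ n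

theorem OldColumns.cons {n x : ℕ} {l : Λ} {H : History Λ} (h : OldColumns n H) :
    OldColumns n (((x, n), l) :: H) := by
  intro p hp
  rcases visited_cons.1 hp with rfl | hp
  · exact le_rfl
  · exact h p hp

theorem OldColumns.unvisited_succ {n : ℕ} {H : History Λ} (h : OldColumns n H) :
    unvisited (n + 1) H = Finset.range (n + 2) := by
  ext x
  rw [mem_unvisited, Finset.mem_range]
  exact ⟨fun h => h.1, fun hx => ⟨hx, fun hv => by have := h _ hv; simp at this⟩⟩

end Position

/-- All lists of length `m` over `{0, …, n-1}`. They represent the maps from `{0, …, m-1}` to `{0,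
…, n-1}`, over which a search for embeddings runs. -/
def tuples (n : ℕ) : ℕ → List (List ℕ)
  | 0 => [[]]
  | m + 1 => (tuples n m).flatMap fun l => (List.range n).map fun a => a :: l

theorem map_mem_tuples {n : ℕ} {f : ℕ → ℕ} (l : List ℕ) (hf : ∀ x ∈ l, f x < n) :
    l.map f ∈ tuples n l.length := by
  induction l with
  | nil => simp [tuples]
  | cons a l ih =>
    simp only [List.map_cons, List.length_cons, tuples, List.mem_flatMap, List.mem_map,
      List.mem_range]
    exact ⟨_, ih fun x hx => hf x (List.mem_cons_of_mem _ hx), f a, hf a List.mem_cons_self, rfl⟩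

namespace Arena

variable {σ Λ : Type} {G : Arena σ Λ}

/-- The positions that follow `p` within a game: finitely many. -/
def successors (G : Arena σ Λ) (p : Position Λ) : List (Position Λ) :=
  (p.1 + 1, p.2) :: (List.range (p.1 + 1)).flatMap fun x => G.opts.flatMap fun s =>
    (G.menu s).map fun l => (p.1, ((x, p.1), l) :: p.2)

theorem mem_successors_succ (p : Position Λ) : (p.1 + 1, p.2) ∈ G.successors p :=
  List.mem_cons_self

theorem mem_successors_move (p : Position Λ) {x : ℕ} (hx : x < p.1 + 1) {s : σ} (hs : s ∈ G.opts)
    {l : Λ} (hl : l ∈ G.menu s) : (p.1, ((x, p.1), l) :: p.2) ∈ G.successors p :=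
  List.mem_cons_of_mem _ <| List.mem_flatMap.2 ⟨x, List.mem_range.2 hx,
    List.mem_flatMap.2 ⟨s, hs, List.mem_map_of_mem hl⟩⟩

/-- A quantity that grows along a game. -/
def measure (p : Position Λ) : ℕ := p.1 + p.2.length

theorem measure_lt_of_mem_successors {p q : Position Λ} (h : q ∈ G.successors p) :
    measure p < measure q := by
  simp only [successors, List.mem_cons, List.mem_flatMap, List.mem_map] at h
  rcases h with rfl | ⟨_, -, _, -, _, -, rfl⟩ <;> simp [measure]

theorem Success.congr {n : ℕ} {L L' : ℕ × ℕ → Λ} (hL : ∀ p : ℕ × ℕ, p.2 < n → L p = L' p)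
    (h : G.Success n L) : G.Success n L' :=
  ⟨h.1, h.2.1.congr hL, fun x hx => by
    rw [← hL _ (show n - 1 < n by omega)]; exact h.2.2 x hx⟩

theorem update_eq_of_lt {n : ℕ} (x : ℕ) (l : Λ) (L : ℕ × ℕ → Λ) (p : ℕ × ℕ) (hp : p.2 < n) :
    Function.update L (x, n) l p = L p := by
  rw [Function.update_of_ne]; rintro rfl; simp at hp

open Classical in
/-- Derivability by rules whose premises are successors is witnessed by finite lists. -/
theorem derivable_iff_of_successors {R : Position Λ → (Position Λ → Prop) → Prop}
    (hmono : ∀ p (X Y : Position Λ → Prop), (∀ q, X q → Y q) → R p X → R p Y)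
    (hsucc : ∀ p X, R p X → R p fun q => X q ∧ q ∈ G.successors p) (p : Position Λ) :
    Derivable R p ↔ ∃ W : List (Position Λ), p ∈ W ∧ ∀ q ∈ W, R q (· ∈ W) := by
  refine derivable_iff_exists_list measure hmono (fun p X h => ?_) (fun p X h => ?_) p
  · refine ⟨(G.successors p).filter (fun q => X q), fun q hq => ?_, ?_⟩
    · simpa using (List.mem_filter.1 hq).2
    · refine hmono _ _ _ (fun q hq => ?_) (hsucc p X h)
      exact List.mem_filter.2 ⟨hq.2, by simpa using hq.1⟩
  · exact hmono _ _ _ (fun q hq => ⟨hq.1, measure_lt_of_mem_successors hq.2⟩) (hsucc p X h)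

variable [Inhabited Λ] (G)

/-- The rules for positions won by the duplicator: success has been reached, or the column is
complete and the next one is won, or each move of the spoiler has a winning answer. A complete
column is left without a move of either player. -/
def WinRule (p : Position Λ) (X : Position Λ → Prop) : Prop :=
  G.Success p.1 (label p.2) ∨ (Complete p.1 p.2 ∧ X (p.1 + 1, p.2)) ∨
    (¬ Complete p.1 p.2 ∧ ∀ x < p.1 + 1, ¬ Visited p.2 (x, p.1) → ∀ s ∈ G.opts, ∃ l ∈ G.menu s,
      X (p.1, ((x, p.1), l) :: p.2))

/-- Column `n` is still empty, and the configuration after some smaller, positive number of columns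
embeds in the current one. -/
def Subsumed (n : ℕ) (H : History Λ) : Prop :=
  (∀ x < n + 1, ¬ Visited H (x, n)) ∧ ∃ m < n, 0 < m ∧ ∃ f ∈ tuples n m,
    G.Embed m (label H) n (label H) fun x => f.getD x 0

/-- The rules for positions in which the spoiler can prevent success: the labelling is invalid, or
subsumed, or the column is complete and the next one is lost, or some move of the spoiler has only
losing answers. Subsumed positions may count as lost because a win from one of them gives an
equally fast win from an earlier position. -/
def LoseRule (p : Position Λ) (X : Position Λ → Prop) : Prop :=
  ¬ G.Success p.1 (label p.2) ∧ (¬ G.Valid p.1 (label p.2) ∨ G.Subsumed p.1 p.2 ∨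
    (Complete p.1 p.2 ∧ X (p.1 + 1, p.2)) ∨
    ∃ x < p.1 + 1, ¬ Visited p.2 (x, p.1) ∧ ∃ s ∈ G.opts, ∀ l ∈ G.menu s,
      X (p.1, ((x, p.1), l) :: p.2))

theorem Subsumed.of_embed {n m : ℕ} {H : History Λ} {f : ℕ → ℕ}
    (hH : ∀ x < n + 1, ¬ Visited H (x, n)) (hm : 0 < m) (hmn : m < n)
    (hf : G.Embed m (label H) n (label H) f) : G.Subsumed n H := by
  refine ⟨hH, m, hmn, hm, (List.range m).map f, ?_, ?_⟩
  · have := map_mem_tuples (n := n) (f := f) (List.range m)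
      (fun x hx => (hf x (List.mem_range.1 hx)).1)
    rwa [List.length_range] at this
  · have : ∀ x < m, ((List.range m).map f).getD x 0 = f x := by
      intro x hx
      simp [List.getD, hx]
    intro x hx
    simp only [this x hx]
    refine ⟨(hf x hx).1, (hf x hx).2.1, fun y hy => ?_⟩
    rw [this y hy]
    exact (hf x hx).2.2 y hy

variable {G}

theorem WinRule.mono (p : Position Λ) (X Y : Position Λ → Prop) (h : ∀ q, X q → Y q)
    (hX : G.WinRule p X) : G.WinRule p Y := by
  refine hX.imp id (Or.imp (And.imp id (h _)) (And.imp id fun hX x hx hv s hs => ?_))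
  obtain ⟨l, hl, hq⟩ := hX x hx hv s hs
  exact ⟨l, hl, h _ hq⟩

theorem LoseRule.mono (p : Position Λ) (X Y : Position Λ → Prop) (h : ∀ q, X q → Y q)
    (hX : G.LoseRule p X) : G.LoseRule p Y := by
  refine ⟨hX.1, hX.2.imp id (Or.imp id (Or.imp (And.imp id (h _)) ?_))⟩
  rintro ⟨x, hx, hv, s, hs, hl⟩
  exact ⟨x, hx, hv, s, hs, fun l hl' => h _ (hl l hl')⟩

theorem WinRule.successors {p : Position Λ} {X : Position Λ → Prop} (h : G.WinRule p X) :
    G.WinRule p fun q => X q ∧ q ∈ G.successors p := by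
  refine h.imp id (Or.imp (And.imp id fun h => ⟨h, mem_successors_succ p⟩)
    (And.imp id fun hX x hx hv s hs => ?_))
  obtain ⟨l, hl, hq⟩ := hX x hx hv s hs
  exact ⟨l, hl, hq, mem_successors_move p hx hs hl⟩

theorem LoseRule.successors {p : Position Λ} {X : Position Λ → Prop} (h : G.LoseRule p X) :
    G.LoseRule p fun q => X q ∧ q ∈ G.successors p := by
  refine ⟨h.1, h.2.imp id (Or.imp id (Or.imp
    (And.imp id fun h => ⟨h, mem_successors_succ p⟩) ?_))⟩
  rintro ⟨x, hx, hv, s, hs, hl⟩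
  exact ⟨x, hx, hv, s, hs, fun l hl' => ⟨hl l hl', mem_successors_move p hx hs hl'⟩⟩

theorem derivable_winRule_iff (p : Position Λ) : Derivable G.WinRule p ↔
    ∃ W : List (Position Λ), p ∈ W ∧ ∀ q ∈ W, G.WinRule q (· ∈ W) :=
  derivable_iff_of_successors (G := G) WinRule.mono (fun _ _ => WinRule.successors) p

theorem derivable_loseRule_iff (p : Position Λ) : Derivable G.LoseRule p ↔
    ∃ W : List (Position Λ), p ∈ W ∧ ∀ q ∈ W, G.LoseRule q (· ∈ W) :=
  derivable_iff_of_successors (G := G) LoseRule.mono (fun _ _ => LoseRule.successors) p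

/-! ### Derivable positions and winning positions -/

/-- The duplicator's certificates are sound. -/
theorem exists_force_of_derivable {p : Position Λ} (h : Derivable G.WinRule p) :
    OldColumns p.1 p.2 → G.Success p.1 (label p.2) ∨ ∃ k,
      G.Force p.1 (G.Win k (p.1 + 1)) (unvisited p.1 p.2).card (unvisited p.1 p.2)
        (label p.2) := by
  refine h (fun p => OldColumns p.1 p.2 → G.Success p.1 (label p.2) ∨ ∃ k,
      G.Force p.1 (G.Win k (p.1 + 1)) (unvisited p.1 p.2).card (unvisited p.1 p.2)
        (label p.2)) ?_
  rintro ⟨n, H⟩ hR (hH : OldColumns n H)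
  show G.Success n (label H) ∨ ∃ k, G.Force n (G.Win k (n + 1)) (unvisited n H).card
    (unvisited n H) (label H)
  by_cases hS : G.Success n (label H)
  · exact Or.inl hS
  right
  rcases hR with hR | ⟨hc, hR⟩ | ⟨hc, hR⟩
  · exact absurd hR hS
  · simp only [complete_iff_unvisited_eq_empty] at hc
    rw [hc]
    rcases hR (fun p hp => (hH p hp).trans n.le_succ) with hR | ⟨k, hk⟩
    · exact ⟨0, hR⟩
    · simp only [hH.unvisited_succ, Finset.card_range] at hk
      exact ⟨k + 1, Or.inr hk⟩
  · simp only [complete_iff_unvisited_eq_empty] at hc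
    obtain ⟨c, hcard⟩ := Nat.exists_eq_succ_of_ne_zero (mt Finset.card_eq_zero.1 hc)
    rw [hcard]
    refine Force.exists_rank fun x hx s hs => ?_
    obtain ⟨hx1, hx2⟩ := mem_unvisited.1 hx
    obtain ⟨l, hl, h⟩ := hR x hx1 hx2 s hs
    refine ⟨l, hl, ?_⟩
    simp only [unvisited_cons, label_cons] at h
    rcases h hH.cons with h | ⟨k, hk⟩
    · exact absurd (h.congr (update_eq_of_lt x l _)) hS
    · rw [Finset.card_erase_of_mem hx, hcard] at hk
      exact hk.mono fun L' hL' => ⟨k, hL'⟩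

theorem exists_win_of_derivable (h : Derivable G.WinRule (0, [])) :
    ∃ k, G.Win k 0 (label []) := by
  rcases exists_force_of_derivable h (fun p hp => absurd hp (by simp)) with h | ⟨k, hk⟩
  · exact absurd h.1 (lt_irrefl 0)
  · refine ⟨k + 1, Or.inr ?_⟩
    have : unvisited 0 ([] : History Λ) = Finset.range 1 := by
      ext x; simp [mem_unvisited]
    simpa only [this, Finset.card_range] using hk

/-- The spoiler's certificates are sound. Suppose that the duplicator could force a win, and let
her take as few further columns as possible. This number decreases strictly from column to column,
so no earlier column allows a win as fast as the current one. At a subsumed position this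
contradicts `Win.of_embed`. -/
theorem not_force_of_derivable (hs : ∃ s, s ∈ G.opts) {p : Position Λ}
    (h : Derivable G.LoseRule p) : ¬ G.Success p.1 (label p.2) ∧ ∀ k, OldColumns p.1 p.2 →
      G.Force p.1 (G.Win k (p.1 + 1)) (unvisited p.1 p.2).card (unvisited p.1 p.2) (label p.2) →
      (∀ m < p.1, 0 < m → ¬ G.Win (k + 1) m (label p.2)) → (0 < p.1 → ¬ G.Win k p.1 (label p.2)) →
      False := by
  refine h (fun p => ¬ G.Success p.1 (label p.2) ∧ ∀ k, OldColumns p.1 p.2 →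
      G.Force p.1 (G.Win k (p.1 + 1)) (unvisited p.1 p.2).card (unvisited p.1 p.2) (label p.2) →
      (∀ m < p.1, 0 < m → ¬ G.Win (k + 1) m (label p.2)) → (0 < p.1 → ¬ G.Win k p.1 (label p.2)) →
      False) ?_
  rintro ⟨n, H⟩ ⟨hS, hR⟩
  refine ⟨hS, ?_⟩
  dsimp only at hS hR ⊢
  intro k hH hF hlt hn
  rcases hR with hR | hR | ⟨hc, hR⟩ | ⟨x, hx, hv, s, hs', hR⟩
  · obtain ⟨L', h1, h2⟩ := hF.exists_target hs
    exact hR (((h1.valid hs).mono n.le_succ).congr fun p hp => (h2 p hp.ne).symm)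
  · obtain ⟨hv, m, hmn, hm, f, -, hf⟩ := hR
    have hU : unvisited n H = Finset.range (n + 1) := by
      ext x
      rw [mem_unvisited, Finset.mem_range]
      exact ⟨fun h => h.1, fun hx => ⟨hx, hv x hx⟩⟩
    rw [hU, Finset.card_range] at hF
    have hW : G.Win (k + 1) n (label H) := Or.inr hF
    exact hlt m hmn hm (hW.of_embed hs hm ((hW.valid hs).mono hmn.le) hf)
  · rw [complete_iff_unvisited_eq_empty] at hc
    rw [hc] at hF
    have hW : ∃ k, G.Win k (n + 1) (label H) := ⟨k, hF⟩
    classical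
    have hle : Nat.find hW ≤ k := Nat.find_min' hW hF
    rcases hk0 : Nat.find hW with _ | j
    · have := Nat.find_spec hW
      rw [hk0] at this
      exact hR.1 this
    · have hw := Nat.find_spec hW
      rw [hk0] at hw hle
      rcases hw with hw | hw
      · exact hR.1 hw
      · refine hR.2 j (fun p hp => (hH p hp).trans n.le_succ) ?_ ?_ ?_
        · rw [hH.unvisited_succ, Finset.card_range]; exact hw
        · intro m hm hm0 hw'
          rcases (Nat.lt_succ_iff.1 hm).lt_or_eq with hm' | rfl
          · exact hlt m hm' hm0 (hw'.mono (by omega))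
          · exact hn hm0 (hw'.mono hle)
        · intro _
          exact Nat.find_min hW (by omega)
  · have hxU : x ∈ unvisited n H := mem_unvisited.2 ⟨hx, hv⟩
    obtain ⟨c, hcard⟩ := Nat.exists_eq_succ_of_ne_zero
      (mt Finset.card_eq_zero.1 (Finset.ne_empty_of_mem hxU))
    rw [hcard] at hF
    obtain ⟨l, hl, hF⟩ := hF x hxU s hs'
    obtain ⟨-, hR⟩ := hR l hl
    rw [unvisited_cons, label_cons, Finset.card_erase_of_mem hxU, hcard] at hR
    refine hR k hH.cons hF ?_ ?_
    · intro m hm hm0 hw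
      exact hlt m hm hm0 (hw.congr hs hm0 fun p hp => update_eq_of_lt x l _ p (hp.trans hm))
    · intro h0 hw
      exact hn h0 (hw.congr hs h0 fun p hp => update_eq_of_lt x l _ p hp)

theorem not_win_of_derivable (hs : ∃ s, s ∈ G.opts) (h : Derivable G.LoseRule (0, [])) (k : ℕ) :
    ¬ G.Win k 0 (label []) := by
  intro hk
  rcases k with _ | k
  · exact lt_irrefl 0 hk.1
  · rcases hk with hk | hk
    · exact lt_irrefl 0 hk.1
    · refine (not_force_of_derivable hs h).2 k (fun p hp => absurd hp (by simp)) ?_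
        (fun m hm => absurd hm (by simp)) (fun h => absurd h (lt_irrefl 0))
      have : unvisited 0 ([] : History Λ) = Finset.range 1 := by
        ext x; simp [mem_unvisited]
      simpa only [this, Finset.card_range] using hk

end Arena

/-! ### Plays -/

section Play

variable {Λ : Type}

open Classical in
/-- The position after row `e.1` of the current column has received the label `e.2`. A column that
is complete is left at once. -/
noncomputable def advance (p : Position Λ) (e : ℕ × Λ) : Position Λ :=
  (if Complete p.1 (((e.1, p.1), e.2) :: p.2) then p.1 + 1 else p.1, ((e.1, p.1), e.2) :: p.2)

/-- The position before round `i` of the play with the rows and labels `e`. -/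
noncomputable def playPos (e : ℕ → ℕ × Λ) : ℕ → Position Λ
  | 0 => (0, [])
  | i + 1 => advance (playPos e i) (e i)

/-- The row `x` may be labelled next. -/
def LegalMove (p : Position Λ) (x : ℕ) : Prop := x < p.1 + 1 ∧ ¬ Visited p.2 (x, p.1)

/-- All rounds of the infinite play label legal rows. -/
def LegalPlay (e : ℕ → ℕ × Λ) : Prop := ∀ i, LegalMove (playPos e i) (e i).1

theorem fst_playPos_of_complete {e : ℕ → ℕ × Λ} {i : ℕ}
    (h : Complete (playPos e i).1 (playPos e (i + 1)).2) :
    (playPos e (i + 1)).1 = (playPos e i).1 + 1 := by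
  classical exact if_pos h

theorem fst_playPos_of_not_complete {e : ℕ → ℕ × Λ} {i : ℕ}
    (h : ¬ Complete (playPos e i).1 (playPos e (i + 1)).2) :
    (playPos e (i + 1)).1 = (playPos e i).1 := by
  classical exact if_neg h

/-- The invariants of the positions of legal plays: all intervals in earlier columns and some, but
not all, in the current column are labelled, each of them once. As there are `n(n+1)/2` intervals
in the first `n` columns, the length of the history determines the column. -/
structure Proper (p : Position Λ) : Prop where
  old : ∀ q, Visited p.2 q → q.1 ≤ q.2 ∧ q.2 ≤ p.1
  all : ∀ q : ℕ × ℕ, q.1 ≤ q.2 → q.2 < p.1 → Visited p.2 q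
  not_complete : ¬ Complete p.1 p.2
  count : 2 * p.2.length + 2 * (unvisited p.1 p.2).card = p.1 * (p.1 + 1) + 2 * (p.1 + 1)

theorem unvisited_zero_nil : unvisited 0 ([] : History Λ) = Finset.range 1 := by
  ext x; simp [mem_unvisited]

theorem Proper.oldColumns {p : Position Λ} (h : Proper p) : OldColumns p.1 p.2 :=
  fun q hq => (h.old q hq).2

theorem proper_zero : Proper ((0, []) : Position Λ) where
  old q hq := absurd hq (not_visited_nil q)
  all q _ hq := by simp at hq
  not_complete := by rw [complete_iff_unvisited_eq_empty, unvisited_zero_nil]; simp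
  count := by simp [unvisited_zero_nil]

theorem Proper.advance {p : Position Λ} (h : Proper p) {e : ℕ × Λ} (he : LegalMove p e.1) :
    Proper (advance p e) := by
  obtain ⟨n, H⟩ := p
  obtain ⟨x, l⟩ := e
  obtain ⟨h1, h2, h3, h4⟩ := h
  obtain ⟨he1, he2⟩ := he
  dsimp only at *
  have hxU : x ∈ unvisited n H := mem_unvisited.2 ⟨he1, he2⟩
  have hpos : 0 < (unvisited n H).card := Finset.card_pos.2 ⟨x, hxU⟩
  have hold : ∀ q, Visited (((x, n), l) :: H) q → q.1 ≤ q.2 ∧ q.2 ≤ n := by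
    intro q hq
    rcases visited_cons.1 hq with rfl | hq
    · exact ⟨Nat.lt_succ_iff.1 he1, le_rfl⟩
    · exact h1 q hq
  by_cases hc : Complete n (((x, n), l) :: H)
  · have hH' : OldColumns n (((x, n), l) :: H) := fun q hq => (hold q hq).2
    have hc' := complete_iff_unvisited_eq_empty.1 hc
    rw [unvisited_cons, ← Finset.card_eq_zero, Finset.card_erase_of_mem hxU] at hc'
    simp only [ABBSim.advance, hc, if_true]
    refine ⟨fun q hq => ⟨(hold q hq).1, (hold q hq).2.trans n.le_succ⟩, fun q hq1 hq2 => ?_,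
      ?_, ?_⟩
    · rcases (Nat.lt_succ_iff.1 hq2).lt_or_eq with hq | hq
      · exact visited_cons.2 (Or.inr (h2 q hq1 hq))
      · obtain ⟨a, b⟩ := q
        dsimp only at hq hq1
        subst hq
        exact hc a (by omega)
    · rw [complete_iff_unvisited_eq_empty, hH'.unvisited_succ]
      simp
    · rw [hH'.unvisited_succ]
      simp only [List.length_cons, Finset.card_range]
      have : (unvisited n H).card = 1 := by omega
      rw [this] at h4
      ring_nf at h4 ⊢
      omega
  · simp only [ABBSim.advance, hc, if_false]
    refine ⟨hold, fun q hq1 hq2 => visited_cons.2 (Or.inr (h2 q hq1 hq2)), hc, ?_⟩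
    rw [unvisited_cons, Finset.card_erase_of_mem hxU, List.length_cons]
    dsimp only
    omega

theorem LegalPlay.proper {e : ℕ → ℕ × Λ} (he : LegalPlay e) (i : ℕ) : Proper (playPos e i) := by
  induction i with
  | zero => exact proper_zero
  | succ i ih => exact ih.advance (he i)

theorem length_playPos (e : ℕ → ℕ × Λ) (i : ℕ) : (playPos e i).2.length = i := by
  induction i with
  | zero => rfl
  | succ i ih => simp [playPos, advance, ih]

theorem Proper.bounds {p : Position Λ} (h : Proper p) :
    p.1 * (p.1 + 1) ≤ 2 * p.2.length ∧ 2 * p.2.length < (p.1 + 1) * (p.1 + 2) := by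
  have h1 := h.count
  have h2 : 0 < (unvisited p.1 p.2).card :=
    Finset.card_pos.2 (Finset.nonempty_iff_ne_empty.2
      (mt complete_iff_unvisited_eq_empty.2 h.not_complete))
  have h3 : (unvisited p.1 p.2).card ≤ p.1 + 1 := by
    refine (Finset.card_le_card (unvisited_subset _ _)).trans ?_
    rw [Finset.card_range]
  constructor
  · omega
  · have : (p.1 + 1) * (p.1 + 2) = p.1 * (p.1 + 1) + 2 * (p.1 + 1) := by ring
    omega

theorem Proper.fst_eq {p : Position Λ} (h : Proper p) {m : ℕ}
    (h1 : m * (m + 1) ≤ 2 * p.2.length) (h2 : 2 * p.2.length < (m + 1) * (m + 2)) : p.1 = m := by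
  obtain ⟨h3, h4⟩ := h.bounds
  rcases lt_trichotomy p.1 m with h | h | h
  · have := Nat.mul_le_mul (show p.1 + 1 ≤ m by omega) (show p.1 + 2 ≤ m + 1 by omega)
    omega
  · exact h
  · have := Nat.mul_le_mul (show m + 1 ≤ p.1 by omega) (show m + 2 ≤ p.1 + 1 by omega)
    omega

/-- After `m(m+1)/2` rounds of a legal play exactly the first `m` columns are labelled. -/
theorem LegalPlay.boundary {e : ℕ → ℕ × Λ} (he : LegalPlay e) {i m : ℕ}
    (hi : 2 * i = m * (m + 1)) :
    (playPos e i).1 = m ∧ ∀ x < m + 1, ¬ Visited (playPos e i).2 (x, m) := by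
  have hp := he.proper i
  have hl := length_playPos e i
  have h1 : (playPos e i).1 = m := by
    refine hp.fst_eq (by omega) ?_
    have : (m + 1) * (m + 2) = m * (m + 1) + 2 * (m + 1) := by ring
    omega
  refine ⟨h1, ?_⟩
  have h2 := hp.count
  rw [h1, hl] at h2
  have h3 : unvisited m (playPos e i).2 = Finset.range (m + 1) := by
    refine Finset.eq_of_subset_of_card_le (unvisited_subset _ _) ?_
    rw [Finset.card_range]
    omega
  intro x hx
  exact (mem_unvisited.1 (h3 ▸ Finset.mem_range.2 hx)).2

/-- The number `m(m+1)/2` of intervals over `m` points is a natural number. -/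
theorem exists_triangle (m : ℕ) : ∃ i, 2 * i = m * (m + 1) := by
  obtain ⟨i, hi⟩ := Nat.even_mul_succ_self m
  exact ⟨i, by omega⟩

/-- Labels are never changed. -/
theorem LegalPlay.label_eq [Inhabited Λ] {e : ℕ → ℕ × Λ} (he : LegalPlay e) {i j : ℕ}
    (hij : i ≤ j) {q : ℕ × ℕ} (hq : Visited (playPos e i).2 q) :
    Visited (playPos e j).2 q ∧ label (playPos e j).2 q = label (playPos e i).2 q := by
  induction hij with
  | refl => exact ⟨hq, rfl⟩
  | @step j _ ih =>
    refine ⟨visited_cons.2 (Or.inr ih.1), ?_⟩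
    rw [← ih.2]
    show label (_ :: _) q = _
    rw [label_cons, Function.update_of_ne]
    rintro rfl
    exact (he j).2 ih.1

theorem not_derivable_advance {R : Position Λ → (Position Λ → Prop) → Prop} {p : Position Λ}
    {e : ℕ × Λ} (hR : ∀ n H, Complete n H → Derivable R (n + 1, H) → Derivable R (n, H))
    (h : ¬ Derivable R (p.1, ((e.1, p.1), e.2) :: p.2)) : ¬ Derivable R (advance p e) := by
  by_cases hc : Complete p.1 (((e.1, p.1), e.2) :: p.2)
  · simp only [advance, hc, if_true]
    exact fun h' => h (hR _ _ hc h')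
  · simpa only [advance, hc, if_false] using h

/-- Plays with a given invariant are built move by move. -/
theorem exists_legalPlay [Inhabited Λ] (I : Position Λ → Prop) (Q : Position Λ → ℕ × Λ → Prop)
    (h0 : I (0, []))
    (hI : ∀ p, Proper p → I p → ∃ e : ℕ × Λ, LegalMove p e.1 ∧ Q p e ∧ I (advance p e)) :
    ∃ e : ℕ → ℕ × Λ, LegalPlay e ∧ ∀ i, I (playPos e i) ∧ Q (playPos e i) (e i) := by
  choose! next hnext using hI
  let pos : ℕ → Position Λ := fun i => Nat.rec (0, []) (fun _ p => advance p (next p)) i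
  have hpos : ∀ i, Proper (pos i) ∧ I (pos i) := by
    intro i
    induction i with
    | zero => exact ⟨proper_zero, h0⟩
    | succ i ih =>
      obtain ⟨h1, -, h2⟩ := hnext _ ih.1 ih.2
      exact ⟨ih.1.advance h1, h2⟩
  have heq : ∀ i, playPos (fun i => next (pos i)) i = pos i := by
    intro i
    induction i with
    | zero => rfl
    | succ i ih => rw [playPos, ih]
  refine ⟨fun i => next (pos i), fun i => ?_, fun i => ?_⟩
  · rw [heq]; exact (hnext _ (hpos i).1 (hpos i).2).1
  · rw [heq]; exact ⟨(hpos i).2, (hnext _ (hpos i).1 (hpos i).2).2.1⟩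

end Play

namespace Arena

variable {σ Λ : Type} [Inhabited Λ] {G : Arena σ Λ}

theorem derivable_winRule_of_complete (n : ℕ) (H : History Λ) (hc : Complete n H)
    (h : Derivable G.WinRule (n + 1, H)) : Derivable G.WinRule (n, H) :=
  Derivable.intro WinRule.mono (Or.inr (Or.inl ⟨hc, h⟩))

/-- The spoiler's choice at a position from which the duplicator cannot be shown to win. -/
theorem exists_move_of_not_derivable {p : Position Λ} (hp : Proper p)
    (h : ¬ Derivable G.WinRule p) : ¬ G.Success p.1 (label p.2) ∧ ∃ x, LegalMove p x ∧
      ∃ s ∈ G.opts, ∀ l ∈ G.menu s, ¬ Derivable G.WinRule (p.1, ((x, p.1), l) :: p.2) := by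
  have h' : ¬ G.WinRule p (Derivable G.WinRule) := fun h' => h (Derivable.intro WinRule.mono h')
  unfold WinRule at h'
  push Not at h'
  obtain ⟨h1, -, h2⟩ := h'
  obtain ⟨x, hx, hv, s, hs, hl⟩ := h2 hp.not_complete
  exact ⟨h1, x, ⟨hx, hv⟩, s, hs, hl⟩

/-- The certificates are complete. If neither player had one, then some infinite play would avoid
both kinds of derivable positions. Its columns are valid and finitely coloured, so two of its
configurations embed, and a subsumed position occurs, which is derivable. -/
theorem derivable_loseRule_of_not (h : ¬ Derivable G.WinRule (0, [])) :
    Derivable G.LoseRule (0, []) := by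
  by_contra hN
  let S : Set Λ := {l | ∃ s ∈ G.opts, l ∈ G.menu s}
  have hS : S.Finite := by
    classical
    refine (G.opts.flatMap G.menu).toFinset.finite_toSet.subset ?_
    rintro l ⟨s, hs, hl⟩
    simpa using ⟨s, hs, hl⟩
  obtain ⟨e, he, hI⟩ := exists_legalPlay
    (fun p => ¬ Derivable G.WinRule p ∧ ¬ Derivable G.LoseRule p ∧
      ∀ q, Visited p.2 q → label p.2 q ∈ S) (fun _ _ => True) ⟨h, hN, by simp⟩ (by
    rintro p hp ⟨h1, h2, h3⟩
    obtain ⟨hsucc, x, hx, s, hs, hl⟩ := exists_move_of_not_derivable hp h1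
    have h2' : ¬ G.LoseRule p (Derivable G.LoseRule) := fun h' =>
      h2 (Derivable.intro LoseRule.mono h')
    have : ∃ l ∈ G.menu s, ¬ Derivable G.LoseRule (p.1, ((x, p.1), l) :: p.2) := by
      by_contra hcon
      push Not at hcon
      exact h2' ⟨hsucc, Or.inr (Or.inr (Or.inr ⟨x, hx.1, hx.2, s, hs, hcon⟩))⟩
    obtain ⟨l, hl1, hl2⟩ := this
    refine ⟨(x, l), hx, trivial, not_derivable_advance derivable_winRule_of_complete (hl l hl1),
      ?_, fun q hq => ?_⟩
    · by_cases hc : Complete p.1 (((x, p.1), l) :: p.2)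
      · simp only [advance, hc, if_true]
        refine fun h' => hl2 (Derivable.intro LoseRule.mono ⟨fun hs' => hl l hl1 ?_,
          Or.inr (Or.inr (Or.inl ⟨hc, h'⟩))⟩)
        exact Derivable.intro WinRule.mono (Or.inl hs')
      · simpa only [advance, hc, if_false] using hl2
    · show label (_ :: _) q ∈ S
      rw [label_cons]
      rcases visited_cons.1 hq with rfl | hq
      · rw [Function.update_self]; exact ⟨s, hs, hl1⟩
      · rw [Function.update_of_ne]
        · exact h3 q hq
        · rintro rfl; exact hx.2 hq)
  replace hI := fun i => (hI i).1
  choose t ht using exists_triangle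
  have hb := fun m => he.boundary (ht m)
  have hmono : ∀ m n, m ≤ n → t m ≤ t n := fun m n hmn => by
    have := Nat.mul_le_mul hmn (Nat.succ_le_succ hmn)
    have h1 := ht m
    have h2 := ht n
    simp only [Nat.succ_eq_add_one] at this
    omega
  have hvis : ∀ m q, q.1 ≤ q.2 → q.2 < m → Visited (playPos e (t m)).2 q := fun m q hq hqm =>
    (he.proper (t m)).all q hq (by rw [(hb m).1]; exact hqm)
  have hN : ∀ m, ¬ G.LoseRule (playPos e (t m)) (Derivable G.LoseRule) := fun m h' =>
    (hI (t m)).2.1 (Derivable.intro LoseRule.mono h')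
  have hsucc : ∀ m, ¬ G.Success (playPos e (t m)).1 (label (playPos e (t m)).2) := fun m h' =>
    (hI (t m)).1 (Derivable.intro WinRule.mono (Or.inl h'))
  have hvalid : ∀ m, G.Valid m (label (playPos e (t m)).2) := by
    intro m
    by_contra hv
    exact hN m ⟨hsucc m, Or.inl (by rw [(hb m).1]; exact hv)⟩
  -- the labelling may have changed between the two boundaries, but not on the first `m` columns
  obtain ⟨m, n, hm, hmn, f, hf⟩ := exists_embed hS (fun m => label (playPos e (t m)).2) hvalid
    (fun m x hx => (hI (t m)).2.2 _ (hvis m _ (by dsimp only; omega) (by dsimp only; omega)))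
  refine hN n ⟨hsucc n, Or.inr (Or.inl ?_)⟩
  rw [(hb n).1]
  refine Subsumed.of_embed (f := f) G (hb n).2 hm hmn fun x hx => ?_
  have hlab : ∀ q : ℕ × ℕ, q.1 ≤ q.2 → q.2 < m →
      label (playPos e (t n)).2 q = label (playPos e (t m)).2 q := fun q hq hqm =>
    (he.label_eq (hmono m n hmn.le) (hvis m q hq hqm)).2
  obtain ⟨h1, h2, h3⟩ := hf x hx
  refine ⟨h1, ?_, fun y hy => ?_⟩
  · rw [hlab _ (by dsimp only; omega) (by dsimp only; omega)]; exact h2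
  · refine ⟨(h3 y hy).1, ?_⟩
    rw [← (h3 y hy).2]
    unfold Rel
    rw [hlab _ (min_le_max) (max_lt hx hy)]

/-- Exactly one of the players has a certificate. -/
theorem derivable_loseRule_iff_not (hs : ∃ s, s ∈ G.opts) :
    Derivable G.LoseRule (0, []) ↔ ¬ Derivable G.WinRule (0, []) :=
  ⟨fun h h' => (exists_win_of_derivable h').elim (not_win_of_derivable hs h),
    derivable_loseRule_of_not⟩

end Arena

/-! ### Reduced formulas and the closure -/

namespace Formula

theorem negate_negate {f : Formula} (h : ∀ g, f ≠ neg (neg g)) : negate (negate f) = f := by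
  cases f with
  | neg g => cases g with
    | neg g => exact absurd rfl (h g)
    | _ => rfl
  | _ => rfl

/-- Reduced formulas do not begin with a double negation. -/
theorem reduce_ne_neg_neg (f g : Formula) : f.reduce ≠ neg (neg g) := by
  induction f generalizing g with
  | atom p => simp [reduce]
  | or f1 f2 => simp [reduce]
  | dia R f => simp [reduce]
  | neg f ih =>
    rw [reduce]
    cases h : f.reduce with
    | neg k =>
      rintro (rfl : k = _)
      exact ih _ h
    | _ => simp [negate]

theorem reduce_negate (f : Formula) : (negate f).reduce = negate f.reduce := by
  cases f with
  | neg g => exact (negate_negate (reduce_ne_neg_neg g)).symm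
  | _ => rfl

theorem reduce_reduce (f : Formula) : f.reduce.reduce = f.reduce := by
  induction f with
  | atom p => rfl
  | neg f ih => rw [reduce, reduce_negate, ih]
  | or f g ihf ihg => rw [reduce, reduce, ihf, ihg]
  | dia R f ih => rw [reduce, reduce, ih]

theorem mem_subformulas_self (f : Formula) : f ∈ f.subformulas := by
  cases f <;> simp [subformulas]

theorem subformulas_trans {f g h : Formula} (hf : f ∈ g.subformulas) (hg : g ∈ h.subformulas) :
    f ∈ h.subformulas := by
  induction h with
  | atom p => rw [subformulas, Finset.mem_singleton] at hg; rwa [hg] at hf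
  | neg h ih =>
    rw [subformulas, Finset.mem_insert] at hg
    rcases hg with rfl | hg
    · exact hf
    · rw [subformulas, Finset.mem_insert]; exact Or.inr (ih hg)
  | or h1 h2 ih1 ih2 =>
    rw [subformulas, Finset.mem_insert, Finset.mem_union] at hg
    rcases hg with rfl | hg | hg
    · exact hf
    · rw [subformulas, Finset.mem_insert, Finset.mem_union]; exact Or.inr (Or.inl (ih1 hg))
    · rw [subformulas, Finset.mem_insert, Finset.mem_union]; exact Or.inr (Or.inr (ih2 hg))
  | dia R h ih =>
    rw [subformulas, Finset.mem_insert] at hg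
    rcases hg with rfl | hg
    · exact hf
    · rw [subformulas, Finset.mem_insert]; exact Or.inr (ih hg)

theorem subformulas_negate (f : Formula) {R : Modality} {g : Formula}
    (h : dia R g ∈ (negate f).subformulas) : dia R g ∈ f.subformulas := by
  cases f with
  | neg f => rw [subformulas, Finset.mem_insert]; exact Or.inr h
  | _ =>
    rcases Finset.mem_insert.1 h with h | h
    · cases h
    · exact h

theorem mem_closure {f φ : Formula} : f ∈ closure φ ↔
    ∃ g ∈ φ.subformulas, f = g.reduce ∨ f = negate g.reduce := by
  simp only [closure, Finset.mem_image, Finset.mem_union]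
  constructor
  · rintro ⟨g, hg | ⟨g, hg, rfl⟩, rfl⟩
    · exact ⟨g, hg, Or.inl rfl⟩
    · exact ⟨g, hg, Or.inr rfl⟩
  · rintro ⟨g, hg, rfl | rfl⟩
    · exact ⟨g, Or.inl hg, rfl⟩
    · exact ⟨neg g, Or.inr ⟨g, hg, rfl⟩, rfl⟩

/-- The arguments of all modal subformulas of `f` lie in the closure of `φ`. -/
def IsGood (φ f : Formula) : Prop := ∀ R g, dia R g ∈ f.subformulas → g ∈ closure φ

theorem isGood_reduce {φ f : Formula} (hf : f ∈ φ.subformulas) : IsGood φ f.reduce := by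
  induction f with
  | atom p =>
    intro R g h
    rw [reduce, subformulas, Finset.mem_singleton] at h
    cases h
  | neg f ih =>
    intro R g h
    exact ih (subformulas_trans (by simp [subformulas, mem_subformulas_self]) hf) R g
      (subformulas_negate _ h)
  | or f1 f2 ih1 ih2 =>
    intro R g h
    rw [reduce, subformulas, Finset.mem_insert, Finset.mem_union] at h
    rcases h with h | h | h
    · cases h
    · exact ih1 (subformulas_trans (by simp [subformulas, mem_subformulas_self]) hf) R g h
    · exact ih2 (subformulas_trans (by simp [subformulas, mem_subformulas_self]) hf) R g h
  | dia R' f ih =>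
    have hf' := subformulas_trans (show f ∈ (dia R' f).subformulas by
      simp [subformulas, mem_subformulas_self]) hf
    intro R g h
    rw [reduce, subformulas, Finset.mem_insert] at h
    rcases h with h | h
    · cases h
      exact mem_closure.2 ⟨f, hf', Or.inl rfl⟩
    · exact ih hf' R g h

theorem isGood_of_mem_closure {φ f : Formula} (hf : f ∈ closure φ) : IsGood φ f := by
  obtain ⟨g, hg, rfl | rfl⟩ := mem_closure.1 hf
  · exact isGood_reduce hg
  · exact fun R h hh => isGood_reduce hg R h (subformulas_negate _ hh)

theorem reduce_of_mem_closure {φ f : Formula} (hf : f ∈ closure φ) : f.reduce = f := by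
  obtain ⟨g, -, rfl | rfl⟩ := mem_closure.1 hf
  · exact reduce_reduce g
  · rw [reduce_negate, reduce_reduce]

theorem mem_requests {R : Modality} {f φ : Formula} : f ∈ requests R φ ↔
    ∃ g ∈ closure φ, f = dia R g ∨ f = neg (dia R (negate g)) := by
  simp only [requests, Finset.mem_image, Finset.mem_union]
  constructor
  · rintro ⟨_, ⟨g, hg, rfl⟩ | ⟨g, hg, rfl⟩, rfl⟩
    · exact ⟨g, hg, Or.inl (by rw [reduce, reduce_of_mem_closure hg])⟩
    · exact ⟨g, hg, Or.inr (by simp only [box, reduce, reduce_of_mem_closure hg, negate])⟩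
  · rintro ⟨g, hg, rfl | rfl⟩
    · exact ⟨_, Or.inl ⟨g, hg, rfl⟩, by rw [reduce, reduce_of_mem_closure hg]⟩
    · exact ⟨_, Or.inr ⟨g, hg, rfl⟩, by simp only [box, reduce, reduce_of_mem_closure hg, negate]⟩

/-- The temporal requests are the formulas `⟨R⟩ψ` with `ψ` in the closure. -/
theorem mem_temporal {f φ : Formula} :
    f ∈ temporal φ ↔ ∃ R, ∃ g ∈ closure φ, f = dia R g := by
  simp only [temporal, extendedClosure, Finset.mem_filter, Finset.mem_union]
  constructor
  · rintro ⟨h, hd⟩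
    have hreq : ∀ R, f ∈ requests R φ → ∃ R, ∃ g ∈ closure φ, f = dia R g := by
      intro R hR
      obtain ⟨g, hg, rfl | rfl⟩ := mem_requests.1 hR
      · exact ⟨R, g, hg, rfl⟩
      · cases hd
    rcases h with h | (h | h) | h
    · cases f with
      | dia R g => exact ⟨R, g, isGood_of_mem_closure h R g (mem_subformulas_self _), rfl⟩
      | _ => cases hd
    all_goals exact hreq _ h
  · rintro ⟨R, g, hg, rfl⟩
    refine ⟨Or.inr ?_, rfl⟩
    have : dia R g ∈ requests R φ := mem_requests.2 ⟨g, hg, Or.inl rfl⟩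
    cases R
    · exact Or.inl (Or.inl this)
    · exact Or.inl (Or.inr this)
    · exact Or.inr this

theorem mem_letters {f φ : Formula} :
    f ∈ letters φ ↔ f ∈ φ.subformulas ∧ f.isAtom = true := by
  simp [letters]

end Formula

open Formula

/-! ### Truth read off from labels -/

/-- Propositional evaluation of a formula, whose letters and modal subformulas are looked up in
the label `l`. -/
def ev (l : List Formula) : Formula → Bool
  | atom p => decide (atom p ∈ l)
  | neg f => !ev l f
  | Formula.or f g => ev l f || ev l g
  | dia R f => decide (dia R f ∈ l)

section Semantics

variable {D : Type*} [LinearOrder D] {V : NonemptyInterval D → Set Letter}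

theorem sat_negate (I : NonemptyInterval D) (f : Formula) :
    Sat V I (negate f) ↔ ¬ Sat V I f := by
  cases f with
  | neg f => simp only [negate, Sat, not_not]
  | _ => rfl

theorem sat_reduce (I : NonemptyInterval D) (f : Formula) : Sat V I f.reduce ↔ Sat V I f := by
  induction f generalizing I with
  | atom p => rfl
  | neg f ih => rw [reduce, sat_negate, ih]; rfl
  | or f g ihf ihg => simp only [reduce, Sat, ihf, ihg]
  | dia R f ih => simp only [reduce, Sat, ih]

/-- The temporal requests in the labels `l` are those that the labels fulfil. -/
def Coherent (φ : Formula) (l : NonemptyInterval D → List Formula) : Prop :=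
  ∀ I R, ∀ f ∈ closure φ, dia R f ∈ l I ↔ ∃ J, R.Rel I J ∧ ev (l J) f

variable {φ : Formula} {l : NonemptyInterval D → List Formula}

theorem sat_iff_ev (hV : ∀ I p, p ∈ V I ↔ atom p ∈ l I)
    (h : ∀ I, ∀ f ∈ temporal φ, Sat V I f ↔ f ∈ l I) {f : Formula} (hf : IsGood φ f)
    (I : NonemptyInterval D) : Sat V I f ↔ ev (l I) f := by
  induction f generalizing I with
  | atom p => simp [Sat, ev, hV]
  | neg f ih =>
    have := ih (fun R g hg => hf R g (by simp [subformulas, hg])) I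
    simp [Sat, ev, this]
  | or f g ihf ihg =>
    have h1 := ihf (fun R g hg => hf R g (by simp [subformulas, hg])) I
    have h2 := ihg (fun R g hg => hf R g (by simp [subformulas, hg])) I
    simp [Sat, ev, h1, h2]
  | dia R f ih =>
    rw [h I _ (mem_temporal.2 ⟨R, f, hf R f (mem_subformulas_self _), rfl⟩)]
    simp [ev]

theorem sat_iff_ev_of_coherent (hV : ∀ I p, p ∈ V I ↔ atom p ∈ l I) (h : Coherent φ l)
    {f : Formula} (hf : IsGood φ f) (I : NonemptyInterval D) : Sat V I f ↔ ev (l I) f := by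
  induction f generalizing I with
  | atom p => simp [Sat, ev, hV]
  | neg f ih =>
    have := ih (fun R g hg => hf R g (by simp [subformulas, hg])) I
    simp [Sat, ev, this]
  | or f g ihf ihg =>
    have h1 := ihf (fun R g hg => hf R g (by simp [subformulas, hg])) I
    have h2 := ihg (fun R g hg => hf R g (by simp [subformulas, hg])) I
    simp [Sat, ev, h1, h2]
  | dia R f ih =>
    have := ih (fun R g hg => hf R g (by simp [subformulas, hg]))
    simp only [Sat, ev, decide_eq_true_eq, this]
    exact (h I R f (hf R f (mem_subformulas_self _))).symm

/-- Requests may be compared with the truth values that the labels show instead of with the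
semantics. -/
theorem temporal_iff_coherent (hV : ∀ I p, p ∈ V I ↔ atom p ∈ l I) :
    (∀ I, ∀ f ∈ temporal φ, Sat V I f ↔ f ∈ l I) ↔ Coherent φ l := by
  constructor
  · intro h I R f hf
    rw [← h I _ (mem_temporal.2 ⟨R, f, hf, rfl⟩)]
    simp only [Sat, sat_iff_ev hV h (isGood_of_mem_closure hf)]
  · rintro h I _ hf
    obtain ⟨R, f, hf', rfl⟩ := mem_temporal.1 hf
    rw [h I R f hf']
    simp only [Sat, sat_iff_ev_of_coherent hV h (isGood_of_mem_closure hf')]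

end Semantics

/-! ### The arena of a formula -/

/-- A list of the subformulas of a formula. -/
def subList : Formula → List Formula
  | atom p => [atom p]
  | neg f => neg f :: subList f
  | Formula.or f g => Formula.or f g :: (subList f ++ subList g)
  | dia R f => dia R f :: subList f

theorem mem_subList {f φ : Formula} : f ∈ subList φ ↔ f ∈ φ.subformulas := by
  induction φ with
  | atom p => simp [subList, subformulas]
  | neg φ ih => simp [subList, subformulas, ih]
  | or φ ψ ih1 ih2 => simp [subList, subformulas, ih1, ih2]
  | dia R φ ih => simp [subList, subformulas, ih]

/-- A list of the closure of a formula. -/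
def closureList (φ : Formula) : List Formula :=
  (subList φ ++ (subList φ).map neg).map reduce

theorem mem_closureList {f φ : Formula} : f ∈ closureList φ ↔ f ∈ closure φ := by
  simp [closureList, Formula.closure, mem_subList, or_and_right, exists_or]

/-- A list of the alphabet of a formula. -/
def alphabetList (φ : Formula) : List Formula :=
  (subList φ).filter (fun f => f.isAtom) ++ (closureList φ).flatMap fun f =>
    [dia Modality.A f, dia Modality.B f, dia Modality.Bbar f]

theorem mem_alphabetList {f φ : Formula} : f ∈ alphabetList φ ↔ f ∈ alphabet φ := by
  simp only [alphabetList, alphabet, List.mem_append, List.mem_filter, mem_subList,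
    List.mem_flatMap, mem_closureList, Finset.mem_union, mem_letters, mem_temporal]
  refine or_congr Iff.rfl ⟨?_, ?_⟩
  · rintro ⟨g, hg, h⟩
    simp only [List.mem_cons, List.not_mem_nil, or_false] at h
    rcases h with rfl | rfl | rfl
    exacts [⟨_, g, hg, rfl⟩, ⟨_, g, hg, rfl⟩, ⟨_, g, hg, rfl⟩]
  · rintro ⟨R, g, hg, rfl⟩
    exact ⟨g, hg, by cases R <;> simp⟩

/-- All sublists of a list. -/
def sublistsOf {α : Type} (l : List α) : List (List α) :=
  l.foldr (fun a acc => acc ++ acc.map fun s => a :: s) [[]]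

theorem mem_sublistsOf {α : Type} {l s : List α} : s ∈ sublistsOf l ↔ s.Sublist l := by
  have : sublistsOf l = l.sublists' := by
    induction l with
    | nil => rfl
    | cons a l ih => rw [List.sublists'_cons, ← ih]; rfl
  rw [this, List.mem_sublists']

/-- A list of the letters and requests controlled by the duplicator. -/
def dupList (φ : Formula) (spo : List Formula) : List Formula :=
  ((alphabetList φ).filter fun f => f ∉ spo).dedup

theorem mem_dupList {f φ : Formula} {spo : List Formula} :
    f ∈ dupList φ spo ↔ f ∈ alphabet φ \ spo.toFinset := by
  simp [dupList, mem_alphabetList]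

/-- The arena of the synthesis problem. A label is a list of letters and requests, the part of the
spoiler followed by that of the duplicator. The requests `⟨B⟩f` accumulate along a row what `f` has
been so far, the requests `⟨B̄⟩f` foretell it, and `⟨A⟩f` on `[x, y]` depends on `y` only and is
settled on `[y, y]`. If the letter `∼` does not occur in `φ`, all points count as equivalent. -/
def arena (φ : Formula) (spo : List Formula) : Arena (List Formula) (List Formula) where
  opts := sublistsOf spo.dedup
  menu s := (sublistsOf (dupList φ spo)).map fun d => s ++ d
  start l := ev l φ.reduce = true
  init l := ∀ f ∈ closureList φ, dia Modality.B f ∉ l ∧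
    (dia Modality.A f ∈ l ↔ ev l f = true ∨ dia Modality.Bbar f ∈ l)
  final l := ∀ f ∈ closureList φ, dia Modality.Bbar f ∉ l
  sm l := atom sim ∉ subList φ ∨ atom sim ∈ l
  step l l' := ∀ f ∈ closureList φ,
    (dia Modality.B f ∈ l' ↔ ev l f = true ∨ dia Modality.B f ∈ l) ∧
    (dia Modality.Bbar f ∈ l ↔ ev l' f = true ∨ dia Modality.Bbar f ∈ l')
  col l l' := ∀ f ∈ closureList φ, dia Modality.A f ∈ l ↔ dia Modality.A f ∈ l'

theorem exists_mem_opts (φ : Formula) (spo : List Formula) : ∃ s, s ∈ (arena φ spo).opts :=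
  ⟨[], mem_sublistsOf.2 (List.nil_sublist _)⟩

/-- Coherence of labels over `{0, …, m-1}`, in terms of natural numbers. -/
theorem coherent_iff {φ : Formula} {m : ℕ} {L : ℕ × ℕ → List Formula} :
    Coherent φ (fun I : NonemptyInterval (Fin m) => L (I.fst, I.snd)) ↔
      ∀ x y, x ≤ y → y < m → ∀ f ∈ closureList φ,
        (dia Modality.B f ∈ L (x, y) ↔ ∃ z, x ≤ z ∧ z < y ∧ ev (L (x, z)) f = true) ∧
        (dia Modality.Bbar f ∈ L (x, y) ↔ ∃ z, y < z ∧ z < m ∧ ev (L (x, z)) f = true) ∧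
        (dia Modality.A f ∈ L (x, y) ↔ ∃ z, y ≤ z ∧ z < m ∧ ev (L (y, z)) f = true) := by
  have key : ∀ x y (h : x ≤ y) (hy : y < m) f,
      ((∃ J : NonemptyInterval (Fin m),
        Modality.B.Rel ⟨(⟨x, h.trans_lt hy⟩, ⟨y, hy⟩), h⟩ J ∧ ev (L (J.fst, J.snd)) f = true) ↔
        ∃ z, x ≤ z ∧ z < y ∧ ev (L (x, z)) f = true) ∧
      ((∃ J : NonemptyInterval (Fin m),
        Modality.Bbar.Rel ⟨(⟨x, h.trans_lt hy⟩, ⟨y, hy⟩), h⟩ J ∧ ev (L (J.fst, J.snd)) f = true) ↔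
        ∃ z, y < z ∧ z < m ∧ ev (L (x, z)) f = true) ∧
      ((∃ J : NonemptyInterval (Fin m),
        Modality.A.Rel ⟨(⟨x, h.trans_lt hy⟩, ⟨y, hy⟩), h⟩ J ∧ ev (L (J.fst, J.snd)) f = true) ↔
        ∃ z, y ≤ z ∧ z < m ∧ ev (L (y, z)) f = true) := by
    intro x y h hy f
    refine ⟨⟨?_, ?_⟩, ⟨?_, ?_⟩, ⟨?_, ?_⟩⟩
    · rintro ⟨⟨⟨a, b⟩, hab⟩, ⟨h1, h2⟩, h3⟩
      dsimp only at *
      subst h1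
      exact ⟨b, hab, h2, h3⟩
    · rintro ⟨z, h1, h2, h3⟩
      exact ⟨⟨(⟨x, h.trans_lt hy⟩, ⟨z, h2.trans hy⟩), h1⟩, ⟨rfl, h2⟩, h3⟩
    · rintro ⟨⟨⟨a, b⟩, hab⟩, ⟨h1, h2⟩, h3⟩
      dsimp only at *
      subst h1
      exact ⟨b, h2, b.2, h3⟩
    · rintro ⟨z, h1, h2, h3⟩
      exact ⟨⟨(⟨x, h.trans_lt hy⟩, ⟨z, h2⟩), h.trans h1.le⟩, ⟨rfl, h1⟩, h3⟩
    · rintro ⟨⟨⟨a, b⟩, hab⟩, h1, h3⟩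
      dsimp only [Modality.Rel] at *
      subst h1
      exact ⟨b, hab, b.2, h3⟩
    · rintro ⟨z, h1, h2, h3⟩
      exact ⟨⟨(⟨y, hy⟩, ⟨z, h2⟩), h1⟩, rfl, h3⟩
  constructor
  · intro hc x y h hy f hf
    have hk := key x y h hy f
    have hc' := fun R => hc ⟨(⟨x, h.trans_lt hy⟩, ⟨y, hy⟩), h⟩ R f (mem_closureList.1 hf)
    exact ⟨(hc' _).trans hk.1, (hc' _).trans hk.2.1, (hc' _).trans hk.2.2⟩
  · rintro hc ⟨⟨⟨x, hx⟩, ⟨y, hy⟩⟩, h⟩ R f hf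
    have hk := key x y h hy f
    have hc' := hc x y h hy f (mem_closureList.2 hf)
    cases R
    exacts [hc'.2.2.trans hk.2.2.symm, hc'.1.trans hk.1.symm, hc'.2.1.trans hk.2.1.symm]

/-- Coherence of the labels is a condition on consecutive labels of a row, and on the labels of a
column. -/
theorem coherent_iff_local {φ : Formula} {spo : List Formula} {m : ℕ}
    {L : ℕ × ℕ → List Formula} :
    Coherent φ (fun I : NonemptyInterval (Fin m) => L (I.fst, I.snd)) ↔
      (∀ x < m, (arena φ spo).init (L (x, x))) ∧
      (∀ x y, x ≤ y → y + 1 < m → (arena φ spo).step (L (x, y)) (L (x, y + 1))) ∧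
      (∀ x y, x ≤ y → y < m → (arena φ spo).col (L (x, y)) (L (y, y))) ∧
      ∀ x < m, (arena φ spo).final (L (x, m - 1)) := by
  rw [coherent_iff]
  constructor
  · intro h
    refine ⟨fun x hx f hf => ?_, fun x y hxy hy f hf => ?_, fun x y hxy hy f hf => ?_,
      fun x hx f hf => ?_⟩
    · obtain ⟨h1, h2, h3⟩ := h x x le_rfl hx f hf
      rw [h1, h2, h3]
      refine ⟨by rintro ⟨z, hz1, hz2, -⟩; omega, ?_, ?_⟩
      · rintro ⟨z, hz1, hz2, hz⟩
        rcases hz1.lt_or_eq with hz1 | rfl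
        · exact Or.inr ⟨z, hz1, hz2, hz⟩
        · exact Or.inl hz
      · rintro (hz | ⟨z, hz1, hz2, hz⟩)
        · exact ⟨x, le_rfl, hx, hz⟩
        · exact ⟨z, hz1.le, hz2, hz⟩
    · obtain ⟨h1, h2, -⟩ := h x y hxy (by omega) f hf
      obtain ⟨h1', h2', -⟩ := h x (y + 1) (by omega) hy f hf
      rw [h1, h2, h1', h2']
      refine ⟨⟨?_, ?_⟩, ?_, ?_⟩
      · rintro ⟨z, hz1, hz2, hz⟩
        rcases (Nat.lt_succ_iff.1 hz2).lt_or_eq with hz2 | rfl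
        · exact Or.inr ⟨z, hz1, hz2, hz⟩
        · exact Or.inl hz
      · rintro (hz | ⟨z, hz1, hz2, hz⟩)
        · exact ⟨y, hxy, y.lt_succ_self, hz⟩
        · exact ⟨z, hz1, by omega, hz⟩
      · rintro ⟨z, hz1, hz2, hz⟩
        rcases (Nat.succ_le_of_lt hz1).lt_or_eq with hz1 | rfl
        · exact Or.inr ⟨z, hz1, hz2, hz⟩
        · exact Or.inl hz
      · rintro (hz | ⟨z, hz1, hz2, hz⟩)
        · exact ⟨y + 1, y.lt_succ_self, hy, hz⟩
        · exact ⟨z, by omega, hz2, hz⟩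
    · rw [(h x y hxy hy f hf).2.2, (h y y le_rfl hy f hf).2.2]
    · rw [(h x (m - 1) (by omega) (by omega) f hf).2.1]
      rintro ⟨z, hz1, hz2, -⟩
      omega
  · rintro ⟨hinit, hstep, hcol, hfinal⟩
    have hB : ∀ f ∈ closureList φ, ∀ x y, x ≤ y → y < m → (dia Modality.B f ∈ L (x, y) ↔
        ∃ z, x ≤ z ∧ z < y ∧ ev (L (x, z)) f = true) := by
      intro f hf x y hxy
      induction hxy with
      | refl =>
        intro hx
        refine ⟨fun h => absurd h (hinit x hx f hf).1, ?_⟩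
        rintro ⟨z, hz1, hz2, -⟩; omega
      | @step y hxy ih =>
        intro hy
        rw [Nat.succ_eq_add_one, (hstep x y hxy hy f hf).1, ih (by omega)]
        constructor
        · rintro (hz | ⟨z, hz1, hz2, hz⟩)
          · exact ⟨y, hxy, y.lt_succ_self, hz⟩
          · exact ⟨z, hz1, by omega, hz⟩
        · rintro ⟨z, hz1, hz2, hz⟩
          rcases (Nat.lt_succ_iff.1 hz2).lt_or_eq with hz2 | rfl
          · exact Or.inr ⟨z, hz1, hz2, hz⟩
          · exact Or.inl hz
    have hBbar : ∀ f ∈ closureList φ, ∀ d x y, x ≤ y → y + d + 1 = m →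
        (dia Modality.Bbar f ∈ L (x, y) ↔ ∃ z, y < z ∧ z < m ∧ ev (L (x, z)) f = true) := by
      intro f hf d
      induction d with
      | zero =>
        intro x y hxy hy
        have := hfinal x (by omega) f hf
        rw [show m - 1 = y by omega] at this
        refine ⟨fun h => absurd h this, ?_⟩
        rintro ⟨z, hz1, hz2, -⟩; omega
      | succ d ih =>
        intro x y hxy hy
        rw [(hstep x y hxy (by omega) f hf).2, ih x (y + 1) (by omega) (by omega)]
        constructor
        · rintro (hz | ⟨z, hz1, hz2, hz⟩)
          · exact ⟨y + 1, y.lt_succ_self, by omega, hz⟩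
          · exact ⟨z, by omega, hz2, hz⟩
        · rintro ⟨z, hz1, hz2, hz⟩
          rcases (Nat.succ_le_of_lt hz1).lt_or_eq with hz1 | rfl
          · exact Or.inr ⟨z, hz1, hz2, hz⟩
          · exact Or.inl hz
    intro x y hxy hy f hf
    refine ⟨hB f hf x y hxy hy, hBbar f hf (m - 1 - y) x y hxy (by omega), ?_⟩
    rw [hcol x y hxy hy f hf, (hinit y hy f hf).2,
      hBbar f hf (m - 1 - y) y y le_rfl (by omega)]
    constructor
    · rintro (hz | ⟨z, hz1, hz2, hz⟩)
      · exact ⟨y, le_rfl, hy, hz⟩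
      · exact ⟨z, hz1.le, hz2, hz⟩
    · rintro ⟨z, hz1, hz2, hz⟩
      rcases hz1.lt_or_eq with hz1 | rfl
      · exact Or.inr ⟨z, hz1, hz2, hz⟩
      · exact Or.inl hz

/-- The condition on the letter `∼`, in terms of the relation that the labelling declares. -/
theorem interpretsSim_iff {φ : Formula} {spo : List Formula} {m : ℕ}
    {L : ℕ × ℕ → List Formula} {V : NonemptyInterval (Fin m) → Set Letter}
    (hV : ∀ I p, p ∈ V I ↔ atom p ∈ L (I.fst, I.snd)) :
    (atom sim ∈ φ.letters → InterpretsSim V) ↔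
      (∀ x < m, (arena φ spo).Rel L x x) ∧
      ∀ x < m, ∀ y < m, ∀ z < m, (arena φ spo).Rel L x y → (arena φ spo).Rel L y z →
        (arena φ spo).Rel L x z := by
  by_cases hsim : atom sim ∈ φ.letters
  · have hsub : atom sim ∈ subList φ := mem_subList.2 (mem_letters.1 hsim).1
    have hRel : ∀ x y, (arena φ spo).Rel L x y ↔ atom sim ∈ L (min x y, max x y) := fun x y =>
      ⟨fun h => h.resolve_left (not_not_intro hsub), Or.inr⟩
    simp only [hsim, forall_const]
    constructor
    · rintro ⟨E, hE⟩
      have hR : ∀ x y (hx : x < m) (hy : y < m),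
          (arena φ spo).Rel L x y ↔ E ⟨x, hx⟩ ⟨y, hy⟩ := by
        intro x y hx hy
        rw [hRel]
        rcases le_total x y with h | h
        · rw [min_eq_left h, max_eq_right h,
            ← hE (⟨(⟨x, hx⟩, ⟨y, hy⟩), h⟩ : NonemptyInterval (Fin m)), hV]
        · rw [min_eq_right h, max_eq_left h, E.comm',
            ← hE (⟨(⟨y, hy⟩, ⟨x, hx⟩), h⟩ : NonemptyInterval (Fin m)), hV]
      refine ⟨fun x hx => (hR x x hx hx).2 (E.refl _), fun x hx y hy z hz h1 h2 => ?_⟩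
      exact (hR x z hx hz).2 (E.trans ((hR x y hx hy).1 h1) ((hR y z hy hz).1 h2))
    · rintro ⟨hr, ht⟩
      refine ⟨⟨fun x y => (arena φ spo).Rel L x y, fun x => hr x x.2, fun h => h.symm,
        fun {x y z} h1 h2 => ht x x.2 y y.2 z z.2 h1 h2⟩, fun I => ?_⟩
      have h : (I.fst : ℕ) ≤ I.snd := I.fst_le_snd
      show _ ↔ (arena φ spo).Rel L I.fst I.snd
      rw [hRel, hV, min_eq_left h, max_eq_right h]
  · have hsub : atom sim ∉ subList φ := fun h => hsim (mem_letters.2 ⟨mem_subList.1 h, rfl⟩)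
    have hRel : ∀ x y, (arena φ spo).Rel L x y := fun x y => Or.inl hsub
    simp [hsim, hRel]

/-- Success in the arena is success in the sense of the logic. -/
theorem success_iff {φ : Formula} {spo : List Formula} {m : ℕ} (hm : 0 < m)
    {L : ℕ × ℕ → List Formula} {V : NonemptyInterval (Fin m) → Set Letter}
    (hV : ∀ I p, p ∈ V I ↔ atom p ∈ L (I.fst, I.snd)) :
    (arena φ spo).Success m L ↔
      (atom sim ∈ φ.letters → InterpretsSim V) ∧
      Sat V (NonemptyInterval.pure ⟨0, hm⟩) φ ∧
      ∀ I : NonemptyInterval (Fin m), ∀ f ∈ φ.temporal, Sat V I f ↔ f ∈ L (I.fst, I.snd) := by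
  have h1 := interpretsSim_iff (φ := φ) (spo := spo) hV
  have h2 := temporal_iff_coherent (φ := φ) hV
  have h3 : Coherent φ (fun I : NonemptyInterval (Fin m) => L (I.fst, I.snd)) →
      (Sat V (NonemptyInterval.pure ⟨0, hm⟩) φ ↔ (arena φ spo).start (L (0, 0))) := by
    intro hc
    rw [← sat_reduce, sat_iff_ev_of_coherent hV hc (isGood_reduce (mem_subformulas_self φ))]
    rfl
  rw [h1, h2]
  constructor
  · rintro ⟨-, hv, hf⟩
    have hc := (coherent_iff_local (spo := spo)).2 ⟨hv.init, hv.step, hv.col, hf⟩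
    exact ⟨⟨hv.refl, hv.trans⟩, (h3 hc).2 (hv.start hm), hc⟩
  · rintro ⟨⟨hr, ht⟩, hs, hc⟩
    obtain ⟨hi, hst, hco, hf⟩ := (coherent_iff_local (spo := spo)).1 hc
    exact ⟨hm, ⟨fun _ => (h3 hc).1 hs, hi, hst, hco, hr, ht⟩, hf⟩

/-! ### Admissible runs as plays -/

/-- In a list without repetitions a sublist is determined by its members. -/
theorem filter_mem_of_sublist {α : Type*} [DecidableEq α] {l s : List α} (hl : l.Nodup)
    (hs : s.Sublist l) : l.filter (fun a => a ∈ s) = s := by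
  induction hs with
  | slnil => rfl
  | @cons s l a h ih =>
    rw [List.nodup_cons] at hl
    rw [List.filter_cons_of_neg (by simpa using fun h' => hl.1 (h.subset h')), ih hl.2]
  | @cons_cons s l a h ih =>
    rw [List.nodup_cons] at hl
    rw [List.filter_cons_of_pos (by simp)]
    congr 1
    refine Eq.trans (List.filter_congr fun b hb => ?_) (ih hl.2)
    have : b ≠ a := fun e => hl.1 (e ▸ hb)
    simp [this]

/-- The label of an interval on which the spoiler has put `s` and the duplicator `d`. The two sets
are listed in a fixed order, so that the label is among those that the arena offers. -/
def roundLabel (φ : Formula) (spo : List Formula) (s d : Finset Formula) : List Formula :=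
  spo.dedup.filter (fun f => f ∈ s) ++ (dupList φ spo).filter (fun f => f ∈ d)

theorem mem_roundLabel {φ : Formula} {spo : List Formula} {s d : Finset Formula}
    (hs : s ⊆ spo.toFinset) (hd : d ⊆ φ.alphabet \ spo.toFinset) {f : Formula} :
    f ∈ roundLabel φ spo s d ↔ f ∈ s ∨ f ∈ d := by
  have h1 : f ∈ s → f ∈ spo := fun h => List.mem_toFinset.1 (hs h)
  have h2 : f ∈ d → f ∈ dupList φ spo := fun h => mem_dupList.2 (hd h)
  simp only [roundLabel, List.mem_append, List.mem_filter, List.mem_dedup, decide_eq_true_eq]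
  tauto

theorem roundLabel_mem_menu (φ : Formula) (spo : List Formula) (s d : Finset Formula) :
    spo.dedup.filter (fun f => f ∈ s) ∈ (arena φ spo).opts ∧ roundLabel φ spo s d ∈
      (arena φ spo).menu (spo.dedup.filter (fun f => f ∈ s)) :=
  ⟨mem_sublistsOf.2 List.filter_sublist,
    List.mem_map.2 ⟨_, mem_sublistsOf.2 List.filter_sublist, rfl⟩⟩

theorem nodup_dupList (φ : Formula) (spo : List Formula) : (dupList φ spo).Nodup :=
  List.nodup_dedup _

/-- The sequence of rows and labels of the rounds of a run. -/
def rounds (φ : Formula) (spo : List Formula) (ρ : ℕ → Move) (i : ℕ) : ℕ × List Formula :=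
  ((ρ (2 * i)).1.fst, roundLabel φ spo (ρ (2 * i)).2 (ρ (2 * i + 1)).2)

/-- The sequence of moves is an infinite admissible run, in the language of plays: round `i`
consists of the moves `2i` and `2i + 1`. -/
structure IsPlay (φ : Formula) (spo : List Formula) (ρ : ℕ → Move) : Prop where
  legal : LegalPlay (rounds φ spo ρ)
  snd : ∀ i, (ρ (2 * i)).1.snd = (playPos (rounds φ spo ρ) i).1
  same : ∀ i, (ρ (2 * i + 1)).1 = (ρ (2 * i)).1
  spoiler : ∀ i, (ρ (2 * i)).2 ⊆ spo.toFinset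
  duplicator : ∀ i, (ρ (2 * i + 1)).2 ⊆ φ.alphabet \ spo.toFinset

theorem visited_playPos {Λ : Type} {e : ℕ → ℕ × Λ} {i : ℕ} {q : ℕ × ℕ} :
    Visited (playPos e i).2 q ↔ ∃ j < i, q = ((e j).1, (playPos e j).1) := by
  induction i with
  | zero => simp [playPos]
  | succ i ih =>
    show Visited (_ :: _) q ↔ _
    rw [visited_cons, ih]
    constructor
    · rintro (h | ⟨j, hj, h⟩)
      · exact ⟨i, i.lt_succ_self, h⟩
      · exact ⟨j, by omega, h⟩
    · rintro ⟨j, hj, h⟩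
      rcases (Nat.lt_succ_iff.1 hj).lt_or_eq with hj | rfl
      · exact Or.inr ⟨j, hj, h⟩
      · exact Or.inl h

theorem label_playPos {Λ : Type} [Inhabited Λ] {e : ℕ → ℕ × Λ} (he : LegalPlay e) {i j : ℕ}
    (hij : j < i) : label (playPos e i).2 ((e j).1, (playPos e j).1) = (e j).2 := by
  have hv : Visited (playPos e (j + 1)).2 ((e j).1, (playPos e j).1) :=
    visited_playPos.2 ⟨j, j.lt_succ_self, rfl⟩
  rw [(he.label_eq (Nat.succ_le_of_lt hij) hv).2]
  show label (_ :: _) _ = _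
  rw [label_cons, Function.update_self]

theorem playPos_congr {Λ : Type} {e e' : ℕ → ℕ × Λ} {i : ℕ} (h : ∀ j < i, e j = e' j) :
    playPos e i = playPos e' i := by
  induction i with
  | zero => rfl
  | succ i ih =>
    rw [playPos, playPos, ih fun j hj => h j (by omega), h i i.lt_succ_self]

theorem interval_ext {I J : NonemptyInterval ℕ} (h1 : I.fst = J.fst) (h2 : I.snd = J.snd) :
    I = J :=
  NonemptyInterval.ext (Prod.ext h1 h2)

section Runs

variable {φ : Formula} {spo : List Formula} {ρ : ℕ → Move}

/-- In an admissible run the right endpoint changes exactly when a column is complete, so its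
rounds form a legal play. -/
theorem isPlay_of_isAdmissibleRun (h : IsAdmissibleRun φ spo.toFinset ⊤ ρ) :
    IsPlay φ spo ρ := by
  have hround := fun i => h.round (2 * i) (even_two_mul i) (WithTop.coe_lt_top _)
  have hinj : ∀ i j, j < i → (ρ (2 * j)).1 ≠ (ρ (2 * i)).1 := fun i j hij e =>
    (hround j).2.2.2 (2 * i) (WithTop.coe_lt_top _) (by omega) (by omega) e.symm
  set e := rounds φ spo ρ with he
  have hkey : ∀ i, Proper (playPos e i) → (∀ j < i, (ρ (2 * j)).1.snd = (playPos e j).1) →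
      LegalMove (playPos e i) (e i).1 ∧ (ρ (2 * i)).1.snd = (playPos e i).1 := by
    intro i hp hs
    have hvis : ∀ I : NonemptyInterval ℕ, Visited (playPos e i).2 (I.fst, I.snd) ↔
        ∃ j < i, I = (ρ (2 * j)).1 := by
      intro I
      rw [visited_playPos]
      constructor
      · rintro ⟨j, hj, hq⟩
        obtain ⟨h1, h2⟩ := Prod.ext_iff.1 hq
        exact ⟨j, hj, interval_ext h1 (h2.trans (hs j hj).symm)⟩
      · rintro ⟨j, hj, rfl⟩
        exact ⟨j, hj, Prod.ext rfl (hs j hj)⟩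
    have hnew : ¬ Visited (playPos e i).2 ((ρ (2 * i)).1.fst, (ρ (2 * i)).1.snd) := by
      rw [hvis]
      rintro ⟨j, hj, hq⟩
      exact hinj i j hj hq.symm
    have hsnd : (ρ (2 * i)).1.snd = (playPos e i).1 := by
      rcases i with _ | i
      · have := h.start
        simp only [mul_zero] at this ⊢
        rw [this]; rfl
      · have h1 : (ρ (2 * i + 1)).1.snd = (playPos e i).1 := by
          rw [(hround i).1]; exact hs i i.lt_succ_self
        have horder := h.order (2 * i + 1) (WithTop.coe_lt_top _)
        rw [show 2 * i + 1 + 1 = 2 * (i + 1) by ring, h1] at horder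
        have hall : (ρ (2 * (i + 1))).1.snd ≠ (playPos e i).1 →
            (ρ (2 * (i + 1))).1.snd = (playPos e i).1 + 1 ∧
            Complete (playPos e i).1 (playPos e (i + 1)).2 := by
          intro hne
          obtain ⟨h2, h3⟩ := horder hne
          refine ⟨h2, fun x hx => ?_⟩
          obtain ⟨j, hj, hjI⟩ := h3 ⟨(x, (playPos e i).1), by dsimp only; omega⟩
            (by show (playPos e i).1 < _; omega)
          refine (hvis ⟨(x, (playPos e i).1), by dsimp only; omega⟩).2 ⟨j / 2, by omega, ?_⟩
          rw [← hjI]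
          rcases Nat.even_or_odd' j with ⟨c, rfl | rfl⟩
          · rw [Nat.mul_div_cancel_left _ two_pos]
          · rw [show (2 * c + 1) / 2 = c by omega, (hround c).1]
        have hc : Complete (playPos e i).1 (playPos e (i + 1)).2 →
            (ρ (2 * (i + 1))).1.snd ≠ (playPos e i).1 := by
          intro hc hsnd
          refine hnew ?_
          rw [hsnd]
          exact hc _ (by have := (ρ (2 * (i + 1))).1.fst_le_snd; omega)
        by_cases hcomp : Complete (playPos e i).1 (playPos e (i + 1)).2
        · rw [(hall (hc hcomp)).1, fst_playPos_of_complete hcomp]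
        · rw [fst_playPos_of_not_complete hcomp]
          by_contra hne
          exact hcomp (hall hne).2
    refine ⟨⟨?_, ?_⟩, hsnd⟩
    · have := (ρ (2 * i)).1.fst_le_snd
      show (ρ (2 * i)).1.fst < _
      omega
    · rw [← hsnd]; exact hnew
  have hall : ∀ i, Proper (playPos e i) ∧ ∀ j < i, LegalMove (playPos e j) (e j).1 ∧
      (ρ (2 * j)).1.snd = (playPos e j).1 := by
    intro i
    induction i with
    | zero => exact ⟨proper_zero, by simp⟩
    | succ i ih =>
      have := hkey i ih.1 fun j hj => (ih.2 j hj).2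
      refine ⟨ih.1.advance this.1, fun j hj => ?_⟩
      rcases (Nat.lt_succ_iff.1 hj).lt_or_eq with hj | rfl
      · exact ih.2 j hj
      · exact this
  exact ⟨fun i => ((hall (i + 1)).2 i i.lt_succ_self).1,
    fun i => ((hall (i + 1)).2 i i.lt_succ_self).2, fun i => (hround i).1,
    fun i => (hround i).2.1, fun i => (hround i).2.2.1⟩

theorem IsPlay.inj (h : IsPlay φ spo ρ) {i j : ℕ} (hij : (ρ (2 * i)).1 = (ρ (2 * j)).1) :
    i = j := by
  have : ∀ i j, i < j → (ρ (2 * i)).1 ≠ (ρ (2 * j)).1 := by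
    intro i j hlt e
    refine (h.legal j).2 (visited_playPos.2 ⟨i, hlt, ?_⟩)
    rw [← h.snd, ← h.snd, ← e]
    show ((ρ (2 * j)).1.fst, _) = ((ρ (2 * i)).1.fst, _)
    rw [e]
  rcases lt_trichotomy i j with hlt | heq | hlt
  · exact absurd hij (this i j hlt)
  · exact heq
  · exact absurd hij.symm (this j i hlt)

theorem IsPlay.visited_iff (h : IsPlay φ spo ρ) {i : ℕ} {I : NonemptyInterval ℕ} :
    Visited (playPos (rounds φ spo ρ) i).2 (I.fst, I.snd) ↔ ∃ j < i, (ρ (2 * j)).1 = I := by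
  rw [visited_playPos]
  constructor
  · rintro ⟨j, hj, hq⟩
    obtain ⟨h1, h2⟩ := Prod.ext_iff.1 hq
    exact ⟨j, hj, (interval_ext h1 (h2.trans (h.snd j).symm)).symm⟩
  · rintro ⟨j, hj, rfl⟩
    exact ⟨j, hj, Prod.ext rfl (h.snd j)⟩

theorem IsPlay.exists_round (h : IsPlay φ spo ρ) {m t : ℕ} (ht : 2 * t = m * (m + 1))
    {I : NonemptyInterval ℕ} (hI : I.snd < m) : ∃ j < t, (ρ (2 * j)).1 = I :=
  h.visited_iff.1 ((h.legal.proper t).all (I.fst, I.snd) I.fst_le_snd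
    (by rw [(h.legal.boundary ht).1]; exact hI))

/-- Conversely, plays are infinite admissible runs, and cut at a boundary between columns they are
finite ones. -/
theorem IsPlay.isAdmissibleRun (h : IsPlay φ spo ρ) {N : ℕ∞}
    (hN : (∃ m : ℕ, 0 < m ∧ N = ((m * (m + 1) : ℕ) : ℕ∞)) ∨ N = ⊤) :
    IsAdmissibleRun φ spo.toFinset N ρ where
  finite_or_infinite := by
    rcases hN with ⟨m, hm, rfl⟩ | rfl
    · refine Or.inl ⟨m, hm, rfl, fun I hI => ?_⟩
      obtain ⟨t, ht⟩ := exists_triangle m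
      obtain ⟨j, hj, hjI⟩ := h.exists_round ht hI
      exact ⟨2 * j, Nat.cast_lt.2 (by omega), hjI⟩
    · refine Or.inr ⟨rfl, fun I => ?_⟩
      obtain ⟨t, ht⟩ := exists_triangle (I.snd + 1)
      obtain ⟨j, -, hjI⟩ := h.exists_round ht I.snd.lt_succ_self
      exact ⟨2 * j, hjI⟩
  start := by
    have h1 := h.snd 0
    have h2 := (ρ (2 * 0)).1.fst_le_snd
    rw [h1] at h2
    exact interval_ext (Nat.le_zero.1 h2) h1
  round := by
    intro i hi _
    obtain ⟨k, rfl⟩ := hi.two_dvd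
    refine ⟨h.same k, h.spoiler k, h.duplicator k, fun j _ h1 h2 e => ?_⟩
    rcases Nat.even_or_odd' j with ⟨c, rfl | rfl⟩
    · have := h.inj e; omega
    · rw [h.same] at e
      have := h.inj e; omega
  order := by
    intro i _ hne
    rcases Nat.even_or_odd' i with ⟨c, rfl | rfl⟩
    · rw [h.same] at hne; exact absurd rfl hne
    · rw [show 2 * c + 1 + 1 = 2 * (c + 1) by ring, h.same, h.snd, h.snd] at *
      have hadv : (playPos (rounds φ spo ρ) (c + 1)).1 = (playPos (rounds φ spo ρ) c).1 + 1 := by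
        by_cases hc : Complete (playPos (rounds φ spo ρ) c).1 (playPos (rounds φ spo ρ) (c + 1)).2
        · exact fst_playPos_of_complete hc
        · exact absurd (fst_playPos_of_not_complete hc) hne
      refine ⟨hadv, fun I hI => ?_⟩
      obtain ⟨j, hj, hjI⟩ := h.visited_iff.1
        ((h.legal.proper (c + 1)).all (I.fst, I.snd) I.fst_le_snd hI)
      exact ⟨2 * j, by omega, hjI⟩

/-- The label of an interval in the induced structure is the one recorded in the play. -/
theorem IsPlay.mem_labelOn (h : IsPlay φ spo ρ) {m t : ℕ} (ht : 2 * t = m * (m + 1))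
    {I : NonemptyInterval ℕ} (hI : I.snd < m) {f : Formula} :
    f ∈ labelOn (m * (m + 1)) ρ I ↔
      f ∈ label (playPos (rounds φ spo ρ) t).2 (I.fst, I.snd) := by
  obtain ⟨j, hj, rfl⟩ := h.exists_round ht hI
  have h1 := label_playPos h.legal hj
  rw [← h.snd] at h1
  have h2 : label (playPos (rounds φ spo ρ) t).2 ((ρ (2 * j)).1.fst, (ρ (2 * j)).1.snd) =
      roundLabel φ spo (ρ (2 * j)).2 (ρ (2 * j + 1)).2 := h1
  rw [h2, mem_roundLabel (h.spoiler j) (h.duplicator j)]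
  constructor
  · rintro ⟨i, hi, -, hiI, hf⟩
    obtain ⟨k, rfl⟩ := hi.two_dvd
    rwa [h.inj hiI] at hf
  · intro hf
    exact ⟨2 * j, even_two_mul j, by omega, rfl, hf⟩

theorem IsPlay.isSuccessful_iff (h : IsPlay φ spo ρ) {m t : ℕ} (hm : 0 < m)
    (ht : 2 * t = m * (m + 1)) : IsSuccessful φ m hm ρ ↔
      (arena φ spo).Success m (label (playPos (rounds φ spo ρ) t).2) := by
  have hl : ∀ (I : NonemptyInterval (Fin m)) (f : Formula),
      f ∈ labelOn (m * (m + 1)) ρ (liftInterval I) ↔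
        f ∈ label (playPos (rounds φ spo ρ) t).2 (I.fst, I.snd) := fun I f =>
    h.mem_labelOn ht (I := liftInterval I) I.snd.2
  rw [success_iff (spo := spo) hm (V := inducedValuation m ρ) (fun I p => hl I (atom p))]
  unfold IsSuccessful
  simp only [hl]

/-- Changing the duplicator's labels does not affect admissibility. -/
theorem isAdmissibleRun_congr {ρ' : ℕ → Move} (h : IsAdmissibleRun φ spo.toFinset ⊤ ρ)
    (h1 : ∀ i, (ρ' i).1 = (ρ i).1) (h2 : ∀ i, (ρ' (2 * i)).2 = (ρ (2 * i)).2)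
    (h3 : ∀ i, (ρ' (2 * i + 1)).2 ⊆ φ.alphabet \ spo.toFinset) :
    IsAdmissibleRun φ spo.toFinset ⊤ ρ' where
  finite_or_infinite := by simpa only [h1] using h.finite_or_infinite
  start := by rw [h1]; exact h.start
  round := by
    intro i hi hN
    have := h.round i hi hN
    simp only [h1]
    obtain ⟨k, rfl⟩ := hi.two_dvd
    exact ⟨this.1, by rw [h2]; exact this.2.1, h3 k, this.2.2.2⟩
  order := by simpa only [h1] using h.order

theorem response_even (S : List Move → Finset Formula) (ρs : ℕ → Move) (i : ℕ) :
    response S ρs (2 * i) = ρs i := by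
  rw [response, if_pos (by omega), Nat.mul_div_cancel_left _ two_pos]

theorem response_odd (S : List Move → Finset Formula) (ρs : ℕ → Move) (i : ℕ) :
    response S ρs (2 * i + 1) =
      ((ρs i).1, S (List.ofFn fun j : Fin (2 * i + 1) => response S ρs j)) := by
  rw [response, if_neg (by omega), show (2 * i + 1) / 2 = i by omega]

end Runs

/-! ### Strategies of the duplicator -/

section Duplicator

variable (φ : Formula) (spo : List Formula)

/-- Answering `d` to the spoiler's labelling of row `x` by `s` leaves a position from which the
duplicator wins within `k` further columns. -/
def WinningAnswer (p : Position (List Formula)) (x : ℕ) (s : Finset Formula) (k : ℕ)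
    (d : Finset Formula) : Prop :=
  d ⊆ φ.alphabet \ spo.toFinset ∧
    (arena φ spo).Force p.1 ((arena φ spo).Win k (p.1 + 1)) ((unvisited p.1 p.2).erase x).card
      ((unvisited p.1 p.2).erase x)
      (Function.update (label p.2) (x, p.1) (roundLabel φ spo s d))

open Classical in
/-- An answer that wins within as few columns as possible, if there is one. -/
noncomputable def bestAnswer (p : Position (List Formula)) (x : ℕ) (s : Finset Formula) :
    Finset Formula :=
  if h : ∃ k, ∃ d, WinningAnswer φ spo p x s k d then (Nat.find_spec h).choose else ∅

variable {φ spo}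

theorem bestAnswer_subset (p : Position (List Formula)) (x : ℕ) (s : Finset Formula) :
    bestAnswer φ spo p x s ⊆ φ.alphabet \ spo.toFinset := by
  classical
  unfold bestAnswer
  split_ifs with h
  · exact (Nat.find_spec h).choose_spec.1
  · exact Finset.empty_subset _

theorem bestAnswer_spec {p : Position (List Formula)} {x : ℕ} {s : Finset Formula} {k : ℕ}
    (h : ∃ d, WinningAnswer φ spo p x s k d) :
    WinningAnswer φ spo p x s k (bestAnswer φ spo p x s) := by
  classical
  have h' : ∃ k, ∃ d, WinningAnswer φ spo p x s k d := ⟨k, h⟩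
  have heq : bestAnswer φ spo p x s = (Nat.find_spec h').choose := dif_pos h'
  rw [heq]
  obtain ⟨h1, h2⟩ := (Nat.find_spec h').choose_spec
  exact ⟨h1, h2.mono fun L hL => hL.mono (Nat.find_min' h' h)⟩

variable (φ spo)

/-- The move number `j` of a list of moves. -/
def moveAt (h : List Move) (j : ℕ) : Move := h.getD j (NonemptyInterval.pure 0, ∅)

/-- The duplicator's strategy: play the best answer. -/
noncomputable def bestStrategy (h : List Move) : Finset Formula :=
  bestAnswer φ spo (playPos (rounds φ spo (moveAt h)) (h.length / 2))
    (moveAt h (2 * (h.length / 2))).1.fst (moveAt h (2 * (h.length / 2))).2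

variable {φ spo}

theorem moveAt_ofFn {ρ : ℕ → Move} {n j : ℕ} (hj : j < n) :
    moveAt (List.ofFn fun j : Fin n => ρ j) j = ρ j := by
  simp [moveAt, List.getD, hj]

theorem bestStrategy_ofFn (ρ : ℕ → Move) (i : ℕ) :
    bestStrategy φ spo (List.ofFn fun j : Fin (2 * i + 1) => ρ j) =
      bestAnswer φ spo (playPos (rounds φ spo ρ) i) (ρ (2 * i)).1.fst (ρ (2 * i)).2 := by
  unfold bestStrategy
  rw [List.length_ofFn, show (2 * i + 1) / 2 = i by omega, moveAt_ofFn (by omega)]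
  congr 1
  refine playPos_congr fun j hj => ?_
  unfold rounds
  rw [moveAt_ofFn (by omega), moveAt_ofFn (by omega)]

/-- Following the best answers, the duplicator reaches success. -/
theorem exists_success_of_force {ρ : ℕ → Move} (h : IsPlay φ spo ρ)
    (hbest : ∀ i, (ρ (2 * i + 1)).2 =
      bestAnswer φ spo (playPos (rounds φ spo ρ) i) (ρ (2 * i)).1.fst (ρ (2 * i)).2) (k : ℕ) :
    ∀ i, (arena φ spo).Force (playPos (rounds φ spo ρ) i).1
      ((arena φ spo).Win k ((playPos (rounds φ spo ρ) i).1 + 1))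
      (unvisited (playPos (rounds φ spo ρ) i).1 (playPos (rounds φ spo ρ) i).2).card
      (unvisited (playPos (rounds φ spo ρ) i).1 (playPos (rounds φ spo ρ) i).2)
      (label (playPos (rounds φ spo ρ) i).2) →
    ∃ m, 0 < m ∧ ∃ t, 2 * t = m * (m + 1) ∧
      (arena φ spo).Success m (label (playPos (rounds φ spo ρ) t).2) := by
  set e := rounds φ spo ρ with he
  induction k using Nat.strong_induction_on with
  | _ k ihk =>
  intro i
  generalize hc : (unvisited (playPos e i).1 (playPos e i).2).card = c
  induction c generalizing i with
  | zero =>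
    exact absurd (complete_iff_unvisited_eq_empty.2 (Finset.card_eq_zero.1 hc))
      (h.legal.proper i).not_complete
  | succ c ihc =>
    intro hF
    have hx := h.legal i
    have hxU := mem_unvisited.2 hx
    have hcard : ((unvisited (playPos e i).1 (playPos e i).2).erase (e i).1).card = c := by
      rw [Finset.card_erase_of_mem hxU, hc]; rfl
    have hw : WinningAnswer φ spo (playPos e i) (e i).1 (ρ (2 * i)).2 k (ρ (2 * i + 1)).2 := by
      rw [hbest]
      refine bestAnswer_spec ?_
      obtain ⟨l, hl, hF⟩ := hF (e i).1 hxU _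
        (roundLabel_mem_menu φ spo (ρ (2 * i)).2 (ρ (2 * i + 1)).2).1
      obtain ⟨d, hd, rfl⟩ := List.mem_map.1 hl
      rw [mem_sublistsOf] at hd
      refine ⟨d.toFinset, fun f hf => mem_dupList.1 (hd.subset (List.mem_toFinset.1 hf)), ?_⟩
      rw [hcard]
      convert hF using 2
      unfold roundLabel
      congr 1
      simp only [List.mem_toFinset]
      exact filter_mem_of_sublist (nodup_dupList φ spo) hd
    have hF := hw.2
    rw [hcard] at hF
    have hlab : label (playPos e (i + 1)).2 = Function.update (label (playPos e i).2)
        ((e i).1, (playPos e i).1) (roundLabel φ spo (ρ (2 * i)).2 (ρ (2 * i + 1)).2) :=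
      label_cons _ _ _
    have hunv : unvisited (playPos e i).1 (playPos e (i + 1)).2 =
        (unvisited (playPos e i).1 (playPos e i).2).erase (e i).1 := unvisited_cons
    rw [← hlab, ← hunv] at hF
    rw [← hunv] at hcard
    by_cases hcomp : Complete (playPos e i).1 (playPos e (i + 1)).2
    · have hn := fst_playPos_of_complete hcomp
      rw [complete_iff_unvisited_eq_empty] at hcomp
      rw [hcomp, Finset.card_empty] at hcard
      subst hcard
      rw [hcomp] at hF
      have hold : OldColumns (playPos e i).1 (playPos e (i + 1)).2 :=
        OldColumns.cons (h.legal.proper i).oldColumns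
      have hW : (arena φ spo).Win k ((playPos e i).1 + 1) (label (playPos e (i + 1)).2) := hF
      have hsucc : (arena φ spo).Success ((playPos e i).1 + 1) (label (playPos e (i + 1)).2) →
          ∃ m, 0 < m ∧ ∃ t, 2 * t = m * (m + 1) ∧
            (arena φ spo).Success m (label (playPos e t).2) := by
        refine fun hs => ⟨(playPos e i).1 + 1, Nat.succ_pos _, i + 1, ?_, hs⟩
        have := (h.legal.proper (i + 1)).count
        rw [hn, hold.unvisited_succ, Finset.card_range, length_playPos] at this
        omega
      rcases k with _ | k
      · exact hsucc hW
      · rcases hW with hW | hW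
        · exact hsucc hW
        · refine ihk k k.lt_succ_self (i + 1) ?_
          rw [hn, hold.unvisited_succ, Finset.card_range]
          exact hW
    · have hn := fst_playPos_of_not_complete hcomp
      refine ihc (i + 1) (by rw [hn]; exact hcard) ?_
      rw [hn]
      exact hF

/-- A winning position at the start yields a finite synthesis by the best answers. -/
theorem admitsFiniteSynthesis_of_win (h : ∃ k, (arena φ spo).Win k 0 (label [])) :
    AdmitsFiniteSynthesis φ spo.toFinset := by
  refine ⟨bestStrategy φ spo, fun _ _ => bestAnswer_subset _ _ _, ?_⟩
  rintro ρs ⟨ρ₀, hρ₀, hρs⟩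
  set ρ := response (bestStrategy φ spo) ρs with hρ
  have hodd : ∀ i, ρ (2 * i + 1) = ((ρs i).1, bestAnswer φ spo (playPos (rounds φ spo ρ) i)
      (ρ (2 * i)).1.fst (ρ (2 * i)).2) := fun i => by
    rw [hρ, response_odd, ← hρ, bestStrategy_ofFn]
  have hadm : IsAdmissibleRun φ spo.toFinset ⊤ ρ := by
    refine isAdmissibleRun_congr hρ₀ (fun i => ?_) (fun i => ?_) (fun i => ?_)
    · rcases Nat.even_or_odd' i with ⟨c, rfl | rfl⟩
      · rw [hρ, response_even, hρs]
      · rw [hodd, hρs]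
        exact ((hρ₀.round (2 * c) (even_two_mul c) (WithTop.coe_lt_top _)).1).symm
    · rw [hρ, response_even, hρs]
    · rw [hodd]; exact bestAnswer_subset _ _ _
  have hplay := isPlay_of_isAdmissibleRun hadm
  obtain ⟨m, hm, t, ht, hs⟩ : ∃ m, 0 < m ∧ ∃ t, 2 * t = m * (m + 1) ∧
      (arena φ spo).Success m (label (playPos (rounds φ spo ρ) t).2) := by
    obtain ⟨k, hk⟩ := h
    rcases k with _ | k
    · exact absurd hk.1 (lt_irrefl 0)
    · rcases hk with hk | hk
      · exact absurd hk.1 (lt_irrefl 0)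
      · refine exists_success_of_force hplay (fun i => by rw [hodd]) k 0 ?_
        show (arena φ spo).Force 0 _ (unvisited 0 []).card (unvisited 0 []) (label [])
        rw [unvisited_zero_nil]
        exact hk
  exact ⟨m, hm, hplay.isAdmissibleRun (Or.inl ⟨m, hm, rfl⟩), (hplay.isSuccessful_iff hm ht).2 hs⟩

end Duplicator

/-! ### The spoiler's play against a strategy -/

section Spoiler

variable {φ : Formula} {spo : List Formula}

/-- The pair `q` as an interval; the minimum only matters for pairs that are not intervals. -/
def intervalOf (q : ℕ × ℕ) : NonemptyInterval ℕ := ⟨(min q.1 q.2, q.2), min_le_right _ _⟩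

/-- The moves of the rounds of a history. -/
def movesOf (spo : List Formula) : History (List Formula) → List Move
  | [] => []
  | (q, l) :: H => movesOf spo H ++ [(intervalOf q, l.toFinset ∩ spo.toFinset),
      (intervalOf q, l.toFinset \ spo.toFinset)]

/-- If the duplicator has no certificate, then against any response strategy the spoiler can stay
in positions that are not derivable, and so prevent success for ever. -/
theorem derivable_of_admitsFiniteSynthesis (h : AdmitsFiniteSynthesis φ spo.toFinset) :
    Derivable (arena φ spo).WinRule (0, []) := by
  by_contra hN
  obtain ⟨S, hS, hwin⟩ := h
  -- `S` is only known to answer legally after prefixes of admissible runs, and that the play built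
  -- here is one follows from the legality of the answers; the intersection breaks the circle
  let answer : Position (List Formula) → ℕ → Finset Formula → Finset Formula := fun p x s =>
    S (movesOf spo p.2 ++ [(intervalOf (x, p.1), s)]) ∩ (φ.alphabet \ spo.toFinset)
  obtain ⟨e, he, hI⟩ := exists_legalPlay
    (fun p => ¬ Derivable (arena φ spo).WinRule p)
    (fun p e => ∃ s : Finset Formula, s ⊆ spo.toFinset ∧
      e.2 = roundLabel φ spo s (answer p e.1 s)) hN (by
    intro p hp hp'
    obtain ⟨-, x, hx, s, hs, hl⟩ := Arena.exists_move_of_not_derivable hp hp'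
    have hs' : s.Sublist spo.dedup := mem_sublistsOf.1 hs
    have heq : spo.dedup.filter (fun f => f ∈ s.toFinset) = s := by
      simp only [List.mem_toFinset]
      exact filter_mem_of_sublist (List.nodup_dedup _) hs'
    have hmenu := (roundLabel_mem_menu φ spo s.toFinset (answer p x s.toFinset)).2
    rw [heq] at hmenu
    exact ⟨(x, _), hx, ⟨s.toFinset, fun f hf => List.mem_toFinset.2
      (List.mem_dedup.1 (hs'.subset (List.mem_toFinset.1 hf))), rfl⟩,
      not_derivable_advance Arena.derivable_winRule_of_complete (hl _ hmenu)⟩)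
  choose hI s hs hl using hI
  let d : ℕ → Finset Formula := fun i => answer (playPos e i) (e i).1 (s i)
  have hd : ∀ i, d i ⊆ φ.alphabet \ spo.toFinset := fun i => Finset.inter_subset_right
  let I : ℕ → NonemptyInterval ℕ := fun i => intervalOf ((e i).1, (playPos e i).1)
  let ρ : ℕ → Move := fun j => (I (j / 2), if j % 2 = 0 then s (j / 2) else d (j / 2))
  have hρe : ∀ i, ρ (2 * i) = (I i, s i) := fun i => by simp [ρ]
  have hρo : ∀ i, ρ (2 * i + 1) = (I i, d i) := fun i => by
    simp [ρ, show (2 * i + 1) / 2 = i by omega, show (2 * i + 1) % 2 = 1 by omega]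
  have hr : rounds φ spo ρ = e := by
    funext i
    have h1 : (e i).1 ≤ (playPos e i).1 := Nat.lt_succ_iff.1 (he i).1
    refine Prod.ext ?_ ?_
    · show (ρ (2 * i)).1.fst = _
      rw [hρe]; exact min_eq_left h1
    · show roundLabel φ spo (ρ (2 * i)).2 (ρ (2 * i + 1)).2 = _
      rw [hρe, hρo]; exact (hl i).symm
  have hplay : IsPlay φ spo ρ :=
    ⟨by rwa [hr], fun i => by rw [hr, hρe]; rfl, fun i => by rw [hρe, hρo],
      fun i => by rw [hρe]; exact hs i, fun i => by rw [hρo]; exact hd i⟩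
  have hadm := hplay.isAdmissibleRun (Or.inr rfl)
  have hmoves : ∀ i, List.ofFn (fun j : Fin (2 * i) => ρ j) = movesOf spo (playPos e i).2 := by
    intro i
    induction i with
    | zero => rfl
    | succ i ih =>
      have hmem : ∀ f, f ∈ (e i).2 ↔ f ∈ s i ∨ f ∈ d i := fun f => by
        rw [hl]; exact mem_roundLabel (hs i) (hd i)
      have hse : (e i).2.toFinset ∩ spo.toFinset = s i := by
        ext f
        have := @hs i f
        have := @hd i f
        simp only [Finset.mem_inter, List.mem_toFinset, hmem, Finset.mem_sdiff] at *
        tauto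
      have hde : (e i).2.toFinset \ spo.toFinset = d i := by
        ext f
        have := @hs i f
        have := @hd i f
        simp only [List.mem_toFinset, hmem, Finset.mem_sdiff] at *
        tauto
      show _ = movesOf spo (_ :: _)
      rw [movesOf, ← ih, hse, hde, show 2 * (i + 1) = 2 * i + 1 + 1 by ring, List.ofFn_succ',
        List.ofFn_succ']
      simp [hρe, hρo, I]
  have hodd : ∀ i, ρ (2 * i + 1) =
      (I i, S (List.ofFn fun j : Fin (2 * i + 1) => ρ j)) := by
    intro i
    have hlist : List.ofFn (fun j : Fin (2 * i + 1) => ρ j) =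
        movesOf spo (playPos e i).2 ++ [(I i, s i)] := by
      rw [List.ofFn_succ', ← hmoves]
      simp [hρe]
    have hpre : List.ofFn (fun j : Fin (2 * i + 1) => ρ j) ∈ oddPrefixes φ spo.toFinset :=
      ⟨⊤, ρ, hadm, 2 * i + 1, odd_two_mul_add_one i, le_top, rfl⟩
    rw [hρo]
    refine congrArg _ ?_
    have := hS _ hpre
    rw [hlist] at this ⊢
    exact Finset.inter_eq_left.2 this
  have hresp : response S (fun i => ρ (2 * i)) = ρ := by
    funext n
    induction n using Nat.strong_induction_on with
    | _ n ih =>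
      rcases Nat.even_or_odd' n with ⟨c, rfl | rfl⟩
      · rw [response_even]
      · rw [response_odd, hodd, hρe]
        have : (fun j : Fin (2 * c + 1) => response S (fun i => ρ (2 * i)) j) =
            fun j : Fin (2 * c + 1) => ρ j := funext fun j => ih j j.2
        rw [this]
  obtain ⟨m, hm, -, hsucc⟩ := hwin _ ⟨ρ, hadm, fun i => rfl⟩
  rw [hresp] at hsucc
  obtain ⟨t, ht⟩ := exists_triangle m
  have h1 := (hplay.isSuccessful_iff hm ht).1 hsucc
  rw [hr, ← (he.boundary ht).1] at h1
  exact hI t (Derivable.intro Arena.WinRule.mono (Or.inl (by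
    rw [(he.boundary ht).1] at h1 ⊢; exact h1)))

end Spoiler

theorem admitsFiniteSynthesis_iff (φ : Formula) (spo : List Formula) :
    AdmitsFiniteSynthesis φ spo.toFinset ↔ Derivable (arena φ spo).WinRule (0, []) :=
  ⟨derivable_of_admitsFiniteSynthesis, fun h =>
    admitsFiniteSynthesis_of_win (Arena.exists_win_of_derivable h)⟩

theorem not_admitsFiniteSynthesis_iff (φ : Formula) (spo : List Formula) :
    ¬ AdmitsFiniteSynthesis φ spo.toFinset ↔ Derivable (arena φ spo).LoseRule (0, []) := by
  rw [admitsFiniteSynthesis_iff, Arena.derivable_loseRule_iff_not (exists_mem_opts φ spo)]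

/-! ### Primitive recursion -/

/- With these attributes `fun_prop` proves primitive recursiveness by composing the closure
properties below. Bounded quantifiers are not in the scope of `fun_prop`, so the lemmas on them
are applied explicitly. -/
attribute [fun_prop] Primrec PrimrecPred

section Primrec

variable {α β γ : Type} [Primcodable α] [Primcodable β] [Primcodable γ]

@[fun_prop] theorem primrec_id : Primrec fun a : α => a := Primrec.id

@[fun_prop] theorem primrec_const (b : β) : Primrec fun _ : α => b := Primrec.const b

@[fun_prop] theorem primrec_comp {f : β → γ} {g : α → β} (hf : Primrec f) (hg : Primrec g) :
    Primrec fun a => f (g a) := hf.comp hg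

attribute [fun_prop] Primrec.fst Primrec.snd Primrec.pair

@[fun_prop] theorem primrec_add {f g : α → ℕ} (hf : Primrec f) (hg : Primrec g) :
    Primrec fun a => f a + g a := Primrec.nat_add.comp hf hg

@[fun_prop] theorem primrec_sub {f g : α → ℕ} (hf : Primrec f) (hg : Primrec g) :
    Primrec fun a => f a - g a := Primrec.nat_sub.comp hf hg

@[fun_prop] theorem primrec_mul {f g : α → ℕ} (hf : Primrec f) (hg : Primrec g) :
    Primrec fun a => f a * g a := Primrec.nat_mul.comp hf hg

@[fun_prop] theorem primrec_div {f g : α → ℕ} (hf : Primrec f) (hg : Primrec g) :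
    Primrec fun a => f a / g a := Primrec.nat_div.comp hf hg

@[fun_prop] theorem primrec_mod {f g : α → ℕ} (hf : Primrec f) (hg : Primrec g) :
    Primrec fun a => f a % g a := Primrec.nat_mod.comp hf hg

@[fun_prop] theorem primrec_min {f g : α → ℕ} (hf : Primrec f) (hg : Primrec g) :
    Primrec fun a => min (f a) (g a) := Primrec.nat_min.comp hf hg

@[fun_prop] theorem primrec_max {f g : α → ℕ} (hf : Primrec f) (hg : Primrec g) :
    Primrec fun a => max (f a) (g a) := Primrec.nat_max.comp hf hg

@[fun_prop] theorem primrec_natPair {f g : α → ℕ} (hf : Primrec f) (hg : Primrec g) :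
    Primrec fun a => Nat.pair (f a) (g a) := Primrec₂.natPair.comp hf hg

@[fun_prop] theorem primrec_unpair {f : α → ℕ} (hf : Primrec f) :
    Primrec fun a => Nat.unpair (f a) := Primrec.unpair.comp hf

@[fun_prop] theorem primrec_not {f : α → Bool} (hf : Primrec f) : Primrec fun a => !f a :=
  Primrec.not.comp hf

@[fun_prop] theorem primrec_or {f g : α → Bool} (hf : Primrec f) (hg : Primrec g) :
    Primrec fun a => f a || g a := Primrec.or.comp hf hg

@[fun_prop] theorem primrec_cons {f : α → β} {g : α → List β} (hf : Primrec f) (hg : Primrec g) :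
    Primrec fun a => f a :: g a := Primrec.list_cons.comp hf hg

@[fun_prop] theorem primrec_append {f g : α → List β} (hf : Primrec f) (hg : Primrec g) :
    Primrec fun a => f a ++ g a := Primrec.list_append.comp hf hg

@[fun_prop] theorem primrec_range {f : α → ℕ} (hf : Primrec f) :
    Primrec fun a => List.range (f a) := Primrec.list_range.comp hf

@[fun_prop] theorem primrec_length {f : α → List β} (hf : Primrec f) :
    Primrec fun a => (f a).length := Primrec.list_length.comp hf

@[fun_prop] theorem primrec_getD {f : α → List β} {g : α → ℕ} (hf : Primrec f) (hg : Primrec g)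
    (d : β) : Primrec fun a => (f a).getD (g a) d := (Primrec.list_getD d).comp hf hg

@[fun_prop] theorem primrec_map {f : α → List β} {g : α → β → γ} (hf : Primrec f)
    (hg : Primrec fun p : α × β => g p.1 p.2) : Primrec fun a => (f a).map (g a) :=
  Primrec.list_map hf hg

@[fun_prop] theorem primrec_flatMap {f : α → List β} {g : α → β → List γ} (hf : Primrec f)
    (hg : Primrec fun p : α × β => g p.1 p.2) : Primrec fun a => (f a).flatMap (g a) :=
  Primrec.list_flatMap hf hg

@[fun_prop] theorem primrec_foldr {f : α → List β} {g : α → β → γ → γ} {d : α → γ}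
    (hf : Primrec f) (hg : Primrec fun p : α × β × γ => g p.1 p.2.1 p.2.2) (hd : Primrec d) :
    Primrec fun a => (f a).foldr (g a) (d a) :=
  Primrec.list_foldr (h := fun a p => g a p.1 p.2) hf hd hg

@[fun_prop] theorem primrec_ite {c : α → Prop} [DecidablePred c] {f g : α → β}
    (hc : PrimrecPred c) (hf : Primrec f) (hg : Primrec g) :
    Primrec fun a => if c a then f a else g a := Primrec.ite hc hf hg

@[fun_prop] theorem primrec_decide {p : α → Prop} [DecidablePred p] (hp : PrimrecPred p) :
    Primrec fun a => decide (p a) := by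
  obtain ⟨_, h⟩ := hp
  convert h

@[fun_prop] theorem primrecPred_bool {f : α → Bool} (hf : Primrec f) :
    PrimrecPred fun a => f a = true :=
  PrimrecPred.of_eq (Primrec.eq.comp hf (Primrec.const true)) fun _ => Iff.rfl

@[fun_prop] theorem primrecPred_eq {f g : α → β} (hf : Primrec f) (hg : Primrec g) :
    PrimrecPred fun a => f a = g a := Primrec.eq.comp hf hg

@[fun_prop] theorem primrecPred_lt {f g : α → ℕ} (hf : Primrec f) (hg : Primrec g) :
    PrimrecPred fun a => f a < g a := Primrec.nat_lt.comp hf hg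

@[fun_prop] theorem primrecPred_not {p : α → Prop} (hp : PrimrecPred p) :
    PrimrecPred fun a => ¬ p a := hp.not

@[fun_prop] theorem primrecPred_and {p q : α → Prop} (hp : PrimrecPred p) (hq : PrimrecPred q) :
    PrimrecPred fun a => p a ∧ q a := hp.and hq

@[fun_prop] theorem primrecPred_or {p q : α → Prop} (hp : PrimrecPred p) (hq : PrimrecPred q) :
    PrimrecPred fun a => p a ∨ q a := hp.or hq

@[fun_prop] theorem primrecPred_iff {p q : α → Prop} (hp : PrimrecPred p) (hq : PrimrecPred q) :
    PrimrecPred fun a => p a ↔ q a :=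
  ((hp.and hq).or (hp.not.and hq.not)).of_eq fun _ => by tauto

theorem primrecPred_imp {p q : α → Prop} (hp : PrimrecPred p) (hq : PrimrecPred q) :
    PrimrecPred fun a => p a → q a :=
  (hp.not.or hq).of_eq fun _ => by tauto

theorem primrecPred_exists_mem {f : α → List β} {p : α → β → Prop} (hf : Primrec f)
    (hp : PrimrecPred fun q : α × β => p q.1 q.2) : PrimrecPred fun a => ∃ b ∈ f a, p a b :=
  (PrimrecRel.exists_mem_list (R := fun b a => p a b)
    (hp.comp (Primrec.snd.pair Primrec.fst))).comp hf Primrec.id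

theorem primrecPred_forall_mem {f : α → List β} {p : α → β → Prop} (hf : Primrec f)
    (hp : PrimrecPred fun q : α × β => p q.1 q.2) : PrimrecPred fun a => ∀ b ∈ f a, p a b :=
  (PrimrecRel.forall_mem_list (R := fun b a => p a b)
    (hp.comp (Primrec.snd.pair Primrec.fst))).comp hf Primrec.id

theorem primrecPred_exists_lt {f : α → ℕ} {p : α → ℕ → Prop} (hf : Primrec f)
    (hp : PrimrecPred fun q : α × ℕ => p q.1 q.2) : PrimrecPred fun a => ∃ b < f a, p a b :=
  (primrecPred_exists_mem (primrec_range hf) hp).of_eq fun _ => by simp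

theorem primrecPred_forall_lt {f : α → ℕ} {p : α → ℕ → Prop} (hf : Primrec f)
    (hp : PrimrecPred fun q : α × ℕ => p q.1 q.2) : PrimrecPred fun a => ∀ b < f a, p a b :=
  (primrecPred_forall_mem (primrec_range hf) hp).of_eq fun _ => by simp

@[fun_prop] theorem primrecPred_mem {f : α → β} {g : α → List β} (hf : Primrec f)
    (hg : Primrec g) : PrimrecPred fun a => f a ∈ g a :=
  (primrecPred_exists_mem (p := fun a b => b = f a) hg (by fun_prop)).of_eq fun _ => by simp

@[fun_prop] theorem primrec_filter {f : α → List β} {p : α → β → Bool} (hf : Primrec f)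
    (hp : Primrec fun q : α × β => p q.1 q.2) : Primrec fun a => (f a).filter (p a) := by
  have : Primrec fun a => (f a).foldr (fun b l => if p a b = true then b :: l else l) [] := by
    refine primrec_foldr hf ?_ (by fun_prop)
    exact primrec_ite (by
      have := hp.comp (Primrec.fst.pair (Primrec.fst.comp (Primrec.snd (α := α) (β := β × List β))))
      exact primrecPred_bool this) (by fun_prop) (by fun_prop)
  refine this.of_eq fun a => ?_
  induction f a with
  | nil => rfl
  | cons b l ih => rw [List.foldr_cons, ih, List.filter_cons]

@[fun_prop] theorem primrec_dedup [DecidableEq β] {f : α → List β} (hf : Primrec f) :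
    Primrec fun a => (f a).dedup := by
  have : Primrec fun a => (f a).foldr (fun b l => if b ∈ l then l else b :: l) [] := by
    fun_prop
  refine this.of_eq fun a => ?_
  induction f a with
  | nil => rfl
  | cons b l ih =>
    rw [List.foldr_cons, ih]
    split_ifs with h
    · rw [List.dedup_cons_of_mem (List.mem_dedup.1 h)]
    · rw [List.dedup_cons_of_notMem (fun h' => h (List.mem_dedup.2 h'))]

@[fun_prop] theorem primrec_sublistsOf {f : α → List β} (hf : Primrec f) :
    Primrec fun a => sublistsOf (f a) := by
  unfold sublistsOf
  fun_prop

/-- Projections of primitive recursive relations are recursively enumerable. -/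
theorem rePred_exists {P : α → β → Prop} (h : PrimrecPred fun p : α × β => P p.1 p.2) :
    REPred fun a => ∃ b, P a b := by
  classical
  have hQ : PrimrecPred fun q : α × ℕ =>
      ∃ b ∈ (Encodable.decode (α := β) q.2).toList, P q.1 b :=
    primrecPred_exists_mem (Primrec.optionToList.comp (Primrec.decode.comp Primrec.snd))
      (h.comp ((Primrec.fst.comp Primrec.fst).pair Primrec.snd))
  have hp : Partrec fun a => Nat.rfind fun n =>
      Part.some (decide (∃ b ∈ (Encodable.decode (α := β) n).toList, P a b)) :=
    Partrec.rfind (primrec_decide hQ).to_comp.partrec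
  refine hp.dom_re.of_eq fun a => ?_
  refine Nat.rfind_dom.trans ?_
  constructor
  · rintro ⟨n, hn, -⟩
    obtain ⟨b, -, hb⟩ : ∃ b ∈ (Encodable.decode (α := β) n).toList, P a b := by
      exact of_decide_eq_true (Part.mem_some_iff.1 hn).symm
    exact ⟨b, hb⟩
  · rintro ⟨b, hb⟩
    refine ⟨Encodable.encode b, ?_, fun {m} _ => trivial⟩
    have : ∃ b' ∈ (Encodable.decode (α := β) (Encodable.encode b)).toList, P a b' :=
      ⟨b, by simp, hb⟩
    simp only [Part.mem_some_iff]
    exact (decide_eq_true this).symm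

end Primrec

/-! ### Primitive recursion on formulas -/

section PrimrecFormula

variable {α : Type} [Primcodable α]

theorem denumerable_ofNat (n : ℕ) : Denumerable.ofNat Formula n = Formula.ofNat n :=
  Denumerable.ofNat_of_decode rfl

@[fun_prop] theorem primrec_toNat {f : α → Formula} (hf : Primrec f) :
    Primrec fun a => (f a).toNat := Primrec.encode.comp hf

@[fun_prop] theorem primrec_ofNat {f : α → ℕ} (hf : Primrec f) :
    Primrec fun a => Formula.ofNat (f a) :=
  ((Primrec.ofNat Formula).comp hf).of_eq fun _ => denumerable_ofNat _

theorem primrec_of_toNat {f : α → Formula} (h : Primrec fun a => (f a).toNat) : Primrec f :=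
  Primrec.encode_iff.1 h

@[fun_prop] theorem primrec_neg {f : α → Formula} (hf : Primrec f) :
    Primrec fun a => neg (f a) :=
  primrec_of_toNat (by simp only [Formula.toNat]; fun_prop)

@[fun_prop] theorem primrec_formula_or {f g : α → Formula} (hf : Primrec f) (hg : Primrec g) :
    Primrec fun a => Formula.or (f a) (g a) :=
  primrec_of_toNat (by simp only [Formula.toNat]; fun_prop)

@[fun_prop] theorem primrec_dia (R : Modality) {f : α → Formula} (hf : Primrec f) :
    Primrec fun a => dia R (f a) :=
  primrec_of_toNat (by cases R <;> simp only [Formula.toNat] <;> fun_prop)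

/-- The outermost symbol of a formula is read off from its number modulo `6`. -/
theorem mod_toNat (f : Formula) : f.toNat % 6 = match f with
    | atom _ => 0
    | neg _ => 1
    | Formula.or _ _ => 2
    | dia Modality.A _ => 3
    | dia Modality.B _ => 4
    | dia Modality.Bbar _ => 5 := by
  rcases f with _ | _ | _ | ⟨_ | _ | _, _⟩ <;> simp only [Formula.toNat] <;> omega

/-- The immediate subformulas are read off from the quotient by `6`. -/
theorem div_toNat (f : Formula) : f.toNat / 6 = match f with
    | atom p => p
    | neg f => f.toNat
    | Formula.or f g => Nat.pair f.toNat g.toNat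
    | dia _ f => f.toNat := by
  rcases f with _ | _ | _ | ⟨_ | _ | _, _⟩ <;> simp only [Formula.toNat] <;> omega

@[fun_prop] theorem primrec_isAtom {f : α → Formula} (hf : Primrec f) :
    Primrec fun a => (f a).isAtom := by
  have : Primrec fun a => decide ((f a).toNat % 6 = 0) := by fun_prop
  refine this.of_eq fun a => ?_
  rw [mod_toNat]
  rcases f a with _ | _ | _ | ⟨_ | _ | _, _⟩ <;> rfl

@[fun_prop] theorem primrec_negate {f : α → Formula} (hf : Primrec f) :
    Primrec fun a => negate (f a) := by
  have : Primrec fun a => if (f a).toNat % 6 = 1 then Formula.ofNat ((f a).toNat / 6)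
      else neg (f a) := by fun_prop
  refine this.of_eq fun a => ?_
  rw [mod_toNat, div_toNat]
  rcases f a with _ | _ | _ | ⟨_ | _ | _, _⟩ <;> simp [negate, ofNat_toNat]

/-- Recursion on formulas is course-of-values recursion on their numbers. The list `l` holds the
values of `F a` at the formulas with smaller numbers. -/
theorem primrec_formula_rec {σ : Type} [Primcodable σ] [Inhabited σ] (F : α → Formula → σ)
    (g : α → Formula → List σ → σ) (hg : Primrec fun p : α × Formula × List σ => g p.1 p.2.1 p.2.2)
    (hF : ∀ a f l, (∀ h : Formula, h.toNat < f.toNat → l.getD h.toNat default = F a h) →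
      F a f = g a f l) : Primrec fun p : α × Formula => F p.1 p.2 := by
  have hg' : Primrec₂ fun (a : α) (l : List σ) => some (g a (Formula.ofNat l.length) l) := by
    refine Primrec.option_some.comp ?_
    exact hg.comp (g := fun p : α × List σ => (p.1, Formula.ofNat p.2.length, p.2)) (by fun_prop)
  have := Primrec.nat_strong_rec (fun a n => F a (Formula.ofNat n)) hg' fun a n => by
    rw [List.length_map, List.length_range]
    refine congrArg some (hF a _ _ fun h hh => ?_).symm
    rw [toNat_ofNat] at hh
    simp [List.getD, hh, ofNat_toNat]
  refine (this.comp Primrec.fst ((primrec_toNat primrec_id).comp Primrec.snd)).of_eq fun p => ?_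
  rw [ofNat_toNat]

theorem toNat_lt_neg (f : Formula) : f.toNat < (neg f).toNat := by simp only [Formula.toNat]; omega

theorem toNat_lt_dia (R : Modality) (f : Formula) : f.toNat < (dia R f).toNat := by
  cases R <;> simp only [Formula.toNat] <;> omega

theorem toNat_lt_or_left (f g : Formula) : f.toNat < (Formula.or f g).toNat := by
  have := Nat.left_le_pair f.toNat g.toNat
  simp only [Formula.toNat]; omega

theorem toNat_lt_or_right (f g : Formula) : g.toNat < (Formula.or f g).toNat := by
  have := Nat.right_le_pair f.toNat g.toNat
  simp only [Formula.toNat]; omega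

instance : Inhabited Formula := ⟨atom sim⟩

@[fun_prop] theorem primrec_ev {l : α → List Formula} {f : α → Formula} (hl : Primrec l)
    (hf : Primrec f) : Primrec fun a => ev (l a) (f a) := by
  have := primrec_formula_rec ev
    (fun l f t => if f.toNat % 6 = 1 then !t.getD (f.toNat / 6) false
      else if f.toNat % 6 = 2 then t.getD (f.toNat / 6).unpair.1 false ||
        t.getD (f.toNat / 6).unpair.2 false
      else decide (f ∈ l)) (by fun_prop) (by
      intro l f t ht
      rw [Bool.default_bool] at ht
      rw [mod_toNat, div_toNat]
      rcases f with p | f | ⟨f, g⟩ | ⟨_ | _ | _, f⟩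
      · rfl
      · simp [-List.getD_eq_getElem?_getD, ev, ht f (toNat_lt_neg f)]
      · simp [-List.getD_eq_getElem?_getD, ev, ht f (toNat_lt_or_left f g), ht g (toNat_lt_or_right f g)]
      all_goals rfl)
  exact this.comp (hl.pair hf)

@[fun_prop] theorem primrec_reduce {f : α → Formula} (hf : Primrec f) :
    Primrec fun a => (f a).reduce := by
  have := primrec_formula_rec (fun (_ : Unit) f => f.reduce)
    (fun _ f t => if f.toNat % 6 = 1 then negate (t.getD (f.toNat / 6) default)
      else if f.toNat % 6 = 2 then Formula.or (t.getD (f.toNat / 6).unpair.1 default)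
        (t.getD (f.toNat / 6).unpair.2 default)
      else if f.toNat % 6 = 3 then dia Modality.A (t.getD (f.toNat / 6) default)
      else if f.toNat % 6 = 4 then dia Modality.B (t.getD (f.toNat / 6) default)
      else if f.toNat % 6 = 5 then dia Modality.Bbar (t.getD (f.toNat / 6) default)
      else f) (by fun_prop) (by
      intro _ f t ht
      rw [mod_toNat, div_toNat]
      rcases f with p | f | ⟨f, g⟩ | ⟨_ | _ | _, f⟩
      · rfl
      · simp [-List.getD_eq_getElem?_getD, reduce, ht f (toNat_lt_neg f)]
      · simp [-List.getD_eq_getElem?_getD, reduce, ht f (toNat_lt_or_left f g), ht g (toNat_lt_or_right f g)]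
      all_goals simp [-List.getD_eq_getElem?_getD, reduce, ht f (toNat_lt_dia _ f)])
  exact this.comp ((Primrec.const ()).pair hf)

@[fun_prop] theorem primrec_subList {f : α → Formula} (hf : Primrec f) :
    Primrec fun a => subList (f a) := by
  have := primrec_formula_rec (fun (_ : Unit) f => subList f)
    (fun _ f t => if f.toNat % 6 = 0 then [f]
      else if f.toNat % 6 = 2 then f :: (t.getD (f.toNat / 6).unpair.1 default ++
        t.getD (f.toNat / 6).unpair.2 default)
      else f :: t.getD (f.toNat / 6) default) (by fun_prop) (by
      intro _ f t ht
      rw [mod_toNat, div_toNat]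
      rcases f with p | f | ⟨f, g⟩ | ⟨_ | _ | _, f⟩
      · rfl
      · simp [-List.getD_eq_getElem?_getD, subList, ht f (toNat_lt_neg f)]
      · simp [-List.getD_eq_getElem?_getD, subList, ht f (toNat_lt_or_left f g), ht g (toNat_lt_or_right f g)]
      all_goals simp [-List.getD_eq_getElem?_getD, subList, ht f (toNat_lt_dia _ f)])
  exact this.comp ((Primrec.const ()).pair hf)

@[fun_prop] theorem primrec_closureList {f : α → Formula} (hf : Primrec f) :
    Primrec fun a => closureList (f a) := by
  unfold closureList
  fun_prop

@[fun_prop] theorem primrec_alphabetList {f : α → Formula} (hf : Primrec f) :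
    Primrec fun a => alphabetList (f a) := by
  unfold alphabetList
  fun_prop

@[fun_prop] theorem primrec_dupList {f : α → Formula} {g : α → List Formula} (hf : Primrec f)
    (hg : Primrec g) : Primrec fun a => dupList (f a) (g a) := by
  unfold dupList
  fun_prop

end PrimrecFormula

/-! ### The rules of the game are primitive recursive -/

section PrimrecGame

variable {α : Type} [Primcodable α]

@[fun_prop] theorem primrec_label {Λ : Type} [Primcodable Λ] [Inhabited Λ] {H : α → History Λ}
    {p : α → ℕ × ℕ} (hH : Primrec H) (hp : Primrec p) :
    Primrec fun a => label (H a) (p a) := by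
  have : Primrec fun a =>
      (H a).foldr (fun (e : (ℕ × ℕ) × Λ) acc => if e.1 = p a then e.2 else acc) default := by
    refine primrec_foldr hH ?_ (Primrec.const _)
    exact primrec_ite (by fun_prop) (by fun_prop) (by fun_prop)
  refine this.of_eq fun a => ?_
  induction H a with
  | nil => rfl
  | cons e H ih =>
    obtain ⟨q, l⟩ := e
    rw [List.foldr_cons, ih, label_cons, Function.update_apply]
    simp only [eq_comm]

@[fun_prop] theorem primrecPred_visited {Λ : Type} [Primcodable Λ] {H : α → History Λ}
    {p : α → ℕ × ℕ} (hH : Primrec H) (hp : Primrec p) :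
    PrimrecPred fun a => Visited (H a) (p a) := by
  unfold Visited
  fun_prop

@[fun_prop] theorem primrecPred_complete {Λ : Type} [Primcodable Λ] {n : α → ℕ}
    {H : α → History Λ} (hn : Primrec n) (hH : Primrec H) :
    PrimrecPred fun a => Complete (n a) (H a) :=
  primrecPred_forall_lt (by fun_prop) (by fun_prop)

@[fun_prop] theorem primrec_tuples {n m : α → ℕ} (hn : Primrec n) (hm : Primrec m) :
    Primrec fun a => tuples (n a) (m a) := by
  have : Primrec fun a => (m a).rec (motive := fun _ => List (List ℕ)) [[]] fun _ t =>
      t.flatMap fun l => (List.range (n a)).map fun b => b :: l :=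
    Primrec.nat_rec' (h := fun a (p : ℕ × List (List ℕ)) =>
      p.2.flatMap fun l => (List.range (n a)).map fun b => b :: l) hm (Primrec.const _)
      (show Primrec fun q : α × ℕ × List (List ℕ) =>
        q.2.2.flatMap fun l => (List.range (n q.1)).map fun b => b :: l by fun_prop)
  refine this.of_eq fun a => ?_
  induction m a with
  | zero => rfl
  | succ k ih => rw [tuples, ← ih]

variable {φ : α → Formula} {spo : α → List Formula} {l l' : α → List Formula}

theorem primrec_opts (hs : Primrec spo) : Primrec fun a => (arena (φ a) (spo a)).opts := by
  simp only [arena]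
  fun_prop

theorem primrec_menu (hφ : Primrec φ) (hs : Primrec spo) (hl : Primrec l) :
    Primrec fun a => (arena (φ a) (spo a)).menu (l a) := by
  simp only [arena]
  fun_prop

theorem primrecPred_start (hφ : Primrec φ) (hl : Primrec l) :
    PrimrecPred fun a => (arena (φ a) (spo a)).start (l a) := by
  simp only [arena]
  fun_prop

theorem primrecPred_init (hφ : Primrec φ) (hl : Primrec l) :
    PrimrecPred fun a => (arena (φ a) (spo a)).init (l a) :=
  primrecPred_forall_mem (by fun_prop) (by fun_prop)

theorem primrecPred_final (hφ : Primrec φ) (hl : Primrec l) :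
    PrimrecPred fun a => (arena (φ a) (spo a)).final (l a) :=
  primrecPred_forall_mem (by fun_prop) (by fun_prop)

theorem primrecPred_sm (hφ : Primrec φ) (hl : Primrec l) :
    PrimrecPred fun a => (arena (φ a) (spo a)).sm (l a) := by
  simp only [arena]
  fun_prop

theorem primrecPred_step (hφ : Primrec φ) (hl : Primrec l) (hl' : Primrec l') :
    PrimrecPred fun a => (arena (φ a) (spo a)).step (l a) (l' a) :=
  primrecPred_forall_mem (by fun_prop) (by fun_prop)

theorem primrecPred_col (hφ : Primrec φ) (hl : Primrec l) (hl' : Primrec l') :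
    PrimrecPred fun a => (arena (φ a) (spo a)).col (l a) (l' a) :=
  primrecPred_forall_mem (by fun_prop) (by fun_prop)

variable {H : α → History (List Formula)} {n m x y : α → ℕ} {p : α → Position (List Formula)}
  {W : α → List (Position (List Formula))}

theorem primrecPred_rel (hφ : Primrec φ) (hH : Primrec H) (hx : Primrec x) (hy : Primrec y) :
    PrimrecPred fun a => (arena (φ a) (spo a)).Rel (label (H a)) (x a) (y a) :=
  primrecPred_sm hφ (by fun_prop)

theorem primrecPred_valid (hφ : Primrec φ) (hn : Primrec n) (hH : Primrec H) :
    PrimrecPred fun a => (arena (φ a) (spo a)).Valid (n a) (label (H a)) := by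
  -- the pairs `x ≤ y` are enumerated by bounded quantifiers, the column first
  have : PrimrecPred fun a =>
      (0 < n a → (arena (φ a) (spo a)).start (label (H a) (0, 0))) ∧
      (∀ x < n a, (arena (φ a) (spo a)).init (label (H a) (x, x))) ∧
      (∀ y < n a - 1, ∀ x < y + 1,
        (arena (φ a) (spo a)).step (label (H a) (x, y)) (label (H a) (x, y + 1))) ∧
      (∀ y < n a, ∀ x < y + 1,
        (arena (φ a) (spo a)).col (label (H a) (x, y)) (label (H a) (y, y))) ∧
      (∀ x < n a, (arena (φ a) (spo a)).Rel (label (H a)) x x) ∧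
      ∀ x < n a, ∀ y < n a, ∀ z < n a, (arena (φ a) (spo a)).Rel (label (H a)) x y →
        (arena (φ a) (spo a)).Rel (label (H a)) y z →
        (arena (φ a) (spo a)).Rel (label (H a)) x z := by
    repeat' first
      | with_reducible refine primrecPred_and ?_ ?_
      | with_reducible refine primrecPred_forall_lt ?_ ?_
      | with_reducible refine primrecPred_imp ?_ ?_
      | with_reducible refine primrecPred_start ?_ ?_
      | with_reducible refine primrecPred_init ?_ ?_
      | with_reducible refine primrecPred_step ?_ ?_ ?_
      | with_reducible refine primrecPred_col ?_ ?_ ?_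
      | with_reducible refine primrecPred_rel ?_ ?_ ?_ ?_
      | fun_prop
  refine this.of_eq fun a => ⟨fun h => ⟨h.1, h.2.1, fun x y hxy hy => ?_, fun x y hxy hy => ?_,
    h.2.2.2.2.1, h.2.2.2.2.2⟩, fun h => ⟨h.1, h.2, fun y hy x hx => ?_, fun y hy x hx => ?_,
    h.refl, h.trans⟩⟩
  · exact h.2.2.1 y (by omega) x (by omega)
  · exact h.2.2.2.1 y hy x (by omega)
  · exact h.step x y (by omega) (by omega)
  · exact h.col x y (by omega) hy

theorem primrecPred_success (hφ : Primrec φ) (hn : Primrec n) (hH : Primrec H) :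
    PrimrecPred fun a => (arena (φ a) (spo a)).Success (n a) (label (H a)) :=
  primrecPred_and (by fun_prop) (primrecPred_and (primrecPred_valid hφ hn hH)
    (primrecPred_forall_lt hn (primrecPred_final (by fun_prop) (by fun_prop))))

theorem primrecPred_subsumed (hφ : Primrec φ) (hn : Primrec n) (hH : Primrec H) :
    PrimrecPred fun a => (arena (φ a) (spo a)).Subsumed (n a) (H a) := by
  unfold Arena.Subsumed Arena.Embed
  repeat' first
    | with_reducible refine primrecPred_and ?_ ?_
    | with_reducible refine primrecPred_not ?_
    | with_reducible refine primrecPred_iff ?_ ?_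
    | with_reducible refine primrecPred_forall_lt ?_ ?_
    | with_reducible refine primrecPred_exists_lt ?_ ?_
    | with_reducible refine primrecPred_exists_mem ?_ ?_
    | with_reducible refine primrecPred_imp ?_ ?_
    | with_reducible refine primrecPred_rel ?_ ?_ ?_ ?_
    | fun_prop

theorem primrecPred_winRule (hφ : Primrec φ) (hs : Primrec spo) (hp : Primrec p)
    (hW : Primrec W) :
    PrimrecPred fun a => (arena (φ a) (spo a)).WinRule (p a) (· ∈ W a) := by
  unfold Arena.WinRule
  repeat' first
    | with_reducible refine primrecPred_and ?_ ?_
    | with_reducible refine primrecPred_or ?_ ?_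
    | with_reducible refine primrecPred_not ?_
    | with_reducible refine primrecPred_forall_lt ?_ ?_
    | with_reducible refine primrecPred_exists_mem ?_ ?_
    | with_reducible refine primrecPred_forall_mem ?_ ?_
    | with_reducible refine primrecPred_imp ?_ ?_
    | with_reducible refine primrecPred_success ?_ ?_ ?_
    | with_reducible refine primrec_opts ?_
    | with_reducible refine primrec_menu ?_ ?_ ?_
    | fun_prop

theorem primrecPred_loseRule (hφ : Primrec φ) (hs : Primrec spo) (hp : Primrec p)
    (hW : Primrec W) :
    PrimrecPred fun a => (arena (φ a) (spo a)).LoseRule (p a) (· ∈ W a) := by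
  unfold Arena.LoseRule
  repeat' first
    | with_reducible refine primrecPred_and ?_ ?_
    | with_reducible refine primrecPred_or ?_ ?_
    | with_reducible refine primrecPred_not ?_
    | with_reducible refine primrecPred_exists_lt ?_ ?_
    | with_reducible refine primrecPred_exists_mem ?_ ?_
    | with_reducible refine primrecPred_forall_mem ?_ ?_
    | with_reducible refine primrecPred_valid ?_ ?_ ?_
    | with_reducible refine primrecPred_success ?_ ?_ ?_
    | with_reducible refine primrecPred_subsumed ?_ ?_ ?_
    | with_reducible refine primrec_opts ?_
    | with_reducible refine primrec_menu ?_ ?_ ?_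
    | fun_prop

end PrimrecGame

/-! ### Decidability -/

/-- Positive instances have finite certificates that can be checked. -/
theorem finiteSynthesisProblem_iff (x : Formula × List Formula) :
    FiniteSynthesisProblem x ↔ ∃ W : List (Position (List Formula)),
      (∀ f ∈ x.2, f ∈ alphabetList x.1) ∧ (0, []) ∈ W ∧
        ∀ q ∈ W, (arena x.1 x.2).WinRule q (· ∈ W) := by
  rw [FiniteSynthesisProblem, admitsFiniteSynthesis_iff, Arena.derivable_winRule_iff,
    exists_and_left]
  simp only [Finset.subset_iff, List.mem_toFinset, mem_alphabetList]

/-- Negative instances have finite certificates that can be checked. -/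
theorem not_finiteSynthesisProblem_iff (x : Formula × List Formula) :
    ¬ FiniteSynthesisProblem x ↔ ∃ W : List (Position (List Formula)),
      ¬ (∀ f ∈ x.2, f ∈ alphabetList x.1) ∨ ((0, []) ∈ W ∧
        ∀ q ∈ W, (arena x.1 x.2).LoseRule q (· ∈ W)) := by
  rw [FiniteSynthesisProblem, not_and_or, not_admitsFiniteSynthesis_iff,
    Arena.derivable_loseRule_iff, exists_or, exists_const]
  simp only [Finset.subset_iff, List.mem_toFinset, mem_alphabetList]

end ABBSim

theorem mainTheorem1 : ComputablePred ABBSim.FiniteSynthesisProblem := by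
  rw [ComputablePred.computable_iff_re_compl_re']
  constructor
  · refine (ABBSim.rePred_exists ?_).of_eq fun x => (ABBSim.finiteSynthesisProblem_iff x).symm
    refine ABBSim.primrecPred_and (ABBSim.primrecPred_forall_mem (by fun_prop) (by fun_prop))
      (ABBSim.primrecPred_and (by fun_prop) (ABBSim.primrecPred_forall_mem (by fun_prop)
        (ABBSim.primrecPred_winRule ?_ ?_ ?_ ?_))) <;> fun_prop
  · refine (ABBSim.rePred_exists ?_).of_eq fun x => (ABBSim.not_finiteSynthesisProblem_iff x).symm
    refine ABBSim.primrecPred_or (ABBSim.primrecPred_not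
      (ABBSim.primrecPred_forall_mem (by fun_prop) (by fun_prop)))
      (ABBSim.primrecPred_and (by fun_prop) (ABBSim.primrecPred_forall_mem (by fun_prop)
        (ABBSim.primrecPred_loseRule ?_ ?_ ?_ ?_))) <;> fun_prop
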